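/- **Setting.** Let $\gamma,\delta\in\mathbb R$, let $\lambda_1,\lambda_2\in\mathbb C$ with $\lambda_i=\lambda_{iR}+\mathrm i\lambda_{iI}$, $\lambda_{iI}>0$, let $n_1,n_2\ge 1$ be integers, $N=n_1+n_2$, and let $a_i^{[j]}\in\mathbb C$ ($i=1,2$, $0\le j\le n_i-1$) be constants. For $x,t\in\mathbb R$ put $$\theta^{[i]}(\lambda)=\mathrm i\lambda\bigl(x+(2\gamma\lambda+4\delta\lambda^2)t\bigr)+\sum_{j=0}^{n_i-1}a_i^{[j]}(\lambda-\lambda_i)^j-\frac{\mathrm i\pi}{4},\qquad \theta_i=\theta^{[i]}(\lambda_i),$$ $$\Phi_i^{[m]}=\begin{bmatrix}\frac1{m!}\frac{d^m}{d\lambda^m}e^{2\theta^{[i]}(\lambda)}\big|_{\lambda=\lambda_i}\\ \delta_{m,0}\end{bmatrix}\in\mathbb C^2 .$$ Let $\mathbf Y=[\Phi_1^{[0]},\dots,\Phi_1^{[n_1-1]},\Phi_2^{[0]},\dots,\Phi_2^{[n_2-1]}]$ (a $2\times N$ matrix with rows $\mathbf Y_1,\mathbf Y_2$), let $\mathbf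 X=\mathrm{diag}(\mathbf X_1,\mathbf X_2)$, where $\mathbf X_i$ is the $n_i\times n_i$ upper triangular block Toeplitz matrix with blocks $\Phi_i^{[q-p]}$ ($0\le p\le q\le n_i-1$), let $\mathbf S=(\mathbf S_{ij})_{i,j=1,2}$, where $\mathbf S_{ij}$ has the $2\times2$ blocks $\binom{r+s}{r}\frac{(-1)^r}{(\lambda_i^*-\lambda_j)^{r+s+1}}\mathbb I_2$ ($0\le r\le n_i-1$, $0\le s\le n_j-1$), and let $\mathbf M=\mathbf X^\dagger\mathbf S\mathbf X$. The high order soliton of the Hirota equation $\mathrm i q_t+\gamma(q_{xx}+2|q|^2q)+\mathrm i\delta(q_{xxx}+6|q|^2q_x)=0$ with these data is $$q^{[N]}(x,t)=2\,\mathbf Y_2\mathbf M^{-1}\mathbf Y_1^\dagger .$$ Put $$v_i=-4(\lambda_{iR}\gamma-\lambda_{iI}^2\delta+3\lambda_{iR}^2\delta),\qquad \mathscr C_i=16\delta\lambda_{iI}^2+8\mathrm i\gamma\lambda_{iI}+48\mathrm i\delta\lambda_{iR}\lambda_{iI},$$ $$u_1=\frac{\lambda_1-\lambda_2^*}{\lambda_1-\lambda_2},\qquad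 u_2=\frac{\lambda_2-\lambda_1}{\lambda_2-\lambda_1^*},$$ and, for $\{i,j\}=\{1,2\}$ and integers $\kappa$, $$\Delta^{[\kappa]}_{i,l}=\log\frac{(n_i-\kappa)!}{(\kappa-1)!}-(n_i+1-2\kappa)\log\bigl(2\lambda_{iI}|\mathscr C_i|\bigr)-n_j\,\mathrm{sgn}(j-i)\log\left|\frac{\lambda_i-\lambda_j}{\lambda_i-\lambda_j^*}\right|,$$ $$\Delta^{[\kappa]}_{i,r}=\log\frac{(n_i-\kappa)!}{(\kappa-1)!}-(n_i+1-2\kappa)\log\bigl(2\lambda_{iI}|\mathscr C_i|\bigr)+n_j\,\mathrm{sgn}(j-i)\log\left|\frac{\lambda_i-\lambda_j}{\lambda_i-\lambda_j^*}\right|,$$ $$s_{i,l,\pm}=x\mp\frac{n_i+1-2\kappa}{2\lambda_{iI}}\log|t|-v_it,\qquad s_{i,r,\pm}=x\pm\frac{n_i+1-2\kappa}{2\lambda_{iI}}\log|t|-v_it .$$ **Theorem.** Suppose $v_1<v_2$. Then, as $t\to\pm\infty$ (upper signs for $t\to+\infty$, lower signs for $t\to-\infty$), uniformly in $x\in\mathbb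 R$, $$\begin{aligned}q^{[N]}(x,t)=\sum_{\substack{i=1,2\\ j=3-i}}\Biggl[&\sum_{\kappa=1}^{\lfloor (n_i+1)/2\rfloor}2\lambda_{iI}\,\mathrm{sech}\bigl(2\lambda_{iI}s_{i,l,\pm}\pm\Delta^{[\kappa]}_{i,l}-2\,\mathrm{Re}\,a_i^{[0]}\bigr)\,e^{-2\mathrm i\,\mathrm{Im}\,\theta_i\pm\mathrm i(n_i+1-2\kappa)\arg\mathscr C_i\pm\mathrm i n_j\arg u_i+\mathrm i\pi(\frac12+\kappa)}\\&+\sum_{\kappa=1}^{\lfloor n_i/2\rfloor}2\lambda_{iI}\,\mathrm{sech}\bigl(2\lambda_{iI}s_{i,r,\pm}\mp\Delta^{[\kappa]}_{i,r}-2\,\mathrm{Re}\,a_i^{[0]}\bigr)\,e^{-2\mathrm i\,\mathrm{Im}\,\theta_i\mp\mathrm i(n_i+1-2\kappa)\arg\mathscr C_i\pm\mathrm i n_j\arg u_i+\mathrm i\pi(n_i-\frac12+\kappa)}\Biggr]+O\!\left(\frac{\log|t|}{|t|}\right),\end{aligned}$$ where the constant in the error term may depend on $\gamma,\delta,\lambda_i,n_i,a_i^{[j]}$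 but not on $x$ and $t$. -/

import Mathlib

namespace HirotaSoliton

open Complex Matrix

noncomputable section

/-! ### The high order soliton built on the zero seed

`γ δ` are the coefficients of the Hirota equation, `lam i` are the spectral parameters, `n i` is the
order attached to `lam i`, and `a i j` (for `j < n i`) are the free constants `a_i^{[j]}`. Constants
`a i j` with `n i ≤ j` are never used when `n i ≥ 1`. For distinct `lam i` in the open upper half
plane the matrix `M` below is invertible for all `x t` (it is skew-Hermitian and definite). -/

/-- The phase
`θ(z) = i z (x + (2 γ z + 4 δ z²) t) + ∑_{j < n} a_j (z - lam)^j - i π / 4`. -/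
def theta (γ δ : ℝ) (lam : ℂ) (n : ℕ) (a : ℕ → ℂ) (x t : ℝ) (z : ℂ) : ℂ :=
  I * z * (x + (2 * γ * z + 4 * δ * z ^ 2) * t)
    + ∑ j ∈ Finset.range n, a j * (z - lam) ^ j - I / 4 * Real.pi

/-- The vector `Φ^{[m]}`: its first entry is the `m`-th Taylor coefficient of `exp (2 θ)` at `lam`,
its second entry is `δ_{m,0}`. -/
def phi (γ δ : ℝ) (lam : ℂ) (n : ℕ) (a : ℕ → ℂ) (x t : ℝ) (m : ℕ) : Fin 2 → ℂ :=
  ![1 / (m.factorial : ℂ) *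
      iteratedDeriv m (fun z => Complex.exp (2 * theta γ δ lam n a x t z)) lam,
    if m = 0 then 1 else 0]

/-- Index set of the columns: pairs (spectral parameter, position in its block). The total number
of columns is `N = ∑ i, n i`. -/
abbrev Idx {k : ℕ} (n : Fin k → ℕ) : Type := (i : Fin k) × Fin (n i)

/-- The `2 × N` matrix `Y`, whose columns are the vectors `Φ_i^{[p]}`. -/
def matY {k : ℕ} (γ δ : ℝ) (lam : Fin k → ℂ) (n : Fin k → ℕ) (a : Fin k → ℕ → ℂ) (x t : ℝ) :
    Matrix (Fin 2) (Idx n) ℂ :=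
  Matrix.of fun c p => phi γ δ (lam p.1) (n p.1) (a p.1) x t p.2 c

/-- The `2N × N` block diagonal matrix `X`; its `i`-th block is the upper triangular block Toeplitz
matrix with the vector `Φ_i^{[q - p]}` at the place `(p, q)`, `p ≤ q`. -/
def matX {k : ℕ} (γ δ : ℝ) (lam : Fin k → ℂ) (n : Fin k → ℕ) (a : Fin k → ℕ → ℂ) (x t : ℝ) :
    Matrix (Idx n × Fin 2) (Idx n) ℂ :=
  Matrix.of fun p q =>
    if p.1.1 = q.1 ∧ (p.1.2 : ℕ) ≤ (q.2 : ℕ) then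
      phi γ δ (lam q.1) (n q.1) (a q.1) x t ((q.2 : ℕ) - (p.1.2 : ℕ)) p.2
    else 0

/-- The `2N × 2N` matrix `S`; the `2 × 2` block at the place `(r, s)` of its `(i, j)` block is
`(-1)^r binom(r + s, r) / (lam_i^* - lam_j)^(r + s + 1)` times the identity (`r, s` count from `0`). -/
def matS {k : ℕ} (lam : Fin k → ℂ) (n : Fin k → ℕ) :
    Matrix (Idx n × Fin 2) (Idx n × Fin 2) ℂ :=
  Matrix.of fun p q =>
    if p.2 = q.2 then
      ((((p.1.2 : ℕ) + (q.1.2 : ℕ)).choose (p.1.2 : ℕ) : ℕ) : ℂ) * (-1) ^ (p.1.2 : ℕ)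
        / (star (lam p.1.1) - lam q.1.1) ^ ((p.1.2 : ℕ) + (q.1.2 : ℕ) + 1)
    else 0

/-- The `N × N` matrix `M = X† S X`. -/
def matM {k : ℕ} (γ δ : ℝ) (lam : Fin k → ℂ) (n : Fin k → ℕ) (a : Fin k → ℕ → ℂ) (x t : ℝ) :
    Matrix (Idx n) (Idx n) ℂ :=
  (matX γ δ lam n a x t)ᴴ * matS lam n * matX γ δ lam n a x t

/-- The high order soliton `q^{[N]} = 2 Y₂ M⁻¹ Y₁†`, with `Y₁`, `Y₂` the two rows of `Y`. -/
def soliton {k : ℕ} (γ δ : ℝ) (lam : Fin k → ℂ) (n : Fin k → ℕ) (a : Fin k → ℕ → ℂ)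
    (x t : ℝ) : ℂ :=
  2 * (matY γ δ lam n a x t 1 ⬝ᵥ ((matM γ δ lam n a x t)⁻¹ *ᵥ star (matY γ δ lam n a x t 0)))

/-! ### The asymptotic solitons -/

/-- The velocity `v = -4 (γ λ_R - δ λ_I² + 3 δ λ_R²)`. -/
def velocity (γ δ : ℝ) (lam : ℂ) : ℝ :=
  -4 * (lam.re * γ - lam.im ^ 2 * δ + 3 * lam.re ^ 2 * δ)

/-- The constant `𝒞 = 16 δ λ_I² + 8 i γ λ_I + 48 i δ λ_R λ_I`. -/
def constC (γ δ : ℝ) (lam : ℂ) : ℂ :=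
  16 * δ * (lam.im : ℂ) ^ 2 + 8 * I * γ * lam.im + 48 * I * δ * lam.re * lam.im

/-- Hyperbolic secant. -/
def sech (y : ℝ) : ℝ := 1 / Real.cosh y

/-- The shift
`log ((n_i - κ)! / (κ - 1)!) - (n_i + 1 - 2 κ) log (2 λ_{iI} |𝒞_i|)
  - n_j sgn (j - i) log |(λ_i - λ_j) / (λ_i - λ_j^*)|` of the solitons of the first kind. -/
def shiftL (γ δ : ℝ) (lam : Fin 2 → ℂ) (n : Fin 2 → ℕ) (i j : Fin 2) (κ : ℕ) : ℝ :=
  Real.log (((n i - κ).factorial : ℝ) / ((κ - 1).factorial : ℝ))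
    - ((n i : ℝ) + 1 - 2 * κ) * Real.log (2 * (lam i).im * ‖constC γ δ (lam i)‖)
    - n j * SignType.sign ((j : ℝ) - (i : ℝ))
        * Real.log ‖(lam i - lam j) / (lam i - star (lam j))‖

/-- The shift of the solitons of the second kind: the interaction term has the opposite sign. -/
def shiftR (γ δ : ℝ) (lam : Fin 2 → ℂ) (n : Fin 2 → ℕ) (i j : Fin 2) (κ : ℕ) : ℝ :=
  Real.log (((n i - κ).factorial : ℝ) / ((κ - 1).factorial : ℝ))
    - ((n i : ℝ) + 1 - 2 * κ) * Real.log (2 * (lam i).im * ‖constC γ δ (lam i)‖)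
    + n j * SignType.sign ((j : ℝ) - (i : ℝ))
        * Real.log ‖(lam i - lam j) / (lam i - star (lam j))‖

/-- `θ_i = θ^{[i]}(λ_i)`. -/
def thetaAt (γ δ : ℝ) (lam : Fin 2 → ℂ) (n : Fin 2 → ℕ) (a : Fin 2 → ℕ → ℂ) (i : Fin 2)
    (x t : ℝ) : ℂ :=
  theta γ δ (lam i) (n i) (a i) x t (lam i)

/-- The `κ`-th soliton of the first kind with parameter `λ_i`, for the sign `σ = ±1` of `t`. The
number `u` carries the interaction phase `σ (n_j / 2) arg (u / u^*)`. A half-argument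
`arg (w / w^*) / 2` is `arg w`; the quotient `w / w^*` alone would lose the sign of `w`. -/
def solitonL (γ δ : ℝ) (lam : Fin 2 → ℂ) (n : Fin 2 → ℕ) (a : Fin 2 → ℕ → ℂ) (σ : ℝ)
    (i j : Fin 2) (u : ℂ) (κ : ℕ) (x t : ℝ) : ℂ :=
  let s : ℝ := x - σ * (((n i : ℝ) + 1 - 2 * κ) / (2 * (lam i).im)) * Real.log |t|
    - velocity γ δ (lam i) * t
  let phase : ℝ := -2 * (thetaAt γ δ lam n a i x t).im
    + σ * ((n i : ℝ) + 1 - 2 * κ) * arg (constC γ δ (lam i))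
    + σ * n j * arg u + Real.pi * (1 / 2 + κ)
  ((2 * (lam i).im * sech (2 * (lam i).im * s + σ * shiftL γ δ lam n i j κ
    - 2 * (a i 0).re) : ℝ) : ℂ) * Complex.exp (I * phase)

/-- The `κ`-th soliton of the second kind with parameter `λ_i`. -/
def solitonR (γ δ : ℝ) (lam : Fin 2 → ℂ) (n : Fin 2 → ℕ) (a : Fin 2 → ℕ → ℂ) (σ : ℝ)
    (i j : Fin 2) (u : ℂ) (κ : ℕ) (x t : ℝ) : ℂ :=
  let s : ℝ := x + σ * (((n i : ℝ) + 1 - 2 * κ) / (2 * (lam i).im)) * Real.log |t|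
    - velocity γ δ (lam i) * t
  let phase : ℝ := -2 * (thetaAt γ δ lam n a i x t).im
    - σ * ((n i : ℝ) + 1 - 2 * κ) * arg (constC γ δ (lam i))
    + σ * n j * arg u + Real.pi * ((n i : ℝ) - 1 / 2 + κ)
  ((2 * (lam i).im * sech (2 * (lam i).im * s - σ * shiftR γ δ lam n i j κ
    - 2 * (a i 0).re) : ℝ) : ℂ) * Complex.exp (I * phase)

/-- The sum of the `n 0 + n 1` asymptotic solitons, for the sign `σ = ±1` of `t`. -/
def asymptoticSum (γ δ : ℝ) (lam : Fin 2 → ℂ) (n : Fin 2 → ℕ) (a : Fin 2 → ℕ → ℂ) (σ : ℝ)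
    (x t : ℝ) : ℂ :=
  let u₁ : ℂ := (lam 0 - star (lam 1)) / (lam 0 - lam 1)
  let u₂ : ℂ := (lam 1 - lam 0) / (lam 1 - star (lam 0))
  (∑ κ ∈ Finset.Icc 1 ((n 0 + 1) / 2), solitonL γ δ lam n a σ 0 1 u₁ κ x t)
    + (∑ κ ∈ Finset.Icc 1 (n 0 / 2), solitonR γ δ lam n a σ 0 1 u₁ κ x t)
    + (∑ κ ∈ Finset.Icc 1 ((n 1 + 1) / 2), solitonL γ δ lam n a σ 1 0 u₂ κ x t)
    + (∑ κ ∈ Finset.Icc 1 (n 1 / 2), solitonR γ δ lam n a σ 1 0 u₂ κ x t)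

end

end HirotaSoliton

/-!
# Asymptotics of the two-parameter high order soliton

Stacking the Taylor coefficients of `exp (2 θ)` into upper triangular Toeplitz matrices, one for
each spectral parameter, gives a block diagonal matrix `T`, and the soliton becomes the matrix
element `-2 i e (G + T† G T)⁻¹ T† e†` (`soliton_eq_amplitude_gramTwo`). Here `G` is the Gram matrix
on the half line of the exponential polynomials `(i y)^r / r! · exp (i λ y)`, and `e` is the row of
their values at `0`. The matrix `G` is positive definite: its kernel is stable under the Jordan
matrix and is annihilated by `e`, which leaves no room for an eigenvector (`posDef_gramTwo`).

Everything rests on the map `T ↦ (P + T† Q T)⁻¹ T†`, for `P` and `Q` positive definite. It is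
bounded by a constant, by a multiple of `‖T‖` and by a multiple of `‖T⁻¹‖`, and it is Lipschitz in
`P` and `Q` uniformly in `T`. Hence changes of basis of `P` and `Q` that become close to the
identity after being moved across `T` may be carried out at the cost of a small error, whatever the
size of `T` (`isBigO_transfer_sub_of_conj`). This principle is used twice.

* Two blocks with different velocities separate. Since `s' - s` grows linearly in time, at every
  position either both blocks are small, or both inverses are, or the inverse of the faster block
  times the slower one is small. In the last case block elimination on the two sides, with opposite
  pivots, decouples the system; each block keeps its own Toeplitz matrix, and one of its two forms
  is replaced by a Schur complement (`isBigO_amplitude_fromBlocks_sub`).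

* Near the trajectory of one block, `s = O(log |t|)`, the Toeplitz symbol is `exp (2 θ) · exp (τ X)`
  up to a relative error `O(log |t| / |t|)`, with `τ` proportional to `t`. After reversing the
  columns this Toeplitz matrix is, up to factors close to the identity, diagonal with the entries
  `exp (2 θ) (-1)^p p! / (m - p)! τ^(m - 2 p)`, because the Hankel matrix `1 / (m - p - q)!` has an
  explicit triangular factorization (`exists_toeplitz_mul_reversal_eq`). These entries are of
  different orders in `t`, so Gram–Schmidt diagonalises `P` and `Q` as well, and the matrix element
  splits into `m + 1` scalar `sech` profiles (`isBigO_transfer_toeplitz_sub_peaks`).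

The constants come out in closed form because all the forms that occur satisfy a displacement
equation `J† Q - Q J = -i b† b` with `J` a Jordan block. Schur complements inherit it
(`schur_displacement`), it makes the values `b` in the orthogonal basis a geometric progression that
determines the norms (`Displacement.vecMul_eq`), and through the matrix determinant lemma the first
entry of `b` for a Schur complement is a power of a Blaschke factor (`schur_firstRow_eq`). This
factor is the interaction shift; the rest of each profile is matched with the two families of
asymptotic solitons in `sum_solitons_eq_sum_peaks`.
-/

namespace HirotaSoliton
open Complex Matrix

noncomputable section

open Filter Asymptotics Topology
open scoped Matrix.Norms.L2Operator ComplexOrder ComplexConjugate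

/-! ### Transfer matrices of coercive forms -/

section Transfer

variable {ι : Type*} [Fintype ι] [DecidableEq ι]

/-- The transfer matrix `(P + T† Q T)⁻¹ T†`. It is only used for positive definite `P` and
`Q`, where the inverse is a genuine one. -/
def transfer (P T Q : Matrix ι ι ℂ) : Matrix ι ι ℂ := (P + Tᴴ * Q * T)⁻¹ * Tᴴ

/-- `P` is coercive with constant `c` if `c ‖v‖² ≤ Re ⟨v, P v⟩` for all vectors `v`. -/
def Coercive (c : ℝ) (P : Matrix ι ι ℂ) : Prop :=
  ∀ v : EuclideanSpace ℂ ι, c * ‖v‖ ^ 2 ≤ (inner ℂ v (toEuclideanCLM (𝕜 := ℂ) P v)).re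

theorem Coercive.of_norm_sub_le {c d : ℝ} {P P' : Matrix ι ι ℂ} (h : Coercive c P)
    (hd : ‖P' - P‖ ≤ d) : Coercive (c - d) P' := by
  intro v
  have h1 := h v
  have h2 : ‖inner ℂ v (toEuclideanCLM (𝕜 := ℂ) (P' - P) v)‖ ≤ d * ‖v‖ ^ 2 := by
    refine (norm_inner_le_norm _ _).trans ?_
    have h3 := (toEuclideanCLM (𝕜 := ℂ) (P' - P)).le_opNorm v
    rw [l2_opNorm_toEuclideanCLM] at h3
    have h4 : ‖P' - P‖ * ‖v‖ ≤ d * ‖v‖ := by gcongr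
    nlinarith [norm_nonneg v]
  have h5 := (abs_le.1 ((abs_re_le_norm _).trans h2)).1
  rw [map_sub, _root_.sub_apply, inner_sub_right, sub_re] at h5
  nlinarith

theorem exists_coercive_of_posDef {P : Matrix ι ι ℂ} (hP : P.PosDef) :
    ∃ c, 0 < c ∧ Coercive c P := by
  rcases isEmpty_or_nonempty ι with hι | hι
  · refine ⟨1, one_pos, fun v => ?_⟩
    have : v = 0 := Subsingleton.elim _ _
    simp [this]
  have hcont : Continuous fun v : EuclideanSpace ℂ ι =>
      (inner ℂ v (toEuclideanCLM (𝕜 := ℂ) P v)).re := by fun_prop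
  obtain ⟨v₀, hv₀, hmin⟩ := (isCompact_sphere (0 : EuclideanSpace ℂ ι) 1).exists_isMinOn
    (NormedSpace.sphere_nonempty.2 zero_le_one) hcont.continuousOn
  have hpos : ∀ v : EuclideanSpace ℂ ι, v ≠ 0 →
      0 < (inner ℂ v (toEuclideanCLM (𝕜 := ℂ) P v)).re := by
    intro v hv
    have hv' : (v : ι → ℂ) ≠ 0 := fun h => hv (by ext i; simpa using congrFun h i)
    have := hP.dotProduct_mulVec_pos hv'
    rw [EuclideanSpace.inner_eq_star_dotProduct, ofLp_toEuclideanCLM, dotProduct_comm]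
    exact (Complex.pos_iff.1 this).1
  refine ⟨_, hpos v₀ (by rintro rfl; simp at hv₀), fun v => ?_⟩
  rcases eq_or_ne v 0 with rfl | hv
  · simp
  have hn : 0 < ‖v‖ := norm_pos_iff.2 hv
  have hmem : ((‖v‖⁻¹ : ℝ) : ℂ) • v ∈ Metric.sphere (0 : EuclideanSpace ℂ ι) 1 := by
    simp [norm_smul, hn.ne']
  have h1 : _ ≤ (inner ℂ _ (toEuclideanCLM (𝕜 := ℂ) P _)).re := hmin hmem
  simp only [map_smul, inner_smul_left, inner_smul_right, conj_ofReal, re_ofReal_mul] at h1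
  have h1' := mul_le_mul_of_nonneg_right h1 (sq_nonneg ‖v‖)
  refine h1'.trans (le_of_eq ?_)
  field_simp

section Bounds

variable {c : ℝ} {P T Q : Matrix ι ι ℂ}

theorem Coercive.add_conj (hP : Coercive c P) (hQ : Coercive c Q) (T : Matrix ι ι ℂ)
    (v : EuclideanSpace ℂ ι) :
    c * (‖v‖ ^ 2 + ‖toEuclideanCLM (𝕜 := ℂ) T v‖ ^ 2) ≤
      (inner ℂ v (toEuclideanCLM (𝕜 := ℂ) (P + Tᴴ * Q * T) v)).re := by
  have h1 := hP v
  have h2 := hQ (toEuclideanCLM (𝕜 := ℂ) T v)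
  rw [← star_eq_conjTranspose, map_add, map_mul, map_mul, map_star, _root_.add_apply,
    inner_add_right, add_re, mul_apply_eq_comp, mul_apply_eq_comp,
    ContinuousLinearMap.star_eq_adjoint, ContinuousLinearMap.adjoint_inner_right]
  linarith

theorem Coercive.isUnit_det (hc : 0 < c) (hP : Coercive c P) (hQ : Coercive c Q)
    (T : Matrix ι ι ℂ) : IsUnit (P + Tᴴ * Q * T).det := by
  rw [← isUnit_iff_isUnit_det, ← mulVec_injective_iff_isUnit]
  refine (injective_iff_map_eq_zero (mulVecLin (P + Tᴴ * Q * T))).2 fun v hv => ?_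
  have h := hP.add_conj hQ T (WithLp.toLp 2 v)
  rw [mulVecLin_apply] at hv
  rw [toEuclideanCLM_toLp (P + _), hv, WithLp.toLp_zero, inner_zero_right, zero_re] at h
  have h1 : ‖WithLp.toLp 2 v‖ = 0 := by
    by_contra hne
    have : 0 < ‖WithLp.toLp 2 v‖ ^ 2 := by positivity
    nlinarith [sq_nonneg ‖toEuclideanCLM (𝕜 := ℂ) T (WithLp.toLp 2 v)‖]
  simpa using norm_eq_zero.1 h1

theorem l2_opNorm_le_of_forall {A : Matrix ι ι ℂ} {C : ℝ} (hC : 0 ≤ C)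
    (h : ∀ v : EuclideanSpace ℂ ι, ‖toEuclideanCLM (𝕜 := ℂ) A v‖ ≤ C * ‖v‖) : ‖A‖ ≤ C := by
  rw [← l2_opNorm_toEuclideanCLM]
  exact ContinuousLinearMap.opNorm_le_bound _ hC h

theorem norm_inv_le (hc : 0 < c) (hP : Coercive c P)
    (hQ : Coercive c Q) : ‖(P + Tᴴ * Q * T)⁻¹‖ ≤ c⁻¹ := by
  refine l2_opNorm_le_of_forall (by positivity) fun y => ?_
  set x := toEuclideanCLM (𝕜 := ℂ) (P + Tᴴ * Q * T)⁻¹ y with hx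
  have hWx : toEuclideanCLM (𝕜 := ℂ) (P + Tᴴ * Q * T) x = y := by
    rw [hx, ← mul_apply_eq_comp, ← map_mul,
      mul_nonsing_inv _ (hP.isUnit_det hc hQ T), map_one, one_apply_eq_self]
  have h := hP.add_conj hQ T x
  rw [hWx] at h
  have h2 := (re_le_norm _).trans (norm_inner_le_norm (𝕜 := ℂ) x y)
  rw [inv_mul_eq_div, le_div_iff₀ hc]
  by_contra! hlt
  have hx0 : 0 < ‖x‖ := by
    by_contra! h0
    nlinarith [norm_nonneg y, norm_nonneg x]
  nlinarith [sq_nonneg ‖toEuclideanCLM (𝕜 := ℂ) T x‖]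

/-- Bounds independent of `T`: pairing `(P + T† Q T) x = T† z` with `x` gives
`c (‖x‖² + ‖T x‖²) ≤ Re ⟨T x, z⟩`, which bounds first `T x` and then `x`. -/
theorem norm_transfer_and_mul_transfer_le (hc : 0 < c) (hP : Coercive c P)
    (hQ : Coercive c Q) :
    ‖transfer P T Q‖ ≤ c⁻¹ ∧ ‖T * transfer P T Q‖ ≤ c⁻¹ := by
  have key : ∀ z : EuclideanSpace ℂ ι,
      ‖toEuclideanCLM (𝕜 := ℂ) (transfer P T Q) z‖ ≤ c⁻¹ * ‖z‖ ∧
      ‖toEuclideanCLM (𝕜 := ℂ) (T * transfer P T Q) z‖ ≤ c⁻¹ * ‖z‖ := by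
    intro z
    rw [map_mul, mul_apply_eq_comp]
    set x := toEuclideanCLM (𝕜 := ℂ) (transfer P T Q) z with hx
    have hWx : toEuclideanCLM (𝕜 := ℂ) (P + Tᴴ * Q * T) x =
        toEuclideanCLM (𝕜 := ℂ) Tᴴ z := by
      rw [hx, ← mul_apply_eq_comp, ← map_mul, transfer, ← Matrix.mul_assoc,
        mul_nonsing_inv _ (hP.isUnit_det hc hQ T), Matrix.one_mul]
    have h := hP.add_conj hQ T x
    rw [hWx, ← star_eq_conjTranspose, map_star, ContinuousLinearMap.star_eq_adjoint,
      ContinuousLinearMap.adjoint_inner_right] at h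
    have h2 := (re_le_norm _).trans
      (norm_inner_le_norm (𝕜 := ℂ) (toEuclideanCLM (𝕜 := ℂ) T x) z)
    set b := ‖toEuclideanCLM (𝕜 := ℂ) T x‖
    have hb : 0 ≤ b := norm_nonneg _
    have hb1 : b * c ≤ ‖z‖ := by
      by_contra! hlt
      have hb0 : 0 < b := by
        by_contra! h0
        nlinarith [norm_nonneg z]
      nlinarith [sq_nonneg ‖x‖]
    rw [inv_mul_eq_div, le_div_iff₀ hc, le_div_iff₀ hc]
    refine ⟨?_, hb1⟩
    refine le_of_sq_le_sq ?_ (norm_nonneg z)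
    have h3 : c * ‖x‖ ^ 2 ≤ b * ‖z‖ := by nlinarith [sq_nonneg b]
    have h4 : c * (b * ‖z‖) ≤ ‖z‖ ^ 2 := by nlinarith [norm_nonneg z]
    nlinarith
  exact ⟨l2_opNorm_le_of_forall (by positivity) fun z => (key z).1,
    l2_opNorm_le_of_forall (by positivity) fun z => (key z).2⟩

theorem norm_transfer_le_mul_norm (hc : 0 < c) (hP : Coercive c P)
    (hQ : Coercive c Q) : ‖transfer P T Q‖ ≤ c⁻¹ * ‖T‖ := by
  refine (norm_mul_le _ _).trans ?_
  rw [l2_opNorm_conjTranspose]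
  gcongr
  exact norm_inv_le hc hP hQ

/-- If `T` has a small inverse `T'`, the transfer matrix is small, since it equals `T'` times the
bounded matrix `T (P + T† Q T)⁻¹ T†`. -/
theorem norm_transfer_le_mul_norm_inv (hc : 0 < c) (hP : Coercive c P)
    (hQ : Coercive c Q) {T' : Matrix ι ι ℂ} (hT : T' * T = 1) :
    ‖transfer P T Q‖ ≤ c⁻¹ * ‖T'‖ := by
  have : transfer P T Q = T' * (T * transfer P T Q) := by
    rw [← Matrix.mul_assoc, hT, Matrix.one_mul]
  rw [this, mul_comm c⁻¹]
  refine (norm_mul_le _ _).trans ?_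
  gcongr
  exact (norm_transfer_and_mul_transfer_le hc hP hQ).2

/-- The transfer matrix is Lipschitz in `P` and `Q`, uniformly in `T`. -/
theorem norm_transfer_sub_le (hc : 0 < c) (hP : Coercive c P)
    (hQ : Coercive c Q) {P' Q' : Matrix ι ι ℂ} (hP' : Coercive c P') (hQ' : Coercive c Q') :
    ‖transfer P' T Q' - transfer P T Q‖ ≤ c⁻¹ ^ 2 * (‖P' - P‖ + ‖Q' - Q‖) := by
  have hW := hP.isUnit_det hc hQ T
  have hW' := hP'.isUnit_det hc hQ' T
  have : transfer P' T Q' - transfer P T Q =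
      -((P' + Tᴴ * Q' * T)⁻¹ * (P' - P) * transfer P T Q
        + transfer P' T Q' * (Q' - Q) * (T * transfer P T Q)) := by
    have h1 : (P' + Tᴴ * Q' * T)⁻¹ * ((P' + Tᴴ * Q' * T) - (P + Tᴴ * Q * T)) *
        (P + Tᴴ * Q * T)⁻¹ = (P + Tᴴ * Q * T)⁻¹ - (P' + Tᴴ * Q' * T)⁻¹ := by
      rw [Matrix.mul_sub, Matrix.sub_mul, nonsing_inv_mul _ hW', Matrix.one_mul,
        Matrix.mul_assoc _ _ (P + Tᴴ * Q * T)⁻¹,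
        mul_nonsing_inv _ hW, Matrix.mul_one]
    have h2 : transfer P' T Q' - transfer P T Q =
        -(((P + Tᴴ * Q * T)⁻¹ - (P' + Tᴴ * Q' * T)⁻¹) * Tᴴ) := by
      simp only [transfer]; noncomm_ring
    rw [h2, ← h1]
    simp only [transfer]
    noncomm_ring
  rw [this, norm_neg]
  refine (norm_add_le _ _).trans ?_
  have b1 := (norm_transfer_and_mul_transfer_le (T := T) hc hP hQ)
  have b2 := (norm_transfer_and_mul_transfer_le (T := T) hc hP' hQ')
  have b3 := norm_inv_le (T := T) hc hP' hQ'
  have e1 : ‖(P' + Tᴴ * Q' * T)⁻¹ * (P' - P) * transfer P T Q‖ ≤ c⁻¹ * ‖P' - P‖ * c⁻¹ :=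
    (norm_mul_le _ _).trans (mul_le_mul ((norm_mul_le _ _).trans (by gcongr)) b1.1
      (norm_nonneg _) (by positivity))
  have e2 : ‖transfer P' T Q' * (Q' - Q) * (T * transfer P T Q)‖ ≤ c⁻¹ * ‖Q' - Q‖ * c⁻¹ :=
    (norm_mul_le _ _).trans (mul_le_mul ((norm_mul_le _ _).trans (by gcongr; exact b2.1)) b1.2
      (norm_nonneg _) (by positivity))
  nlinarith

end Bounds

/-- A left factor of `T` is absorbed into `Q`. -/
theorem transfer_conj_mul_left (P T Q A : Matrix ι ι ℂ) :
    transfer P (A * T) Q = transfer P T (Aᴴ * Q * A) * Aᴴ := by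
  simp only [transfer, conjTranspose_mul, Matrix.mul_assoc]

/-- An invertible right factor of `T` is absorbed into `P`. -/
theorem transfer_conj_mul_right (P T Q : Matrix ι ι ℂ) {B B' : Matrix ι ι ℂ} (h : B * B' = 1) :
    transfer P (T * B) Q = B' * transfer (B'ᴴ * P * B') T Q := by
  have h' : B' * B = 1 := mul_eq_one_comm.1 h
  have hB : B⁻¹ = B' := inv_eq_right_inv h
  have e : P + (T * B)ᴴ * Q * (T * B) = Bᴴ * (B'ᴴ * P * B' + Tᴴ * Q * T) * B := by
    have h3 : Bᴴ * B'ᴴ = 1 := by rw [← conjTranspose_mul, h', conjTranspose_one]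
    rw [conjTranspose_mul, Matrix.mul_add, Matrix.add_mul]
    congr 1
    · rw [← Matrix.mul_assoc, ← Matrix.mul_assoc, h3, Matrix.one_mul, Matrix.mul_assoc, h',
        Matrix.mul_one]
    · simp only [Matrix.mul_assoc]
  have h4 : Bᴴ⁻¹ * Bᴴ = 1 := by
    rw [← conjTranspose_nonsing_inv, ← conjTranspose_mul, hB, h, conjTranspose_one]
  rw [transfer, e, Matrix.mul_inv_rev, Matrix.mul_inv_rev, hB, transfer, conjTranspose_mul]
  simp only [Matrix.mul_assoc]
  rw [← Matrix.mul_assoc Bᴴ⁻¹, h4, Matrix.one_mul]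

end Transfer

/-! ### Transfer matrices along a filter -/

section Perturbation

variable {ι : Type*} [Fintype ι] [DecidableEq ι] {Ω : Type*} {l : Filter Ω} {g : Ω → ℝ}

theorem norm_entry_le_l2_opNorm (A : Matrix ι ι ℂ) (i j : ι) : ‖A i j‖ ≤ ‖A‖ := by
  have h := l2_opNorm_mulVec A (EuclideanSpace.single j (1 : ℂ))
  rw [PiLp.norm_single, norm_one, mul_one] at h
  refine le_trans ?_ h
  have h2 := PiLp.norm_apply_le (WithLp.toLp 2 (A *ᵥ (EuclideanSpace.single j (1 : ℂ)).ofLp)) i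
  simpa [mulVec_single] using h2

theorem isBigO_matrix_iff {A : Ω → Matrix ι ι ℂ} :
    A =O[l] g ↔ ∀ i j, (fun ω => A ω i j) =O[l] g := by
  refine ⟨fun h i j => (IsBigO.of_norm_le fun ω => norm_entry_le_l2_opNorm _ i j).trans h.norm_left,
    fun h => ?_⟩
  have : A = fun ω => ∑ i, ∑ j, A ω i j • Matrix.single i j (1 : ℂ) := by
    funext ω
    conv_lhs => rw [matrix_eq_sum_single (A ω)]
    simp
  rw [this]
  refine IsBigO.fun_sum fun i _ => IsBigO.fun_sum fun j _ => ?_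
  have := (h i j).smul (isBigO_const_const (Matrix.single i j (1 : ℂ)) (one_ne_zero (α := ℝ)) l)
  simpa using this

theorem tendsto_one_of_isBigO {A : Ω → Matrix ι ι ℂ} (hg : Tendsto g l (𝓝 0))
    (h : (fun ω => A ω - 1) =O[l] g) : Tendsto A l (𝓝 1) := by
  have := (h.trans_tendsto hg).add_const 1
  simpa using this

theorem isBigO_one_of_sub_one {A : Ω → Matrix ι ι ℂ} (hg : Tendsto g l (𝓝 0))
    (h : (fun ω => A ω - 1) =O[l] g) : A =O[l] (fun _ => (1 : ℝ)) :=
  (tendsto_one_of_isBigO hg h).isBigO_one ℝ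

theorem eventually_mul_inv_of_isBigO {A : Ω → Matrix ι ι ℂ} (hg : Tendsto g l (𝓝 0))
    (h : (fun ω => A ω - 1) =O[l] g) : ∀ᶠ ω in l, A ω * (A ω)⁻¹ = 1 := by
  have h1 : {B : Matrix ι ι ℂ | IsUnit B} ∈ 𝓝 (1 : Matrix ι ι ℂ) :=
    Units.isOpen.mem_nhds isUnit_one
  filter_upwards [(tendsto_one_of_isBigO hg h) h1] with ω hω
  exact mul_nonsing_inv _ ((isUnit_iff_isUnit_det _).1 hω)

theorem isBigO_inv_sub_one {A : Ω → Matrix ι ι ℂ} (hg : Tendsto g l (𝓝 0))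
    (h : (fun ω => A ω - 1) =O[l] g) : (fun ω => (A ω)⁻¹ - 1) =O[l] g := by
  -- Inversion is differentiable at `1`, hence Lipschitz there.
  have h1 := (hasFDerivAt_ringInverse (𝕜 := ℂ) (1 : (Matrix ι ι ℂ)ˣ)).isBigO_sub
  have h2 := (h1.comp_tendsto (tendsto_one_of_isBigO hg h)).trans h
  refine h2.congr_left fun ω => ?_
  simp [nonsing_inv_eq_ringInverse]

theorem IsBigO.conjTranspose {A : Ω → Matrix ι ι ℂ} (hA : A =O[l] g) :
    (fun ω => (A ω)ᴴ) =O[l] g :=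
  (IsBigO.of_norm_le fun ω => (l2_opNorm_conjTranspose (A ω)).le).trans hA.norm_left

/-- Multiplying a fixed matrix on both sides by factors close to `1` changes it little. -/
theorem isBigO_conj_sub {A : Ω → Matrix ι ι ℂ} (P : Matrix ι ι ℂ) (hg : Tendsto g l (𝓝 0))
    (hA : (fun ω => A ω - 1) =O[l] g) : (fun ω => (A ω)ᴴ * P * A ω - P) =O[l] g := by
  have hP : (fun _ : Ω => P) =O[l] (fun _ => (1 : ℝ)) := isBigO_const_const _ one_ne_zero _
  have h1 : (fun ω => (A ω)ᴴ - 1) =O[l] g := by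
    refine (IsBigO.conjTranspose hA).congr_left fun ω => by simp
  have e1 := (h1.mul hP).mul (isBigO_one_of_sub_one hg hA)
  have e2 := hP.mul hA
  simp only [mul_one, one_mul] at e1 e2
  refine (e1.add e2).congr_left fun ω => ?_
  simp only [sub_mul, mul_sub, one_mul, mul_one]; abel

theorem isBigO_transfer_one {P Q : Matrix ι ι ℂ} (hP : P.PosDef) (hQ : Q.PosDef)
    (T : Ω → Matrix ι ι ℂ) : (fun ω => transfer P (T ω) Q) =O[l] (fun _ => (1 : ℝ)) := by
  obtain ⟨c, hc, hPc⟩ := exists_coercive_of_posDef hP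
  obtain ⟨d, hd, hQd⟩ := exists_coercive_of_posDef hQ
  have mono : ∀ {a b : ℝ} {R : Matrix ι ι ℂ}, a ≤ b → Coercive b R → Coercive a R :=
    fun hab h v => (mul_le_mul_of_nonneg_right hab (sq_nonneg _)).trans (h v)
  refine IsBigO.of_bound (min c d)⁻¹ (Eventually.of_forall fun ω => ?_)
  simpa using (norm_transfer_and_mul_transfer_le (T := T ω) (lt_min hc hd)
    (mono (min_le_left _ _) hPc) (mono (min_le_right _ _) hQd)).1

theorem isBigO_transfer_of_isBigO {P Q : Matrix ι ι ℂ} (hP : P.PosDef) (hQ : Q.PosDef)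
    {T : Ω → Matrix ι ι ℂ} (hT : T =O[l] g) : (fun ω => transfer P (T ω) Q) =O[l] g := by
  obtain ⟨c, hc, hPc⟩ := exists_coercive_of_posDef hP
  obtain ⟨d, hd, hQd⟩ := exists_coercive_of_posDef hQ
  have mono : ∀ {a b : ℝ} {R : Matrix ι ι ℂ}, a ≤ b → Coercive b R → Coercive a R :=
    fun hab h v => (mul_le_mul_of_nonneg_right hab (sq_nonneg _)).trans (h v)
  refine (IsBigO.of_bound (min c d)⁻¹ (Eventually.of_forall fun ω => ?_)).trans hT
  exact norm_transfer_le_mul_norm (lt_min hc hd)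
    (mono (min_le_left _ _) hPc) (mono (min_le_right _ _) hQd)

theorem isBigO_transfer_of_isBigO_inv {P Q : Matrix ι ι ℂ} (hP : P.PosDef) (hQ : Q.PosDef)
    {T T' : Ω → Matrix ι ι ℂ} (hTT : ∀ ω, T' ω * T ω = 1) (hT : T' =O[l] g) :
    (fun ω => transfer P (T ω) Q) =O[l] g := by
  obtain ⟨c, hc, hPc⟩ := exists_coercive_of_posDef hP
  obtain ⟨d, hd, hQd⟩ := exists_coercive_of_posDef hQ
  have mono : ∀ {a b : ℝ} {R : Matrix ι ι ℂ}, a ≤ b → Coercive b R → Coercive a R :=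
    fun hab h v => (mul_le_mul_of_nonneg_right hab (sq_nonneg _)).trans (h v)
  refine (IsBigO.of_bound (min c d)⁻¹ (Eventually.of_forall fun ω => ?_)).trans hT
  exact norm_transfer_le_mul_norm_inv (lt_min hc hd)
    (mono (min_le_left _ _) hPc) (mono (min_le_right _ _) hQd) (hTT ω)

/-- Small changes of `P` and `Q` change the transfer matrix little, uniformly in `T`. -/
theorem isBigO_transfer_sub {P Q : Matrix ι ι ℂ} (hP : P.PosDef) (hQ : Q.PosDef)
    (hg : Tendsto g l (𝓝 0)) {P' Q' : Ω → Matrix ι ι ℂ} (T : Ω → Matrix ι ι ℂ)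
    (hP' : (fun ω => P' ω - P) =O[l] g) (hQ' : (fun ω => Q' ω - Q) =O[l] g) :
    (fun ω => transfer (P' ω) (T ω) (Q' ω) - transfer P (T ω) Q) =O[l] g := by
  obtain ⟨c, hc, hPc⟩ := exists_coercive_of_posDef hP
  obtain ⟨d, hd, hQd⟩ := exists_coercive_of_posDef hQ
  have mono : ∀ {a b : ℝ} {R : Matrix ι ι ℂ}, a ≤ b → Coercive b R → Coercive a R :=
    fun hab h v => (mul_le_mul_of_nonneg_right hab (sq_nonneg _)).trans (h v)
  set e := min c d with he
  have hepos : 0 < e := lt_min hc hd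
  have hPe : Coercive e P := mono (min_le_left _ _) hPc
  have hQe : Coercive e Q := mono (min_le_right _ _) hQd
  have near : ∀ {R : Matrix ι ι ℂ} {R' : Ω → Matrix ι ι ℂ}, (fun ω => R' ω - R) =O[l] g →
      ∀ᶠ ω in l, ‖R' ω - R‖ ≤ e / 2 := by
    intro R R' h
    have h1 := (h.trans_tendsto hg).norm
    rw [norm_zero] at h1
    exact (h1.eventually (gt_mem_nhds (half_pos hepos))).mono fun ω h => h.le
  have hsum : (fun ω => ‖P' ω - P‖ + ‖Q' ω - Q‖) =O[l] g := hP'.norm_left.add hQ'.norm_left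
  refine (IsBigO.of_bound ((e / 2)⁻¹ ^ 2) ?_).trans hsum
  filter_upwards [near hP', near hQ'] with ω h1 h2
  have h3 := hPe.of_norm_sub_le h1
  have h4 := hQe.of_norm_sub_le h2
  rw [sub_half] at h3 h4
  rw [Real.norm_of_nonneg (by positivity)]
  exact norm_transfer_sub_le (half_pos hepos) (mono (by linarith) hPe)
    (mono (by linarith) hQe) h3 h4

/-- Multiplying `T` on both sides by factors close to `1` changes the transfer matrix little. -/
theorem isBigO_transfer_mul_sub {P Q : Matrix ι ι ℂ} (hP : P.PosDef) (hQ : Q.PosDef)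
    (hg : Tendsto g l (𝓝 0)) {A B : Ω → Matrix ι ι ℂ} (T : Ω → Matrix ι ι ℂ)
    (hA : (fun ω => A ω - 1) =O[l] g) (hB : (fun ω => B ω - 1) =O[l] g) :
    (fun ω => transfer P (A ω * T ω * B ω) Q - transfer P (T ω) Q) =O[l] g := by
  have hB' := isBigO_inv_sub_one hg hB
  have h1 := isBigO_transfer_sub hP hQ hg T (isBigO_conj_sub P hg hB') (isBigO_conj_sub Q hg hA)
  set F := fun ω => transfer P (T ω) Q with hF
  set F' := fun ω => transfer ((B ω)⁻¹ᴴ * P * (B ω)⁻¹) (T ω) ((A ω)ᴴ * Q * A ω) with hF'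
  have hFO : F =O[l] (fun _ => (1 : ℝ)) := isBigO_transfer_one hP hQ T
  have hg1 : g =O[l] (fun _ => (1 : ℝ)) := hg.isBigO_one ℝ
  have hFO' : F' =O[l] (fun _ => (1 : ℝ)) := by
    refine ((h1.trans hg1).add hFO).congr_left fun ω => by simp [hF, hF']
  have hAH : (fun ω => (A ω)ᴴ - 1) =O[l] g :=
    (IsBigO.conjTranspose hA).congr_left fun ω => by simp
  have e1 := (hB'.mul hFO').mul (isBigO_one_of_sub_one hg hAH)
  have e2 := hFO'.mul hAH
  simp only [mul_one, one_mul] at e1 e2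
  refine ((e1.add e2).add h1).congr' ?_ EventuallyEq.rfl
  filter_upwards [eventually_mul_inv_of_isBigO hg hB] with ω hω
  rw [transfer_conj_mul_right _ _ _ hω, transfer_conj_mul_left]
  simp only [hF', sub_mul, mul_sub, one_mul, mul_one, Matrix.mul_assoc]
  abel

/-- If `P` and `Q` are brought to the forms `p` and `q` by congruences `U` and `V` that are almost
invisible after conjugation by `T` (respectively its inverse), then the transfer matrix for `P, Q`
is, up to a small error, obtained from the one for `p, q` by the same changes of basis. -/
theorem isBigO_transfer_sub_of_conj {P Q p q U V : Matrix ι ι ℂ} (hp : p.PosDef) (hq : q.PosDef)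
    (hU : Uᴴ * P * U = p) (hV : Vᴴ * Q * V = q) (hUu : IsUnit U.det)
    (hg : Tendsto g l (𝓝 0)) {T U' V' : Ω → Matrix ι ι ℂ}
    (hTU : ∀ᶠ ω in l, T ω * U = U' ω * T ω) (hTV : ∀ᶠ ω in l, V * T ω = T ω * V' ω)
    (hU' : (fun ω => U' ω - 1) =O[l] g) (hV' : (fun ω => V' ω - 1) =O[l] g) :
    (fun ω => transfer P (T ω) Q - U * transfer p (T ω) q * Vᴴ) =O[l] g := by
  have hc : ∀ R : Matrix ι ι ℂ, (fun _ : Ω => R) =O[l] (fun _ => (1 : ℝ)) :=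
    fun R => isBigO_const_const _ one_ne_zero _
  have hUV : (fun ω => U' ω * V - V) =O[l] g := by
    have := hU'.mul (hc V)
    simp only [mul_one, sub_mul, one_mul] at this
    exact this
  have hQ' : (fun ω => (U' ω * V)ᴴ * Q * (U' ω * V) - q) =O[l] g := by
    have := (hc Vᴴ).mul ((isBigO_conj_sub Q hg hU').mul (hc V))
    simp only [mul_one, one_mul] at this
    refine this.congr_left fun ω => ?_
    rw [← hV, conjTranspose_mul]
    simp only [mul_sub, sub_mul, Matrix.mul_assoc]
  have h1 := isBigO_transfer_sub hp hq hg T (isBigO_conj_sub p hg hV') hQ'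
  set F := fun ω => transfer p (T ω) q with hF
  set F' := fun ω => transfer ((V' ω)ᴴ * p * V' ω) (T ω) ((U' ω * V)ᴴ * Q * (U' ω * V)) with hF'
  have hFO : F =O[l] (fun _ => (1 : ℝ)) := isBigO_transfer_one hp hq T
  have hg1 : g =O[l] (fun _ => (1 : ℝ)) := hg.isBigO_one ℝ
  have hFO' : F' =O[l] (fun _ => (1 : ℝ)) := by
    refine ((h1.trans hg1).add hFO).congr_left fun ω => by simp [hF, hF']
  have hUVH : (fun ω => (U' ω * V)ᴴ - Vᴴ) =O[l] g :=
    (IsBigO.conjTranspose hUV).congr_left fun ω => by simp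
  have hUVb : (fun ω => (U' ω * V)ᴴ) =O[l] (fun _ => (1 : ℝ)) := by
    refine ((hUVH.trans hg1).add (hc Vᴴ)).congr_left fun ω => by simp
  have e1 := (hc U).mul ((hV'.mul hFO').mul hUVb)
  have e2 := (hc U).mul (hFO'.mul hUVH)
  have e3 := (hc U).mul (h1.mul (hc Vᴴ))
  simp only [mul_one, one_mul] at e1 e2 e3
  refine ((e1.add e2).add e3).congr' ?_ EventuallyEq.rfl
  filter_upwards [hTU, hTV, eventually_mul_inv_of_isBigO hg hV'] with ω h2 h3 h4
  have h5 : IsUnit (U * V' ω) := by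
    refine IsUnit.mul ((isUnit_iff_isUnit_det _).2 hUu) ?_
    exact (isUnit_iff_exists_inv.2 ⟨_, h4⟩)
  obtain ⟨u, hu⟩ := h5
  have h6 : (↑u⁻¹ : Matrix ι ι ℂ) * (U * V' ω) = 1 := by rw [← hu, Units.inv_mul]
  have h7 : T ω * (U * V' ω) = U' ω * V * T ω := by
    rw [← Matrix.mul_assoc, h2, Matrix.mul_assoc, ← h3, Matrix.mul_assoc]
  -- `T = (U' V) T (U V')⁻¹`, so the factors can be absorbed into `Q` and `P`.
  have h8 : transfer P (T ω) Q = U * V' ω * F' ω * (U' ω * V)ᴴ := by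
    have h9 : T ω = U' ω * V * T ω * (↑u⁻¹ : Matrix ι ι ℂ) := by
      rw [← h7, ← hu, Matrix.mul_assoc, Units.mul_inv, Matrix.mul_one]
    conv_lhs => rw [h9]
    rw [transfer_conj_mul_right _ _ _ h6, transfer_conj_mul_left, ← Matrix.mul_assoc]
    congr 3
    rw [← hU, conjTranspose_mul]
    simp only [Matrix.mul_assoc]
  rw [h8]
  simp only [hF', sub_mul, mul_sub, one_mul, Matrix.mul_assoc]
  abel

end Perturbation

/-! ### Triangular factorizations -/

section Triangular

variable {n : ℕ}

/-- Upper triangular with ones on the diagonal. -/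
def IsUnitUpper (V : Matrix (Fin n) (Fin n) ℂ) : Prop :=
  (∀ i j, j < i → V i j = 0) ∧ ∀ i, V i i = 1

theorem IsUnitUpper.det {V : Matrix (Fin n) (Fin n) ℂ} (h : IsUnitUpper V) : V.det = 1 := by
  rw [det_of_isUpperTriangular (fun i j hij => h.1 i j hij)]
  simp [h.2]

theorem IsUnitUpper.isUnit_det {V : Matrix (Fin n) (Fin n) ℂ} (h : IsUnitUpper V) :
    IsUnit V.det := by rw [h.det]; exact isUnit_one

theorem IsUnitUpper.inv {V : Matrix (Fin n) (Fin n) ℂ} (h : IsUnitUpper V) :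
    IsUnitUpper V⁻¹ := by
  let : Invertible V := invertibleOfIsUnitDet V h.isUnit_det
  have h1 : BlockTriangular V⁻¹ id :=
    blockTriangular_inv_of_blockTriangular (fun i j hij => h.1 i j hij)
  refine ⟨fun i j hij => h1 hij, fun i => ?_⟩
  have h2 : (V * V⁻¹) i i = 1 := by rw [mul_nonsing_inv _ h.isUnit_det, one_apply_eq]
  rw [mul_apply, Finset.sum_eq_single i] at h2
  · rwa [h.2 i, one_mul] at h2
  · intro k _ hk
    rcases lt_or_gt_of_ne hk with hk | hk
    · rw [h.1 i k hk, zero_mul]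
    · rw [h1 hk, mul_zero]
  · simp

/-- Gram–Schmidt orthogonalisation: a positive definite form becomes diagonal in a basis obtained
from the given one by a unit upper triangular change of basis. -/
theorem exists_isUnitUpper_conj_eq_diagonal {Q : Matrix (Fin n) (Fin n) ℂ} (hQ : Q.PosDef) :
    ∃ V : Matrix (Fin n) (Fin n) ℂ, IsUnitUpper V ∧ ∃ q : Fin n → ℝ, (∀ i, 0 < q i) ∧
      Vᴴ * Q * V = diagonal fun i => (q i : ℂ) := by
  -- The factor in Mathlib's LDL decomposition has an unspecified nonzero diagonal; it is rescaled.
  set A := LDL.lowerInv hQ with hA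
  have htri : ∀ i j, i < j → A i j = 0 := fun i j h => LDL.lowerInv_triangular hQ h
  have hdet : IsUnit A.det := isUnit_det_of_invertible A
  have hdiag : ∀ i, A i i ≠ 0 := by
    rw [det_of_isLowerTriangular A (fun i j hij => htri i j hij)] at hdet
    intro i h
    exact hdet.ne_zero (Finset.prod_eq_zero (Finset.mem_univ i) h)
  set V : Matrix (Fin n) (Fin n) ℂ := Aᴴ * diagonal fun i => (star (A i i))⁻¹ with hV
  have hVu : IsUnitUpper V := by
    constructor
    · intro i j hij
      rw [hV, mul_diagonal, conjTranspose_apply, htri j i hij, star_zero, zero_mul]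
    · intro i
      rw [hV, mul_diagonal, conjTranspose_apply]
      exact mul_inv_cancel₀ (star_ne_zero.2 (hdiag i))
  have hpos : (Vᴴ * Q * V).PosDef := by
    refine hQ.conjTranspose_mul_mul_same ?_
    exact mulVec_injective_iff_isUnit.2 ((isUnit_iff_isUnit_det _).2 hVu.isUnit_det)
  have hd : Vᴴ * Q * V =
      diagonal fun i => (A i i)⁻¹ * LDL.diagEntries hQ i * (star (A i i))⁻¹ := by
    have h1 := LDL.diag_eq_lowerInv_conj hQ
    rw [hV, conjTranspose_mul, conjTranspose_conjTranspose, diagonal_conjTranspose]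
    have : diagonal (star fun i => (star (A i i))⁻¹) * A * Q *
        (Aᴴ * diagonal fun i => (star (A i i))⁻¹) = diagonal (star fun i => (star (A i i))⁻¹) *
        (A * Q * Aᴴ) * diagonal fun i => (star (A i i))⁻¹ := by simp only [Matrix.mul_assoc]
    rw [this, ← h1, LDL.diag, diagonal_mul_diagonal, diagonal_mul_diagonal]
    congr 1
    funext i
    simp
  refine ⟨V, hVu, fun i => ((Vᴴ * Q * V) i i).re, fun i => ?_, ?_⟩
  · exact (Complex.pos_iff.1 (hpos.diag_pos (i := i))).1
  · have h2 : ∀ i, (((Vᴴ * Q * V) i i).re : ℂ) = (Vᴴ * Q * V) i i := by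
      intro i
      have := (Complex.pos_iff.1 (hpos.diag_pos (i := i))).2
      apply Complex.ext <;> simp [← this]
    simp only [h2]
    rw [hd]
    congr 1
    funext i
    rw [diagonal_apply_eq]

/-- The strictly lower triangular part. -/
def strictLower : Matrix (Fin n) (Fin n) ℂ →ₗ[ℂ] Matrix (Fin n) (Fin n) ℂ where
  toFun M := of fun i j => if j < i then M i j else 0
  map_add' M N := by ext i j; by_cases h : j < i <;> simp [h]
  map_smul' c M := by ext i j; simp

theorem strictLower_apply (M : Matrix (Fin n) (Fin n) ℂ) (i j : Fin n) :
    strictLower M i j = if j < i then M i j else 0 := rfl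

/-- Every matrix close to `1` is the product of a unit lower and an upper triangular matrix, both
close to `1`. The map `M ↦ (1 + L(M)) (1 + M - L(M))`, with `L` the strictly lower part, has the
identity as its derivative at `0`, so the inverse function theorem applies. -/
theorem exists_lower_mul_upper {Ω : Type*} {l : Filter Ω} {g : Ω → ℝ} (hg : Tendsto g l (𝓝 0))
    {E : Ω → Matrix (Fin n) (Fin n) ℂ} (hE : (fun ω => E ω - 1) =O[l] g) :
    ∃ M : Ω → Matrix (Fin n) (Fin n) ℂ, M =O[l] g ∧
      ∀ᶠ ω in l, E ω = (1 + strictLower (M ω)) * (1 + (M ω - strictLower (M ω))) := by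
  set S : Matrix (Fin n) (Fin n) ℂ →L[ℂ] Matrix (Fin n) (Fin n) ℂ :=
    LinearMap.toContinuousLinearMap strictLower with hS
  set Φ : Matrix (Fin n) (Fin n) ℂ → Matrix (Fin n) (Fin n) ℂ :=
    fun M => (1 + S M) * (1 + (M - S M)) with hΦ
  have h0 : Φ 0 = 1 := by simp [hΦ]
  have hd : HasStrictFDerivAt Φ ((ContinuousLinearEquiv.refl ℂ (Matrix (Fin n) (Fin n) ℂ) :
      Matrix (Fin n) (Fin n) ℂ →L[ℂ] Matrix (Fin n) (Fin n) ℂ)) 0 := by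
    have h1 : HasStrictFDerivAt (fun M => 1 + S M) S 0 := S.hasStrictFDerivAt.const_add 1
    have h2 : HasStrictFDerivAt (fun M : Matrix (Fin n) (Fin n) ℂ => 1 + (M - S M))
        (ContinuousLinearMap.id ℂ _ - S) 0 :=
      ((hasStrictFDerivAt_id _).sub S.hasStrictFDerivAt).const_add 1
    convert! h1.mul' h2 using 1
    ext M : 1
    simp
  set ψ := hd.localInverse Φ _ 0 with hψ
  have hψd : HasStrictFDerivAt ψ _ (Φ 0) := hd.to_localInverse
  have hψ0 : ψ (Φ 0) = 0 := hd.localInverse_apply_image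
  have hr : ∀ᶠ X in 𝓝 (Φ 0), Φ (ψ X) = X := hd.eventually_right_inverse
  have ht : Tendsto E l (𝓝 (Φ 0)) := by rw [h0]; exact tendsto_one_of_isBigO hg hE
  refine ⟨fun ω => ψ (E ω), ?_, (ht.eventually hr).mono fun ω h => h.symm⟩
  have h3 := (hψd.hasFDerivAt.isBigO_sub.comp_tendsto ht).trans
    (hE.congr_left fun ω => by rw [← h0]; rfl)
  refine h3.congr_left fun ω => ?_
  simp [hψ0]

/-- Alternating form of the Vandermonde convolution. -/
theorem sum_neg_one_pow_choose_mul_choose (p : ℕ) : ∀ m q : ℕ, p ≤ m →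
    ∑ k ∈ Finset.range (q + 1), (-1 : ℤ) ^ k * p.choose k * (m - k).choose (q - k) =
      (m - p).choose q := by
  induction p with
  | zero =>
    intro m q _
    rw [Finset.sum_eq_single 0]
    · simp
    · intro k _ hk
      obtain ⟨k, rfl⟩ := Nat.exists_eq_succ_of_ne_zero hk
      simp
    · simp
  | succ p ih =>
    intro m q hm
    rcases q with _ | q
    · simp
    rw [Finset.sum_range_succ']
    have h1 := ih m (q + 1) (by omega)
    have h2 := ih (m - 1) q (by omega)
    rw [Finset.sum_range_succ'] at h1
    have h3 : ∀ k ∈ Finset.range (q + 1), (-1 : ℤ) ^ (k + 1) * (p + 1).choose (k + 1) *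
        (m - (k + 1)).choose (q + 1 - (k + 1)) =
        (-1 : ℤ) ^ (k + 1) * p.choose (k + 1) * (m - (k + 1)).choose (q + 1 - (k + 1)) -
        (-1 : ℤ) ^ k * p.choose k * (m - 1 - k).choose (q - k) := by
      intro k _
      rw [Nat.choose_succ_succ, show m - (k + 1) = m - 1 - k by omega,
        show q + 1 - (k + 1) = q - k by omega]
      push_cast
      ring
    rw [Finset.sum_congr rfl h3, Finset.sum_sub_distrib, h2]
    have h4 : (m - p).choose (q + 1) = (m - (p + 1)).choose q + (m - (p + 1)).choose (q + 1) := by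
      rw [show m - p = (m - (p + 1)) + 1 by omega, Nat.choose_succ_succ]
    have h5 : m - 1 - p = m - (p + 1) := by omega
    rw [h5]
    simp only [Nat.choose_zero_right] at h1 ⊢
    rw [h4] at h1
    push_cast at h1 ⊢
    linarith

/-- The unit lower triangular factor of the Hankel matrix `1 / (m - p - q)!`. -/
def hankelLower (m : ℕ) : Matrix (Fin (m + 1)) (Fin (m + 1)) ℂ :=
  of fun p k => ((p : ℕ).choose k : ℂ) * ((m - k : ℕ).factorial : ℂ) / ((m - p : ℕ).factorial : ℂ)

/-- The pivots `(-1)^p p! / (m - p)!` of the Hankel matrix `1 / (m - p - q)!`. -/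
def hankelPivot (m p : ℕ) : ℂ :=
  (-1) ^ p * (p.factorial : ℂ) / ((m - p : ℕ).factorial : ℂ)

theorem hankelPivot_ne_zero (m p : ℕ) : hankelPivot m p ≠ 0 := by
  refine div_ne_zero (mul_ne_zero (pow_ne_zero _ (by norm_num)) ?_) ?_ <;>
  exact Nat.cast_ne_zero.2 (Nat.factorial_ne_zero _)

theorem isUnitUpper_hankelLower_transpose (m : ℕ) : IsUnitUpper (hankelLower m)ᵀ := by
  constructor
  · intro i j hij
    simp [hankelLower, Nat.choose_eq_zero_of_lt (show (j : ℕ) < i from hij)]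
  · intro i
    simp [hankelLower, Nat.factorial_ne_zero]

/-- Explicit symmetric triangular factorization of the Hankel matrix `1 / (m - p - q)!`, whose
entries vanish for `p + q > m`. -/
theorem hankel_eq (m : ℕ) :
    (of fun p q : Fin (m + 1) =>
      if (p : ℕ) + q ≤ m then 1 / ((m - p - q : ℕ).factorial : ℂ) else 0) =
      hankelLower m * diagonal (fun p : Fin (m + 1) => hankelPivot m p) * (hankelLower m)ᵀ := by
  ext p q
  have hp : (p : ℕ) ≤ m := by omega
  have hq : (q : ℕ) ≤ m := by omega
  have hf : ∀ k : ℕ, (k.factorial : ℂ) ≠ 0 := fun k =>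
    Nat.cast_ne_zero.2 (Nat.factorial_ne_zero _)
  have hterm : ∀ k ∈ Finset.range ((q : ℕ) + 1),
      ((p : ℕ).choose k : ℂ) * ((m - k : ℕ).factorial : ℂ) / ((m - p : ℕ).factorial : ℂ) *
        hankelPivot m k *
        (((q : ℕ).choose k : ℂ) * ((m - k : ℕ).factorial : ℂ) / ((m - q : ℕ).factorial : ℂ)) =
      ((q : ℕ).factorial : ℂ) / ((m - p : ℕ).factorial : ℂ) *
        (((-1 : ℤ) ^ k * (p : ℕ).choose k * (m - k).choose (q - k) : ℤ) : ℂ) := by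
    intro k hk
    have hk : k ≤ q := by simpa [Nat.lt_succ_iff] using hk
    have e1 : ((q : ℕ).choose k : ℂ) * (k.factorial : ℂ) * ((q - k : ℕ).factorial : ℂ) =
        ((q : ℕ).factorial : ℂ) := by exact_mod_cast Nat.choose_mul_factorial_mul_factorial hk
    have e2 : ((m - k : ℕ).choose (q - k) : ℂ) * ((q - k : ℕ).factorial : ℂ) *
        ((m - q : ℕ).factorial : ℂ) = ((m - k : ℕ).factorial : ℂ) := by
      have := Nat.choose_mul_factorial_mul_factorial (show (q : ℕ) - k ≤ m - k by omega)
      rw [show m - k - ((q : ℕ) - k) = m - q by omega] at this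
      exact_mod_cast this
    rw [hankelPivot, ← e1]
    push_cast
    have := hf (m - k); have := hf (m - p); have := hf (m - q); have := hf (q - k)
    field_simp
    rw [← e2]
    ring
  rw [mul_apply]
  simp only [mul_diagonal, transpose_apply, hankelLower, of_apply]
  rw [Fin.sum_univ_eq_sum_range (fun k => ((p : ℕ).choose k : ℂ) *
      ((m - k : ℕ).factorial : ℂ) / ((m - p : ℕ).factorial : ℂ) * hankelPivot m k *
      (((q : ℕ).choose k : ℂ) * ((m - k : ℕ).factorial : ℂ) / ((m - q : ℕ).factorial : ℂ))),
    ← Finset.sum_subset (Finset.range_mono (show (q : ℕ) + 1 ≤ m + 1 by omega)),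
    Finset.sum_congr rfl hterm, ← Finset.mul_sum, ← Int.cast_sum,
    sum_neg_one_pow_choose_mul_choose _ _ _ hp]
  · split_ifs with h
    · have := Nat.choose_mul_factorial_mul_factorial (show (q : ℕ) ≤ m - p by omega)
      have e : ((m - p : ℕ).choose q : ℂ) * ((q : ℕ).factorial : ℂ) *
        ((m - p - q : ℕ).factorial : ℂ) = ((m - p : ℕ).factorial : ℂ) := by exact_mod_cast this
      have := hf (m - p); have := hf (m - p - q)
      push_cast
      field_simp
      rw [← e]; ring
    · rw [Nat.choose_eq_zero_of_lt (by omega)]; simp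
  · intro k _ hk
    have hk : (q : ℕ) < k := by simpa using hk
    rw [Nat.choose_eq_zero_of_lt hk]
    simp

end Triangular

/-! ### Displacement equations -/

section Displacement

variable {n : ℕ}

/-- The upper triangular Jordan block with eigenvalue `μ`. -/
def jordan (n : ℕ) (μ : ℂ) : Matrix (Fin n) (Fin n) ℂ :=
  of fun i j => if i = j then μ else if (j : ℕ) = i + 1 then 1 else 0

/-- The displacement equation of a Hermitian form `Q` relative to a Jordan block and a row vector
`b`; it says that `Q` is a Gram matrix of exponential polynomials with values `b` at `0`. -/
def Displacement (μ : ℂ) (Q : Matrix (Fin n) (Fin n) ℂ) (b : Fin n → ℂ) : Prop :=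
  (jordan n μ)ᴴ * Q - Q * jordan n μ = of fun i j => -I * (star (b i) * b j)

/-- Conjugation by a unit upper triangular matrix preserves the diagonal and the superdiagonal of
a Jordan block, and keeps it upper triangular. -/
theorem conj_jordan_apply {V W : Matrix (Fin n) (Fin n) ℂ} {μ : ℂ} (hV : IsUnitUpper V)
    (hW : IsUnitUpper W) (hWV : W * V = 1) (i j : Fin n) :
    (j < i → (W * jordan n μ * V) i j = 0) ∧ (W * jordan n μ * V) i i = μ ∧
      ((j : ℕ) = i + 1 → (W * jordan n μ * V) i j = 1) := by
  have hJ : jordan n μ = μ • (1 : Matrix (Fin n) (Fin n) ℂ) +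
      of fun i j : Fin n => if (j : ℕ) = i + 1 then (1 : ℂ) else 0 := by
    ext i j
    rcases eq_or_ne i j with rfl | h
    · simp [jordan]
    · simp [jordan, h]
  have hsum : W * jordan n μ * V = μ • (1 : Matrix (Fin n) (Fin n) ℂ) +
      W * (of fun i j : Fin n => if (j : ℕ) = i + 1 then (1 : ℂ) else 0) * V := by
    rw [hJ, Matrix.mul_add, Matrix.add_mul, Matrix.mul_smul, Matrix.mul_one, Matrix.smul_mul, hWV]
  set N : Matrix (Fin n) (Fin n) ℂ := of fun i j : Fin n => if (j : ℕ) = i + 1 then (1 : ℂ) else 0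
    with hN
  have hWN : ∀ i k : Fin n, (k : ℕ) ≤ i → (W * N) i k = 0 := by
    intro i k hk
    rw [mul_apply]
    refine Finset.sum_eq_zero fun a _ => ?_
    by_cases h : (k : ℕ) = a + 1
    · rw [hW.1 i a (show (a : ℕ) < i by omega), zero_mul]
    · simp [hN, h]
  have hWN1 : ∀ i k : Fin n, (k : ℕ) = i + 1 → (W * N) i k = 1 := by
    intro i k hk
    rw [mul_apply, Finset.sum_eq_single i]
    · simp [hN, hk, hW.2 i]
    · intro a _ ha
      have : (k : ℕ) ≠ a + 1 := fun h => ha (Fin.ext (by omega))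
      simp [hN, this]
    · simp
  have hzero : ∀ i j : Fin n, (j : ℕ) ≤ i → (W * N * V) i j = 0 := by
    intro i j hij
    rw [mul_apply]
    refine Finset.sum_eq_zero fun k _ => ?_
    by_cases h : (k : ℕ) ≤ i
    · rw [hWN i k h, zero_mul]
    · rw [hV.1 k j (show (j : ℕ) < k by omega), mul_zero]
  have hone : ∀ i j : Fin n, (j : ℕ) = i + 1 → (W * N * V) i j = 1 := by
    intro i j hij
    rw [mul_apply, Finset.sum_eq_single j]
    · rw [hWN1 i j hij, hV.2 j, one_mul]
    · intro k _ hk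
      by_cases h : (k : ℕ) ≤ i
      · rw [hWN i k h, zero_mul]
      · have : (j : ℕ) < k := lt_of_le_of_ne (by omega) fun h' => hk (Fin.ext h'.symm)
        rw [hV.1 k j this, mul_zero]
    · simp
  rw [hsum]
  refine ⟨fun h => ?_, ?_, fun h => ?_⟩
  · rw [Matrix.add_apply, hzero i j (le_of_lt h), Matrix.smul_apply, one_apply_ne (ne_of_gt h)]
    simp
  · rw [Matrix.add_apply, hzero i i le_rfl, Matrix.smul_apply, one_apply_eq]
    simp
  · have : i ≠ j := fun h' => by rw [h'] at h; omega
    rw [Matrix.add_apply, hone i j h, Matrix.smul_apply, one_apply_ne this]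
    simp

/-- In the orthogonal basis of a form satisfying the displacement equation, the values `b` form a
geometric progression and determine the squared norms of the basis. -/
theorem Displacement.vecMul_eq {μ : ℂ} (hμ : 0 < μ.im) {Q V : Matrix (Fin n) (Fin n) ℂ}
    {b : Fin n → ℂ} (h : Displacement μ Q b) (hV : IsUnitUpper V) {q : Fin n → ℝ}
    (hq : ∀ i, 0 < q i) (hVQ : Vᴴ * Q * V = diagonal fun i => (q i : ℂ)) :
    (∀ i, 2 * μ.im * q i = ‖(b ᵥ* V) i‖ ^ 2) ∧
    ∀ h0 : 0 < n, ∀ i : Fin n, (b ᵥ* V) i = b ⟨0, h0⟩ * (-I / (2 * μ.im)) ^ (i : ℕ) := by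
  set W := V⁻¹ with hW
  have hWu : IsUnitUpper W := hV.inv
  have hWV : W * V = 1 := nonsing_inv_mul _ hV.isUnit_det
  have hVW : V * W = 1 := mul_nonsing_inv _ hV.isUnit_det
  set K := W * jordan n μ * V with hK
  have hKc := fun i j => conj_jordan_apply (μ := μ) hV hWu hWV i j
  rw [← hK] at hKc
  set c := b ᵥ* V with hc
  have hJV : jordan n μ * V = V * K := by
    rw [hK, ← Matrix.mul_assoc, ← Matrix.mul_assoc, hVW, Matrix.one_mul]
  have key : Kᴴ * (diagonal fun i => (q i : ℂ)) - (diagonal fun i => (q i : ℂ)) * K =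
      of fun i j => -I * (star (c i) * c j) := by
    have h1 := congrArg (fun M => Vᴴ * M * V) h
    have h2 : (of fun i j => -I * (star (b i) * b j) : Matrix (Fin n) (Fin n) ℂ) =
        (-I) • vecMulVec (star b) b := by
      ext i j; simp [vecMulVec_apply]
    have h3 : (of fun i j => -I * (star (c i) * c j) : Matrix (Fin n) (Fin n) ℂ) =
        (-I) • vecMulVec (star c) c := by
      ext i j; simp [vecMulVec_apply]
    rw [h2] at h1
    rw [h3, ← hVQ]
    have h4 : Vᴴ * ((-I) • vecMulVec (star b) b) * V = (-I) • vecMulVec (star c) c := by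
      rw [Matrix.mul_smul, Matrix.smul_mul, mul_vecMulVec, vecMulVec_mul, hc, star_vecMul]
    rw [h4] at h1
    rw [← h1, Matrix.mul_sub, Matrix.sub_mul]
    have h5 : Kᴴ * Vᴴ = Vᴴ * (jordan n μ)ᴴ := by
      rw [← conjTranspose_mul, ← hJV, conjTranspose_mul]
    congr 1
    · rw [← Matrix.mul_assoc, ← Matrix.mul_assoc, h5]
      simp only [Matrix.mul_assoc]
    · simp only [Matrix.mul_assoc, hJV]
  -- The diagonal entries of the transformed equation give the norms.
  have e1 : ∀ i, 2 * μ.im * q i = ‖c i‖ ^ 2 := by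
    intro i
    have h1 := congrFun (congrFun key i) i
    rw [Matrix.sub_apply, mul_diagonal, diagonal_mul, conjTranspose_apply, (hKc i i).2.1,
      of_apply] at h1
    have h2 : star (c i) * c i = ((‖c i‖ ^ 2 : ℝ) : ℂ) := by
      rw [← starRingEnd_apply, conj_mul']; push_cast; rfl
    rw [h2] at h1
    have h3 := congrArg Complex.im h1
    rw [neg_mul, neg_im, I_mul_im, ofReal_re] at h3
    simp at h3
    linarith
  refine ⟨e1, fun h0 => ?_⟩
  -- The superdiagonal entries give the ratio of consecutive values.
  have hstep : ∀ i j : Fin n, (j : ℕ) = i + 1 → c j = c i * (-I / (2 * μ.im)) := by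
    intro i j hij
    have h1 := congrFun (congrFun key i) j
    rw [Matrix.sub_apply, mul_diagonal, diagonal_mul, conjTranspose_apply,
      (hKc j i).1 (show (i : ℕ) < j by omega), (hKc i j).2.2 hij, of_apply] at h1
    have h2 : star (c i) * c i = ((2 * μ.im * q i : ℝ) : ℂ) := by
      rw [← starRingEnd_apply, conj_mul', e1 i]; push_cast; rfl
    have hμ' : (μ.im : ℂ) ≠ 0 := ofReal_ne_zero.2 hμ.ne'
    have hci : c i ≠ 0 := by
      intro h
      have := e1 i
      rw [h, norm_zero] at this
      have := mul_pos hμ (hq i)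
      nlinarith
    have hsc : star (c i) ≠ 0 := star_ne_zero.2 hci
    have h3 : (q i : ℂ) = I * (star (c i) * c j) := by
      simp at h1
      simpa using h1
    apply mul_left_cancel₀ hsc
    have h4 : star (c i) * (c i * (-I / (2 * μ.im))) = -I * q i := by
      rw [← mul_assoc, h2]; push_cast; field_simp
    rw [h4, h3]
    linear_combination (star (c i) * c j) * I_mul_I
  rintro ⟨i, hi⟩
  induction i with
  | zero =>
    simp only [pow_zero, mul_one]
    rw [hc, vecMul, dotProduct, Finset.sum_eq_single ⟨0, h0⟩]
    · rw [hV.2, mul_one]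
    · intro k _ hk
      rw [hV.1 k ⟨0, h0⟩ (Nat.pos_of_ne_zero fun h => hk (Fin.ext h)), mul_zero]
    · simp
  | succ i ih =>
    rw [hstep ⟨i, by omega⟩ ⟨i + 1, hi⟩ rfl, ih, pow_succ, mul_assoc]

end Displacement

/-! ### Taylor coefficients and Toeplitz matrices of exponentials -/

section TaylorCoefficients

/-- The `m`-th Taylor coefficient of `g` at `z₀`. -/
def taylorCoeff (g : ℂ → ℂ) (z₀ : ℂ) (m : ℕ) : ℂ :=
  1 / (m.factorial : ℂ) * iteratedDeriv m g z₀

theorem taylorCoeff_zero (g : ℂ → ℂ) (z₀ : ℂ) : taylorCoeff g z₀ 0 = g z₀ := by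
  simp [taylorCoeff]

theorem taylorCoeff_mul {f g : ℂ → ℂ} (hf : ContDiff ℂ ⊤ f) (hg : ContDiff ℂ ⊤ g) (z₀ : ℂ)
    (m : ℕ) : taylorCoeff (fun z => f z * g z) z₀ m =
      ∑ k ∈ Finset.range (m + 1), taylorCoeff f z₀ k * taylorCoeff g z₀ (m - k) := by
  rw [taylorCoeff, iteratedDeriv_fun_mul ((hf.of_le le_top).contDiffAt)
    ((hg.of_le le_top).contDiffAt), Finset.mul_sum]
  refine Finset.sum_congr rfl fun k hk => ?_
  have hk : k ≤ m := by simpa [Nat.lt_succ_iff] using hk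
  have h := Nat.choose_mul_factorial_mul_factorial hk
  have h' : (m.choose k : ℂ) * (k.factorial : ℂ) * ((m - k).factorial : ℂ) = m.factorial := by
    exact_mod_cast h
  have h1 : (k.factorial : ℂ) ≠ 0 := Nat.cast_ne_zero.2 (Nat.factorial_ne_zero _)
  have h2 : ((m - k).factorial : ℂ) ≠ 0 := Nat.cast_ne_zero.2 (Nat.factorial_ne_zero _)
  have h3 : (m.factorial : ℂ) ≠ 0 := Nat.cast_ne_zero.2 (Nat.factorial_ne_zero _)
  rw [taylorCoeff, taylorCoeff]
  field_simp
  rw [← h']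
  ring

theorem taylorCoeff_deriv (g : ℂ → ℂ) (z₀ : ℂ) (m : ℕ) :
    taylorCoeff (deriv g) z₀ m = (m + 1) * taylorCoeff g z₀ (m + 1) := by
  have h3 : (m.factorial : ℂ) ≠ 0 := Nat.cast_ne_zero.2 (Nat.factorial_ne_zero _)
  have h4 : (m : ℂ) + 1 ≠ 0 := by exact_mod_cast Nat.succ_ne_zero m
  rw [taylorCoeff, taylorCoeff, iteratedDeriv_succ', Nat.factorial_succ]
  push_cast
  field_simp

/-- The recurrence for the Taylor coefficients of `exp g`, from `(exp g)' = g' exp g`. -/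
theorem taylorCoeff_exp_succ {g : ℂ → ℂ} (hg : ContDiff ℂ ⊤ g) (z₀ : ℂ) (m : ℕ) :
    (m + 1) * taylorCoeff (fun z => cexp (g z)) z₀ (m + 1) = ∑ k ∈ Finset.range (m + 1),
      ((k + 1) * taylorCoeff g z₀ (k + 1)) * taylorCoeff (fun z => cexp (g z)) z₀ (m - k) := by
  have hd : deriv (fun z => cexp (g z)) = fun z => deriv g z * cexp (g z) := by
    funext z
    rw [deriv_cexp ((hg.differentiable (by simp)) z), mul_comm]
  have hg' : ContDiff ℂ ⊤ (deriv g) := by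
    have : ContDiff ℂ (⊤ + 1) g := by simpa using hg
    exact (contDiff_succ_iff_deriv.1 this).2.2
  rw [← taylorCoeff_deriv, hd, taylorCoeff_mul hg' hg.cexp]
  simp only [taylorCoeff_deriv]

theorem sum_taylorCoeff_exp_mul_exp_neg {g : ℂ → ℂ} (hg : ContDiff ℂ ⊤ g) (z₀ : ℂ) (m : ℕ) :
    ∑ k ∈ Finset.range (m + 1), taylorCoeff (fun z => cexp (g z)) z₀ k *
      taylorCoeff (fun z => cexp (-g z)) z₀ (m - k) = if m = 0 then 1 else 0 := by
  rw [← taylorCoeff_mul hg.cexp hg.neg.cexp]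
  have : (fun z => cexp (g z) * cexp (-g z)) = fun _ => 1 := by
    funext z; rw [← Complex.exp_add, add_neg_cancel, Complex.exp_zero]
  rw [this, taylorCoeff, iteratedDeriv_const]
  split_ifs with h
  · simp [h]
  · simp

/-- The upper triangular Toeplitz matrix with symbol `∑ f k X ^ k`. -/
def toeplitz (n : ℕ) (f : ℕ → ℂ) : Matrix (Fin n) (Fin n) ℂ :=
  of fun p q => if (p : ℕ) ≤ q then f (q - p) else 0

/-- Upper triangular Toeplitz matrices multiply like the Cauchy product of their symbols. -/
theorem toeplitz_mul (n : ℕ) (f g : ℕ → ℂ) : toeplitz n f * toeplitz n g =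
    toeplitz n fun m => ∑ k ∈ Finset.range (m + 1), f k * g (m - k) := by
  ext p q
  simp only [mul_apply, toeplitz, of_apply]
  rw [Fin.sum_univ_eq_sum_range (fun k => (if (p : ℕ) ≤ k then f (k - p) else 0) *
    (if k ≤ (q : ℕ) then g (q - k) else 0))]
  split_ifs with h
  · have hsub : Finset.Ico (p : ℕ) (q + 1) ⊆ Finset.range n := by
      intro k hk
      have := Finset.mem_Ico.1 hk
      exact Finset.mem_range.2 (by omega)
    rw [← Finset.sum_subset hsub, Finset.sum_Ico_eq_sum_range,
      show (q : ℕ) + 1 - p = q - p + 1 by omega]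
    · refine Finset.sum_congr rfl fun k hk => ?_
      have hk := Finset.mem_range.1 hk
      rw [if_pos (by omega), if_pos (by omega)]
      congr 2 <;> omega
    · intro k _ hk
      have : ¬ ((p : ℕ) ≤ k ∧ k < q + 1) := fun h => hk (Finset.mem_Ico.2 h)
      by_cases h1 : (p : ℕ) ≤ k
      · rw [if_neg (show ¬ k ≤ (q : ℕ) by omega), mul_zero]
      · rw [if_neg h1, zero_mul]
  · refine Finset.sum_eq_zero fun k _ => ?_
    by_cases h1 : (p : ℕ) ≤ k
    · rw [if_neg (show ¬ k ≤ (q : ℕ) by omega), mul_zero]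
    · rw [if_neg h1, zero_mul]

theorem toeplitz_exp_mul_toeplitz_exp_neg {g : ℂ → ℂ} (hg : ContDiff ℂ ⊤ g) (z₀ : ℂ) (n : ℕ) :
    toeplitz n (taylorCoeff (fun z => cexp (g z)) z₀) *
      toeplitz n (taylorCoeff (fun z => cexp (-g z)) z₀) = 1 := by
  rw [toeplitz_mul]
  ext p q
  simp only [toeplitz, of_apply, sum_taylorCoeff_exp_mul_exp_neg hg, one_apply, Fin.ext_iff]
  split_ifs <;> first | rfl | omega

end TaylorCoefficients

section Recurrence

variable {Ω : Type*} {l : Filter Ω} {F c : ℕ → Ω → ℂ}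

/-- Crude growth of the Taylor coefficients `F m` of an exponential, normalised by `F 0 = 1`, when
the Taylor coefficients `c k` of the exponent are all `O(R)`. -/
theorem isBigO_pow_of_recurrence {R : Ω → ℝ} (hR : (fun _ => (1 : ℝ)) =O[l] R)
    (h0 : ∀ ω, F 0 ω = 1) (hF : ∀ (m : ℕ) ω, ((m : ℂ) + 1) * F (m + 1) ω =
      ∑ k ∈ Finset.range (m + 1), ((k + 1) * c (k + 1) ω) * F (m - k) ω)
    (hc : ∀ k, c (k + 1) =O[l] R) (m : ℕ) : F m =O[l] fun ω => R ω ^ m := by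
  induction m using Nat.strong_induction_on with
  | _ m ih =>
    rcases m with _ | m
    · simp only [pow_zero]
      rw [show F 0 = fun _ => (1 : ℂ) from funext h0]
      exact isBigO_const_const _ one_ne_zero _
    have h1 : F (m + 1) = fun ω => ((m : ℂ) + 1)⁻¹ * ∑ k ∈ Finset.range (m + 1),
        ((k + 1) * c (k + 1) ω) * F (m - k) ω := by
      funext ω
      rw [← hF, inv_mul_cancel_left₀ (by exact_mod_cast Nat.succ_ne_zero m)]
    rw [h1]
    refine IsBigO.const_mul_left (IsBigO.fun_sum fun k hk => ?_) _
    have hk := Finset.mem_range.1 hk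
    have h2 := ((hc k).const_mul_left ((k : ℂ) + 1)).mul (ih (m - k) (by omega))
    have h3 : (fun ω => R ω * R ω ^ (m - k)) =O[l] fun ω => R ω ^ (m + 1) := by
      have h4 : (fun ω => R ω ^ (m - k + 1)) =O[l] fun ω => R ω ^ (m - k + 1) * R ω ^ k := by
        simpa using (isBigO_refl (fun ω => R ω ^ (m - k + 1)) l).mul (hR.pow k)
      refine (h4.congr_left fun ω => by ring).congr_right fun ω => ?_
      rw [← pow_add]; congr 1; omega
    exact h2.trans h3

/-- If the exponent is close to `X`, the Taylor coefficients of its exponential are close to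
`1 / m!`. -/
theorem isBigO_sub_inv_factorial_of_recurrence {g : Ω → ℝ} (hg : Tendsto g l (𝓝 0))
    (h0 : ∀ ω, F 0 ω = 1) (hF : ∀ (m : ℕ) ω, ((m : ℂ) + 1) * F (m + 1) ω =
      ∑ k ∈ Finset.range (m + 1), ((k + 1) * c (k + 1) ω) * F (m - k) ω)
    (hc1 : (fun ω => c 1 ω - 1) =O[l] g) (hc : ∀ k, c (k + 2) =O[l] g) (m : ℕ) :
    (fun ω => F m ω - 1 / (m.factorial : ℂ)) =O[l] g := by
  have hg1 : g =O[l] (fun _ => (1 : ℝ)) := hg.isBigO_one ℝ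
  induction m using Nat.strong_induction_on with
  | _ m ih =>
    have hb : ∀ k < m, F k =O[l] fun _ => (1 : ℝ) := by
      intro k hk
      refine (((ih k hk).trans hg1).add (isBigO_const_const (1 / (k.factorial : ℂ))
        (one_ne_zero (α := ℝ)) l)).congr_left fun ω => by simp
    rcases m with _ | m
    · refine (isBigO_zero g l).congr_left fun ω => by simp [h0]
    have h1 : (fun ω => F (m + 1) ω - 1 / ((m + 1).factorial : ℂ)) = fun ω =>
        ((m : ℂ) + 1)⁻¹ * (∑ k ∈ Finset.range m, ((k + 1 + 1) * c (k + 2) ω) * F (m - (k + 1)) ω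
          + ((c 1 ω - 1) * F m ω + (F m ω - 1 / (m.factorial : ℂ)))) := by
      funext ω
      have h2 := hF m ω
      rw [Finset.sum_range_succ'] at h2
      have h3 : (m : ℂ) + 1 ≠ 0 := by exact_mod_cast Nat.succ_ne_zero m
      have h4 : (m.factorial : ℂ) ≠ 0 := Nat.cast_ne_zero.2 (Nat.factorial_ne_zero _)
      rw [Nat.factorial_succ]
      push_cast at h2 ⊢
      simp only [zero_add, tsub_zero, one_mul] at h2
      rw [show ∑ k ∈ Finset.range m, ((k : ℂ) + 1 + 1) * c (k + 2) ω * F (m - (k + 1)) ω =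
        ((m : ℂ) + 1) * F (m + 1) ω - c 1 ω * F m ω by rw [h2]; ring]
      field_simp
      ring
    rw [h1]
    refine IsBigO.const_mul_left ((IsBigO.fun_sum fun k hk => ?_).add (IsBigO.add ?_ ?_)) _
    · have hk := Finset.mem_range.1 hk
      simpa using ((hc k).const_mul_left ((k : ℂ) + 1 + 1)).mul (hb (m - (k + 1)) (by omega))
    · simpa using hc1.mul (hb m (by omega))
    · exact ih m (by omega)

end Recurrence

/-! ### Factorization of Toeplitz matrices near the exponential -/

section SingleBlock

variable {Ω : Type*} {l : Filter Ω} {g : Ω → ℝ} {m : ℕ}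

theorem IsUnitUpper.mul {n : ℕ} {V W : Matrix (Fin n) (Fin n) ℂ} (hV : IsUnitUpper V)
    (hW : IsUnitUpper W) : IsUnitUpper (V * W) := by
  refine ⟨fun i j hij => ?_, fun i => ?_⟩
  · rw [mul_apply]
    refine Finset.sum_eq_zero fun k _ => ?_
    by_cases h : k < i
    · rw [hV.1 i k h, zero_mul]
    · rw [hW.1 k j (lt_of_lt_of_le hij (not_lt.1 h)), mul_zero]
  · rw [mul_apply, Finset.sum_eq_single i]
    · rw [hV.2, hW.2, one_mul]
    · intro k _ hk
      rcases lt_or_gt_of_ne hk with h | h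
      · rw [hV.1 i k h, zero_mul]
      · rw [hW.1 k i h, mul_zero]
    · simp

theorem isBigO_pow_inv_of_pos {τ : Ω → ℂ} (hg : Tendsto g l (𝓝 0))
    (hτ : (fun ω => (τ ω)⁻¹) =O[l] g) {k : ℕ} (hk : 0 < k) :
    (fun ω => (τ ω)⁻¹ ^ k) =O[l] g := by
  obtain ⟨k, rfl⟩ := Nat.exists_eq_succ_of_ne_zero hk.ne'
  have h1 := ((hτ.trans (hg.isBigO_one ℝ)).pow k).mul hτ
  simpa [pow_succ] using h1

/-- Conjugating a triangular matrix by powers of a large parameter leaves only its diagonal. -/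
theorem isBigO_conj_pow_sub_one {n : ℕ} (w : Fin n → ℕ) {τ : Ω → ℂ} (hg : Tendsto g l (𝓝 0))
    (hτ0 : ∀ᶠ ω in l, τ ω ≠ 0) (hτ : (fun ω => (τ ω)⁻¹) =O[l] g)
    {X : Ω → Matrix (Fin n) (Fin n) ℂ} (hX : X =O[l] fun _ => (1 : ℝ))
    (hoff : ∀ ω p q, p ≠ q → ¬ w q < w p → X ω p q = 0)
    (hdiag : ∀ p, (fun ω => X ω p p - 1) =O[l] g) :
    (fun ω => (of fun p q => (τ ω)⁻¹ ^ w p * X ω p q * τ ω ^ w q) - 1) =O[l] g := by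
  refine isBigO_matrix_iff.2 fun p q => ?_
  rcases eq_or_ne p q with rfl | hpq
  · refine (hdiag p).congr' ?_ EventuallyEq.rfl
    filter_upwards [hτ0] with ω hω
    rw [Matrix.sub_apply, of_apply, one_apply_eq, mul_right_comm, ← mul_pow, inv_mul_cancel₀ hω,
      one_pow, one_mul]
  · by_cases h : w q < w p
    · have h1 := (isBigO_pow_inv_of_pos hg hτ (Nat.sub_pos_of_lt h)).mul
        (isBigO_matrix_iff.1 hX p q)
      simp only [mul_one] at h1
      refine h1.congr' ?_ EventuallyEq.rfl
      filter_upwards [hτ0] with ω hω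
      rw [Matrix.sub_apply, of_apply, one_apply_ne hpq, sub_zero, mul_right_comm]
      congr 1
      conv_rhs => rw [← Nat.sub_add_cancel h.le, pow_add, mul_assoc, ← mul_pow,
        inv_mul_cancel₀ hω, one_pow, mul_one]
    · refine (isBigO_zero g l).congr_left fun ω => ?_
      rw [Matrix.sub_apply, of_apply, one_apply_ne hpq, hoff ω p q hpq h]
      simp

/-- The permutation matrix reversing the order of the basis. -/
def reversal (n : ℕ) : Matrix (Fin n) (Fin n) ℂ := of fun p q => if q = p.rev then 1 else 0

theorem reversal_conjTranspose (n : ℕ) : (reversal n)ᴴ = reversal n := by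
  ext p q
  simp only [reversal, conjTranspose_apply, of_apply]
  have : (p = q.rev) ↔ (q = p.rev) := ⟨fun h => by rw [h, Fin.rev_rev], fun h => by
    rw [h, Fin.rev_rev]⟩
  simp only [this]
  split_ifs <;> simp

theorem mul_reversal_apply {n : ℕ} (A : Matrix (Fin n) (Fin n) ℂ) (p q : Fin n) :
    (A * reversal n) p q = A p q.rev := by
  rw [mul_apply, Finset.sum_eq_single q.rev]
  · simp [reversal]
  · intro k _ hk
    have : q ≠ k.rev := fun h => hk (by rw [h, Fin.rev_rev])
    simp [reversal, this]
  · simp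

theorem reversal_mul_apply {n : ℕ} (A : Matrix (Fin n) (Fin n) ℂ) (p q : Fin n) :
    (reversal n * A) p q = A p.rev q := by
  rw [mul_apply, Finset.sum_eq_single p.rev]
  · simp [reversal]
  · intro k _ hk
    simp [reversal, hk]
  · simp

theorem reversal_mul_self (n : ℕ) : reversal n * reversal n = 1 := by
  ext p q
  rw [mul_reversal_apply]
  simp [reversal, one_apply, Fin.rev_inj, eq_comm]

/-- After reversing the columns, a Toeplitz matrix whose symbol is close to `exp (τ X)` with `τ`
large is a strongly graded diagonal matrix up to factors close to `1`. -/
theorem exists_toeplitz_mul_reversal_eq (hg : Tendsto g l (𝓝 0)) {τ : Ω → ℂ}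
    (hτ0 : ∀ᶠ ω in l, τ ω ≠ 0) (hτ : (fun ω => (τ ω)⁻¹) =O[l] g) {F : ℕ → Ω → ℂ} (e : Ω → ℂ)
    (hF : ∀ k, (fun ω => F k ω * (τ ω)⁻¹ ^ k - 1 / (k.factorial : ℂ)) =O[l] g) :
    ∃ A B : Ω → Matrix (Fin (m + 1)) (Fin (m + 1)) ℂ,
      (fun ω => A ω - 1) =O[l] g ∧ (fun ω => B ω - 1) =O[l] g ∧
      ∀ᶠ ω in l, toeplitz (m + 1) (fun k => e ω * F k ω) * reversal (m + 1) =
        A ω * diagonal (fun p : Fin (m + 1) =>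
          e ω * hankelPivot m p * τ ω ^ ((m : ℤ) - 2 * p)) * B ω := by
  have hc : ∀ R : Matrix (Fin (m + 1)) (Fin (m + 1)) ℂ,
      (fun _ : Ω => R) =O[l] (fun _ => (1 : ℝ)) := fun R => isBigO_const_const _ one_ne_zero _
  set D : Matrix (Fin (m + 1)) (Fin (m + 1)) ℂ := diagonal fun p => hankelPivot m p with hD
  set D' : Matrix (Fin (m + 1)) (Fin (m + 1)) ℂ := diagonal fun p => (hankelPivot m p)⁻¹ with hD'
  have hDD : D * D' = 1 := by
    rw [hD, hD', diagonal_mul_diagonal, ← diagonal_one]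
    congr 1; funext p; exact mul_inv_cancel₀ (hankelPivot_ne_zero m p)
  have hDD' : D' * D = 1 := mul_eq_one_comm.1 hDD
  set A0 := hankelLower m with hA0
  have hA0u := isUnitUpper_hankelLower_transpose m
  have hA0d : IsUnit A0.det := by rw [← det_transpose]; exact hA0u.isUnit_det
  -- The rescaled Toeplitz matrix with reversed columns; its limit is the Hankel matrix.
  set K : Ω → Matrix (Fin (m + 1)) (Fin (m + 1)) ℂ := fun ω => of fun p q =>
    if (p : ℕ) + q ≤ m then F (m - p - q) ω * (τ ω)⁻¹ ^ (m - p - q) else 0 with hK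
  have hKH : (fun ω => K ω - A0 * D * A0ᵀ) =O[l] g := by
    rw [hD, hA0, ← hankel_eq]
    refine isBigO_matrix_iff.2 fun p q => ?_
    by_cases h : (p : ℕ) + q ≤ m
    · refine (hF (m - p - q)).congr_left fun ω => ?_
      simp [hK, h]
    · refine (isBigO_zero g l).congr_left fun ω => ?_
      simp [hK, h]
  have hE : (fun ω => D' * A0⁻¹ * K ω * A0ᵀ⁻¹ - 1) =O[l] g := by
    have h1 := ((hc (D' * A0⁻¹)).mul hKH).mul (hc A0ᵀ⁻¹)
    simp only [mul_one, one_mul] at h1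
    refine h1.congr_left fun ω => ?_
    rw [Matrix.mul_sub, Matrix.sub_mul]
    congr 1
    have h2 : D' * A0⁻¹ * (A0 * D * A0ᵀ) * A0ᵀ⁻¹ = D' * (A0⁻¹ * A0) * D * (A0ᵀ * A0ᵀ⁻¹) := by
      simp only [Matrix.mul_assoc]
    rw [h2, nonsing_inv_mul _ hA0d, mul_nonsing_inv _ hA0u.isUnit_det, Matrix.mul_one,
      Matrix.mul_one, hDD']
  obtain ⟨M, hM, hEM⟩ := exists_lower_mul_upper hg hE
  have hg1 : g =O[l] (fun _ => (1 : ℝ)) := hg.isBigO_one ℝ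
  have hSM : (fun ω => strictLower (M ω)) =O[l] g := by
    refine isBigO_matrix_iff.2 fun p q => ?_
    by_cases h : q < p
    · simpa [strictLower_apply, h] using isBigO_matrix_iff.1 hM p q
    · simpa [strictLower_apply, h] using isBigO_zero g l
  have hUM : (fun ω => M ω - strictLower (M ω)) =O[l] g := hM.sub hSM
  set X : Ω → Matrix (Fin (m + 1)) (Fin (m + 1)) ℂ :=
    fun ω => A0 * (D * (1 + strictLower (M ω)) * D') with hX
  set Y : Ω → Matrix (Fin (m + 1)) (Fin (m + 1)) ℂ :=
    fun ω => (1 + (M ω - strictLower (M ω))) * A0ᵀ with hY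
  have hKXY : ∀ᶠ ω in l, K ω = X ω * D * Y ω := by
    filter_upwards [hEM] with ω hω
    have h1 : X ω * D * Y ω = A0 * D * ((1 + strictLower (M ω)) * (D' * D) *
        (1 + (M ω - strictLower (M ω)))) * A0ᵀ := by simp only [hX, hY, Matrix.mul_assoc]
    rw [h1, hDD', Matrix.mul_one, ← hω]
    have h2 : A0 * D * (D' * A0⁻¹ * K ω * A0ᵀ⁻¹) * A0ᵀ =
        A0 * (D * D') * A0⁻¹ * K ω * (A0ᵀ⁻¹ * A0ᵀ) := by simp only [Matrix.mul_assoc]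
    rw [h2, hDD, Matrix.mul_one, mul_nonsing_inv _ hA0d, nonsing_inv_mul _ hA0u.isUnit_det,
      Matrix.one_mul, Matrix.mul_one]
  have hXu : ∀ ω, IsUnitUpper (X ω)ᵀ := by
    intro ω
    rw [hX, transpose_mul]
    refine IsUnitUpper.mul ⟨fun i j hij => ?_, fun i => ?_⟩ hA0u
    · rw [transpose_apply, hD, hD', mul_diagonal, diagonal_mul, Matrix.add_apply,
        strictLower_apply, if_neg (not_lt.2 hij.le), one_apply_ne (ne_of_lt hij)]
      simp
    · rw [transpose_apply, hD, hD', mul_diagonal, diagonal_mul, Matrix.add_apply,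
        strictLower_apply, if_neg (lt_irrefl _), one_apply_eq, add_zero, mul_one,
        mul_inv_cancel₀ (hankelPivot_ne_zero m i)]
  have hX1 : X =O[l] fun _ => (1 : ℝ) := by
    have h1 := (hc A0).mul (((hc D).mul ((hc 1).add (hSM.trans hg1))).mul (hc D'))
    simpa using h1
  have hY1 : Y =O[l] fun _ => (1 : ℝ) := by
    have h1 := ((hc 1).add (hUM.trans hg1)).mul (hc A0ᵀ)
    simpa using h1
  have hYd : (fun ω => Y ω - A0ᵀ) =O[l] g := by
    have h1 := hUM.mul (hc A0ᵀ)
    simp only [mul_one] at h1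
    refine h1.congr_left fun ω => ?_
    simp only [hY, Matrix.add_mul, Matrix.one_mul, add_sub_cancel_left]
  -- Undoing the rescaling conjugates the triangular factors by powers of `τ`, which kills the
  -- off-diagonal parts because the lower and the upper factor face opposite gradings.
  refine ⟨fun ω => of fun p q => (τ ω)⁻¹ ^ (p : ℕ) * X ω p q * τ ω ^ (q : ℕ),
    fun ω => of fun p q => (τ ω)⁻¹ ^ (m - p : ℕ) * Y ω p q * τ ω ^ (m - q : ℕ),
    isBigO_conj_pow_sub_one (fun p => (p : ℕ)) hg hτ0 hτ hX1 ?_ ?_,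
    isBigO_conj_pow_sub_one (fun p => (m - p : ℕ)) hg hτ0 hτ hY1 ?_ ?_, ?_⟩
  · intro ω p q hpq h
    have : p < q := lt_of_le_of_ne (not_lt.1 h) hpq
    exact (hXu ω).1 q p this
  · intro p
    refine (isBigO_zero g l).congr_left fun ω => ?_
    rw [show X ω p p = 1 from (hXu ω).2 p, sub_self]
  · intro ω p q hpq h
    have hqp : q < p := by
      have : (p : ℕ) ≠ q := fun h => hpq (Fin.ext h)
      show (q : ℕ) < p
      omega
    simp only [hY]
    rw [mul_apply]
    refine Finset.sum_eq_zero fun k _ => ?_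
    by_cases hk : k < p
    · rw [Matrix.add_apply, Matrix.sub_apply, strictLower_apply, if_pos hk, sub_self,
        one_apply_ne (ne_of_gt hk), add_zero, zero_mul]
    · rw [hA0u.1 k q (lt_of_lt_of_le hqp (not_lt.1 hk)), mul_zero]
  · intro p
    refine (isBigO_matrix_iff.1 hYd p p).congr_left fun ω => ?_
    rw [Matrix.sub_apply, hA0u.2]
  · filter_upwards [hKXY, hτ0] with ω hω h0
    have e1 : toeplitz (m + 1) (fun k => e ω * F k ω) * reversal (m + 1) =
        of fun p q : Fin (m + 1) => e ω * ((τ ω)⁻¹ ^ (p : ℕ) * K ω p q * τ ω ^ (m - q : ℕ)) := by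
      ext p q
      rw [mul_reversal_apply]
      simp only [toeplitz, of_apply, hK, Fin.val_rev]
      have e3 : m + 1 - ((q : ℕ) + 1) = m - q := by omega
      rw [e3]
      by_cases h : (p : ℕ) + q ≤ m
      · rw [if_pos h, if_pos (by omega), show m - (q : ℕ) - p = m - p - q by omega]
        congr 1
        have e4 : τ ω ^ (m - q : ℕ) = τ ω ^ (p : ℕ) * τ ω ^ (m - p - q : ℕ) := by
          rw [← pow_add]; congr 1; omega
        rw [e4, inv_pow, inv_pow]
        field_simp
      · rw [if_neg h, if_neg (by omega)]
        simp
    rw [e1, hω]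
    ext p q
    rw [mul_apply, of_apply, mul_apply, Finset.mul_sum, Finset.sum_mul, Finset.mul_sum]
    refine Finset.sum_congr rfl fun k _ => ?_
    simp only [mul_diagonal, hD, of_apply]
    have hk : (k : ℕ) ≤ m := by omega
    have e5 : τ ω ^ ((m : ℤ) - 2 * k) = (τ ω)⁻¹ ^ (k : ℕ) * τ ω ^ (m - k : ℕ) := by
      rw [inv_pow, ← zpow_natCast, ← zpow_natCast, ← _root_.zpow_neg, ← zpow_add₀ h0]
      congr 1
      push_cast [hk]
      ring
    have e6 : τ ω ^ (k : ℕ) * (τ ω)⁻¹ ^ (k : ℕ) = 1 := by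
      rw [← mul_pow, mul_inv_cancel₀ h0, one_pow]
    have e7 : τ ω ^ (m - k : ℕ) * (τ ω)⁻¹ ^ (m - k : ℕ) = 1 := by
      rw [← mul_pow, mul_inv_cancel₀ h0, one_pow]
    calc _ = e ω * ((τ ω)⁻¹ ^ (p : ℕ) * (X ω p k * hankelPivot m k * Y ω k q) *
          τ ω ^ (m - q : ℕ)) * (τ ω ^ (k : ℕ) * (τ ω)⁻¹ ^ (k : ℕ)) *
          (τ ω ^ (m - k : ℕ) * (τ ω)⁻¹ ^ (m - k : ℕ)) := by rw [e6, e7, mul_one, mul_one]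
      _ = _ := by rw [e5]; ring

end SingleBlock

/-! ### Peaks and the asymptotics of one block -/

section Peaks

variable {Ω : Type*} {l : Filter Ω} {g : Ω → ℝ} {m : ℕ}

/-- The profile of a single soliton with amplitude `2 η` as a function of the complex number `r`
that carries its position `log ‖r‖` and its phase `arg r`. -/
def peak (η : ℝ) (r : ℂ) : ℂ := -4 * I * η * star r / (1 + (‖r‖ : ℂ) ^ 2)

theorem norm_peak_le (η : ℝ) (r : ℂ) : ‖peak η r‖ ≤ 4 * |η| * ‖r‖ := by
  have h1 : (1 : ℝ) ≤ ‖(1 + (‖r‖ : ℂ) ^ 2 : ℂ)‖ := by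
    rw [show (1 + (‖r‖ : ℂ) ^ 2 : ℂ) = ((1 + ‖r‖ ^ 2 : ℝ) : ℂ) by push_cast; rfl, norm_real,
      Real.norm_of_nonneg (by positivity)]
    nlinarith [sq_nonneg ‖r‖]
  rw [peak, norm_div]
  have h2 : ‖-4 * I * (η : ℂ) * star r‖ = 4 * |η| * ‖r‖ := by simp
  rw [h2]
  exact div_le_self (by positivity) h1

theorem norm_peak_le_inv (η : ℝ) (r : ℂ) : ‖peak η r‖ ≤ 4 * |η| * ‖r‖⁻¹ := by
  rcases eq_or_ne r 0 with rfl | hr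
  · simp [peak]
  have hr' : 0 < ‖r‖ := norm_pos_iff.2 hr
  have h1 : ‖r‖ ^ 2 ≤ ‖(1 + (‖r‖ : ℂ) ^ 2 : ℂ)‖ := by
    rw [show (1 + (‖r‖ : ℂ) ^ 2 : ℂ) = ((1 + ‖r‖ ^ 2 : ℝ) : ℂ) by push_cast; rfl, norm_real,
      Real.norm_of_nonneg (by positivity)]
    linarith
  rw [peak, norm_div]
  have h2 : ‖-4 * I * (η : ℂ) * star r‖ = 4 * |η| * ‖r‖ := by simp
  rw [h2, div_le_iff₀ (lt_of_lt_of_le (by positivity) h1)]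
  calc 4 * |η| * ‖r‖ = 4 * |η| * ‖r‖⁻¹ * ‖r‖ ^ 2 := by field_simp
    _ ≤ _ := by gcongr

theorem transfer_diagonal {n : ℕ} {p q : Fin n → ℝ} (hp : ∀ i, 0 < p i) (hq : ∀ i, 0 < q i)
    (d : Fin n → ℂ) :
    transfer (diagonal fun i => (p i : ℂ)) (diagonal d) (diagonal fun i => (q i : ℂ)) =
      diagonal fun i => star (d i) / (p i + q i * (‖d i‖ : ℂ) ^ 2) := by
  have hne : ∀ i, (p i + q i * (‖d i‖ : ℂ) ^ 2 : ℂ) ≠ 0 := by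
    intro i
    rw [show (p i + q i * (‖d i‖ : ℂ) ^ 2 : ℂ) = ((p i + q i * ‖d i‖ ^ 2 : ℝ) : ℂ) by
      push_cast; rfl, ofReal_ne_zero]
    have := hp i; have := hq i
    positivity
  have h1 : (diagonal fun i => (p i : ℂ)) + (diagonal d)ᴴ * (diagonal fun i => (q i : ℂ)) *
      diagonal d = diagonal fun i => (p i + q i * (‖d i‖ : ℂ) ^ 2 : ℂ) := by
    rw [diagonal_conjTranspose, diagonal_mul_diagonal, diagonal_mul_diagonal, diagonal_add]
    congr 1
    funext i
    have := conj_mul' (d i)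
    rw [starRingEnd_apply] at this
    rw [Pi.star_apply, ← this]; ring
  rw [transfer, h1, diagonal_conjTranspose]
  have h2 : (diagonal fun i => (p i + q i * (‖d i‖ : ℂ) ^ 2 : ℂ))⁻¹ =
      diagonal fun i => (p i + q i * (‖d i‖ : ℂ) ^ 2 : ℂ)⁻¹ := by
    refine inv_eq_right_inv ?_
    rw [diagonal_mul_diagonal, ← diagonal_one]
    congr 1
    funext i
    exact mul_inv_cancel₀ (hne i)
  rw [h2, diagonal_mul_diagonal]
  congr 1
  funext i
  rw [Pi.star_apply, div_eq_inv_mul]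

theorem isBigO_bilin {ι : Type*} [Fintype ι] [DecidableEq ι] {A : Ω → Matrix ι ι ℂ}
    (hA : A =O[l] g) (α β : ι → ℂ) : (fun ω => α ⬝ᵥ (A ω *ᵥ β)) =O[l] g := by
  simp only [dotProduct, mulVec]
  exact IsBigO.fun_sum fun i _ => IsBigO.const_mul_left (IsBigO.fun_sum fun j _ =>
    ((isBigO_matrix_iff.1 hA i j).const_mul_left (β j)).congr_left fun ω => mul_comm _ _) _

/-- In the displacement equation of a positive definite form the first value does not vanish: it
is the first value in the orthogonal basis, and its square is `2 (Im μ)` times a norm. -/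
theorem displacement_apply_zero_ne_zero {μ : ℂ} (hμ : 0 < μ.im)
    {Q : Matrix (Fin (m + 1)) (Fin (m + 1)) ℂ} (hQ : Q.PosDef) {β : Fin (m + 1) → ℂ}
    (h : Displacement μ Q β) : β 0 ≠ 0 := by
  obtain ⟨V, hV, q, hq, hVQ⟩ := exists_isUnitUpper_conj_eq_diagonal hQ
  obtain ⟨h1, h2⟩ := h.vecMul_eq hμ hV hq hVQ
  intro h0
  have h3 := h1 0
  have h4 : (β ᵥ* V) 0 = β 0 := by simpa using h2 (Nat.succ_pos m) 0
  rw [h4, h0, norm_zero] at h3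
  have := mul_pos hμ (hq 0)
  nlinarith

theorem posDef_conj_reversal {n : ℕ} {P : Matrix (Fin n) (Fin n) ℂ} (hP : P.PosDef) :
    ((reversal n)ᴴ * P * reversal n).PosDef := by
  refine hP.conjTranspose_mul_mul_same (mulVec_injective_iff_isUnit.2 ?_)
  exact isUnit_iff_exists_inv.2 ⟨_, reversal_mul_self n⟩

/-- Asymptotics of the contribution of one block: when the Toeplitz symbol is close to
`exp (τ X)` with `τ` large, this contribution splits into `m + 1` separate solitons. -/
theorem isBigO_transfer_toeplitz_sub_peaks {μ : ℂ} (hμ : 0 < μ.im)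
    {P Q : Matrix (Fin (m + 1)) (Fin (m + 1)) ℂ} (hP : P.PosDef) (hQ : Q.PosDef)
    {α β : Fin (m + 1) → ℂ} (hα : Displacement μ P α) (hβ : Displacement μ Q β)
    (hg : Tendsto g l (𝓝 0)) {τ : Ω → ℂ}
    (hτ0 : ∀ᶠ ω in l, τ ω ≠ 0) (hτ : (fun ω => (τ ω)⁻¹) =O[l] g) {F : ℕ → Ω → ℂ} {e : Ω → ℂ}
    (he : ∀ ω, e ω ≠ 0)
    (hF : ∀ k, (fun ω => F k ω * (τ ω)⁻¹ ^ k - 1 / (k.factorial : ℂ)) =O[l] g) :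
    (fun ω => -2 * I * (α ⬝ᵥ (transfer P (toeplitz (m + 1) fun k => e ω * F k ω) Q *ᵥ star β))
      - ∑ p : Fin (m + 1), peak μ.im (β 0 / α 0 * (e ω * hankelPivot m p *
        (2 * I * μ.im * τ ω) ^ ((m : ℤ) - 2 * p)))) =O[l] g := by
  have hg1 : g =O[l] (fun _ => (1 : ℝ)) := hg.isBigO_one ℝ
  obtain ⟨V, hV, q, hq, hVQ⟩ := exists_isUnitUpper_conj_eq_diagonal hQ
  obtain ⟨V₁, hV₁, p, hp, hVP⟩ := exists_isUnitUpper_conj_eq_diagonal hP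
  obtain ⟨A, B, hA, hB, hTAB⟩ := exists_toeplitz_mul_reversal_eq (m := m) hg hτ0 hτ e hF
  set R := reversal (m + 1) with hR
  have hRR : R * R = 1 := reversal_mul_self _
  have hRH : Rᴴ = R := reversal_conjTranspose _
  set d : Ω → Fin (m + 1) → ℂ :=
    fun ω p => e ω * hankelPivot m p * τ ω ^ ((m : ℤ) - 2 * p) with hd
  have hd0 : ∀ᶠ ω in l, ∀ p, d ω p ≠ 0 := by
    filter_upwards [hτ0] with ω hω p
    exact mul_ne_zero (mul_ne_zero (he ω) (hankelPivot_ne_zero m p)) (zpow_ne_zero _ hω)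
  have hdinv : ∀ᶠ ω in l, diagonal (d ω) * diagonal (fun i => (d ω i)⁻¹) = 1 := by
    filter_upwards [hd0] with ω hω
    rw [diagonal_mul_diagonal, ← diagonal_one]
    congr 1
    funext i
    exact mul_inv_cancel₀ (hω i)
  -- Ratios of the graded entries: `d i / d j` is small for `j < i`.
  have hratio : ∀ i j : Fin (m + 1), j < i → (fun ω => d ω i * (d ω j)⁻¹) =O[l] g := by
    intro i j hij
    have hlt : (j : ℕ) < i := hij
    have h1 := (isBigO_pow_inv_of_pos hg hτ (k := 2 * (i - j : ℕ)) (by omega)).const_mul_left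
      (hankelPivot m i * (hankelPivot m j)⁻¹)
    refine h1.congr' ?_ EventuallyEq.rfl
    filter_upwards [hτ0] with ω hω
    have h2 : τ ω ^ ((m : ℤ) - 2 * i) =
        (τ ω)⁻¹ ^ (2 * (i - j : ℕ)) * τ ω ^ ((m : ℤ) - 2 * j) := by
      rw [inv_pow, ← zpow_natCast, ← _root_.zpow_neg, ← zpow_add₀ hω]
      congr 1
      push_cast [hlt.le]
      ring
    simp only [hd]
    rw [h2]
    have := he ω
    have := hankelPivot_ne_zero m j
    have := zpow_ne_zero ((m : ℤ) - 2 * j) hω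
    rw [mul_inv, mul_inv]
    field_simp
  -- The reversal turns the upper triangular change of basis for `P` into a lower triangular one,
  -- as is needed for it to become trivial when moved across the graded diagonal matrix.
  set U := R * V₁ * R with hU
  have hUu : IsUnit U.det := by
    rw [hU, det_mul, det_mul]
    have : IsUnit R.det := (isUnit_iff_isUnit_det _).1 (isUnit_iff_exists_inv.2 ⟨_, hRR⟩)
    exact (this.mul hV₁.isUnit_det).mul this
  have hUlow : ∀ i j, i < j → U i j = 0 := by
    intro i j hij
    rw [hU, hR, mul_reversal_apply, reversal_mul_apply]
    exact hV₁.1 _ _ (Fin.rev_lt_rev.2 hij)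
  have hUone : ∀ i, U i i = 1 := by
    intro i
    rw [hU, hR, mul_reversal_apply, reversal_mul_apply, hV₁.2]
  set P₁ := Rᴴ * P * R with hP₁
  have hP₁pd : P₁.PosDef := posDef_conj_reversal hP
  have hUP : Uᴴ * P₁ * U = diagonal fun i : Fin (m + 1) => (p i.rev : ℂ) := by
    have h1 : Uᴴ * P₁ * U = R * (V₁ᴴ * ((R * R) * P * (R * R)) * V₁) * R := by
      rw [hU, hP₁, conjTranspose_mul, conjTranspose_mul, hRH]
      simp only [Matrix.mul_assoc]
    rw [h1, hRR, Matrix.one_mul, Matrix.mul_one, hVP]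
    ext i j
    rw [hR, mul_reversal_apply, reversal_mul_apply]
    simp only [diagonal_apply, Fin.rev_inj]
  have hpd : ∀ {r : Fin (m + 1) → ℝ}, (∀ i, 0 < r i) →
      (diagonal fun i => (r i : ℂ)).PosDef := fun hr =>
    PosDef.diagonal fun i => by exact_mod_cast hr i
  -- Replace the Toeplitz matrix by its graded diagonal part.
  have s1 : (fun ω => transfer P (toeplitz (m + 1) fun k => e ω * F k ω) Q -
      R * transfer P₁ (diagonal (d ω)) Q) =O[l] g := by
    have h1 := isBigO_transfer_mul_sub hP₁pd hQ hg (fun ω => diagonal (d ω)) hA hB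
    have h2 := (isBigO_const_const R (one_ne_zero (α := ℝ)) l).mul h1
    simp only [one_mul] at h2
    refine h2.congr' ?_ EventuallyEq.rfl
    filter_upwards [hTAB] with ω hω
    rw [← hω, mul_sub]
    congr 1
    have h3 := transfer_conj_mul_right P (toeplitz (m + 1) (fun k => e ω * F k ω) * R) Q hRR
    rw [Matrix.mul_assoc _ R R, hRR, Matrix.mul_one] at h3
    exact h3.symm
  -- Diagonalise the two quadratic forms.
  have s2 := isBigO_transfer_sub_of_conj (l := l) (T := fun ω => diagonal (d ω))
    (U' := fun ω => diagonal (d ω) * U * diagonal (fun i => (d ω i)⁻¹))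
    (V' := fun ω => diagonal (fun i => (d ω i)⁻¹) * V * diagonal (d ω))
    (hpd fun i => hp i.rev) (hpd hq) hUP hVQ hUu hg
    (by
      filter_upwards [hdinv] with ω hω
      rw [Matrix.mul_assoc _ _ (diagonal (d ω)), mul_eq_one_comm.1 hω, Matrix.mul_one])
    (by
      filter_upwards [hdinv] with ω hω
      rw [← Matrix.mul_assoc, ← Matrix.mul_assoc, hω, Matrix.one_mul])
    (by
      refine isBigO_matrix_iff.2 fun i j => ?_
      simp only [Matrix.sub_apply, mul_diagonal, diagonal_mul]
      rcases lt_trichotomy i j with h | rfl | h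
      · refine (isBigO_zero g l).congr_left fun ω => ?_
        rw [hUlow i j h, one_apply_ne (ne_of_lt h)]; simp
      · refine (isBigO_zero g l).congr' ?_ EventuallyEq.rfl
        filter_upwards [hd0] with ω hω
        rw [hUone, one_apply_eq, mul_one, mul_inv_cancel₀ (hω i), sub_self]
      · refine ((hratio i j h).const_mul_left (U i j)).congr_left fun ω => ?_
        rw [one_apply_ne (ne_of_gt h)]; ring)
    (by
      refine isBigO_matrix_iff.2 fun i j => ?_
      simp only [Matrix.sub_apply, mul_diagonal, diagonal_mul]
      rcases lt_trichotomy i j with h | rfl | h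
      · refine ((hratio j i h).const_mul_left (V i j)).congr_left fun ω => ?_
        rw [one_apply_ne (ne_of_lt h)]; ring
      · refine (isBigO_zero g l).congr' ?_ EventuallyEq.rfl
        filter_upwards [hd0] with ω hω
        rw [hV.2, one_apply_eq, mul_one, inv_mul_cancel₀ (hω i), sub_self]
      · refine (isBigO_zero g l).congr_left fun ω => ?_
        rw [hV.1 i j h, one_apply_ne (ne_of_gt h)]; simp)
  have s3 : (fun ω => transfer P (toeplitz (m + 1) fun k => e ω * F k ω) Q -
      R * (U * diagonal (fun i => star (d ω i) / (p i.rev + q i * (‖d ω i‖ : ℂ) ^ 2)) * Vᴴ))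
      =O[l] g := by
    have h2 := (isBigO_const_const R (one_ne_zero (α := ℝ)) l).mul s2
    simp only [one_mul] at h2
    refine (s1.add h2).congr_left fun ω => ?_
    rw [← transfer_diagonal (fun i => hp i.rev) hq (d ω), mul_sub, sub_add_sub_cancel]
  -- The displacement equations determine the pivots `p`, `q` and the entries of the row vectors.
  have hα0 := displacement_apply_zero_ne_zero hμ hP hα
  obtain ⟨a1, a2⟩ := hα.vecMul_eq hμ hV₁ hp hVP
  obtain ⟨b1, b2⟩ := hβ.vecMul_eq hμ hV hq hVQ
  have a3 := a2 (Nat.succ_pos m)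
  have b3 := b2 (Nat.succ_pos m)
  refine ((isBigO_bilin s3 α (star β)).const_mul_left (-2 * I)).congr' ?_ EventuallyEq.rfl
  filter_upwards [hτ0] with ω hω
  rw [Matrix.sub_mulVec, dotProduct_sub, mul_sub]
  congr 1
  have hRU : R * U = V₁ * R := by
    rw [hU, ← Matrix.mul_assoc, ← Matrix.mul_assoc, hRR, Matrix.one_mul]
  have e1 : α ⬝ᵥ ((R * (U * diagonal (fun i => star (d ω i) /
      (p i.rev + q i * (‖d ω i‖ : ℂ) ^ 2)) * Vᴴ)) *ᵥ star β) =
      ∑ i, (α ᵥ* V₁) i.rev * (star (d ω i) / (p i.rev + q i * (‖d ω i‖ : ℂ) ^ 2)) *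
        star ((β ᵥ* V) i) := by
    rw [← Matrix.mul_assoc, ← Matrix.mul_assoc, hRU, ← mulVec_mulVec, ← star_vecMul,
      ← mulVec_mulVec, dotProduct_mulVec, ← vecMul_vecMul]
    simp only [dotProduct, mulVec_diagonal]
    refine Finset.sum_congr rfl fun i _ => ?_
    have : ((α ᵥ* V₁) ᵥ* R) i = (α ᵥ* V₁) i.rev := by
      rw [hR]
      simp only [vecMul, dotProduct]
      rw [Finset.sum_eq_single i.rev]
      · simp [reversal]
      · intro k _ hk
        have : i ≠ k.rev := fun h => hk (by rw [h, Fin.rev_rev])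
        simp [reversal, this]
      · simp
    rw [this, Pi.star_apply]
    ring
  rw [e1, Finset.mul_sum]
  refine Finset.sum_congr rfl fun i _ => ?_
  have hη : (μ.im : ℂ) ≠ 0 := ofReal_ne_zero.2 hμ.ne'
  set a := (α ᵥ* V₁) i.rev with ha
  set b := (β ᵥ* V) i with hb
  have ha0 : a ≠ 0 := by
    rw [ha, a3]
    refine mul_ne_zero hα0 (pow_ne_zero _ (div_ne_zero (neg_ne_zero.2 I_ne_zero) ?_))
    exact mul_ne_zero two_ne_zero hη
  have hr : β 0 / α 0 * (e ω * hankelPivot m i * (2 * I * μ.im * τ ω) ^ ((m : ℤ) - 2 * i)) =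
      b / a * d ω i := by
    have ha3 : a = α 0 * (-I / (2 * μ.im)) ^ (m - i : ℕ) := by
      rw [ha, a3 i.rev]
      congr 2
      rw [Fin.val_rev]; omega
    have hb3 : b = β 0 * (-I / (2 * μ.im)) ^ (i : ℕ) := b3 i
    have hρ : (2 * I * μ.im : ℂ)⁻¹ = -I / (2 * μ.im) := by
      rw [mul_inv, mul_inv, inv_I]; field_simp
    have hne : (2 * I * μ.im : ℂ) ≠ 0 := mul_ne_zero (mul_ne_zero two_ne_zero I_ne_zero) hη
    have hz : (2 * I * μ.im : ℂ) ^ ((m : ℤ) - 2 * i) =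
        (-I / (2 * μ.im)) ^ (i : ℕ) / (-I / (2 * μ.im)) ^ (m - i : ℕ) := by
      rw [← hρ, inv_pow, inv_pow, div_inv_eq_mul, ← zpow_natCast, ← zpow_natCast,
        ← _root_.zpow_neg, ← zpow_add₀ hne]
      congr 1
      push_cast [show (i : ℕ) ≤ m by omega]
      ring
    rw [mul_zpow, hz, ha3, hb3]
    simp only [hd]
    generalize (-I / (2 * (μ.im : ℂ))) ^ (m - i : ℕ) = y
    generalize (-I / (2 * (μ.im : ℂ))) ^ (i : ℕ) = z
    ring
  rw [hr, peak]
  have ha1 : (2 * μ.im * p i.rev : ℂ) = (‖a‖ : ℂ) ^ 2 := by exact_mod_cast a1 i.rev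
  have hb1 : (2 * μ.im * q i : ℂ) = (‖b‖ : ℂ) ^ 2 := by exact_mod_cast b1 i
  have hp' : (p i.rev : ℂ) = (‖a‖ : ℂ) ^ 2 / (2 * μ.im) := by
    rw [← ha1]; field_simp
  have hq' : (q i : ℂ) = (‖b‖ : ℂ) ^ 2 / (2 * μ.im) := by
    rw [← hb1]; field_simp
  have hna : (‖a‖ : ℂ) ≠ 0 := ofReal_ne_zero.2 (norm_ne_zero_iff.2 ha0)
  have haa : star a * a = (‖a‖ : ℂ) ^ 2 := by
    rw [← conj_mul', starRingEnd_apply]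
  have hsa : star a ≠ 0 := star_ne_zero.2 ha0
  have hden : (‖a‖ : ℂ) ^ 2 + (‖b‖ : ℂ) ^ 2 * (‖d ω i‖ : ℂ) ^ 2 ≠ 0 := by
    rw [show (‖a‖ : ℂ) ^ 2 + (‖b‖ : ℂ) ^ 2 * (‖d ω i‖ : ℂ) ^ 2 =
      ((‖a‖ ^ 2 + ‖b‖ ^ 2 * ‖d ω i‖ ^ 2 : ℝ) : ℂ) by push_cast; rfl, ofReal_ne_zero]
    have := norm_pos_iff.2 ha0
    positivity
  have hstar : star (b / a * d ω i) = star b * star (d ω i) / star a := by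
    rw [star_mul', star_div₀]; ring
  have hnorm : (‖b / a * d ω i‖ : ℂ) = ‖b‖ * ‖d ω i‖ / ‖a‖ := by
    rw [norm_mul, norm_div]; push_cast; ring
  rw [hp', hq', hstar, hnorm]
  have hL : (‖a‖ : ℂ) ^ 2 / (2 * μ.im) + (‖b‖ : ℂ) ^ 2 / (2 * μ.im) * (‖d ω i‖ : ℂ) ^ 2 =
      ((‖a‖ : ℂ) ^ 2 + (‖b‖ : ℂ) ^ 2 * (‖d ω i‖ : ℂ) ^ 2) / (2 * μ.im) := by ring
  have hR' : 1 + ((‖b‖ : ℂ) * ‖d ω i‖ / ‖a‖) ^ 2 =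
      ((‖a‖ : ℂ) ^ 2 + (‖b‖ : ℂ) ^ 2 * (‖d ω i‖ : ℂ) ^ 2) / (‖a‖ : ℂ) ^ 2 := by
    field_simp
  rw [hL, hR', ← haa]
  field_simp
  ring

end Peaks

/-! ### Gram matrices of exponential polynomials -/

section Gram

open MeasureTheory Set

theorem integrableOn_pow_mul_cexp_neg (k : ℕ) {w : ℂ} (hw : 0 < w.re) :
    IntegrableOn (fun y : ℝ => (y : ℂ) ^ k * cexp (-(w * y))) (Ioi 0) := by
  have h := integrableOn_rpow_mul_exp_neg_mul_rpow (p := 1) (s := k) (b := w.re)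
    (by have : (0 : ℝ) ≤ k := Nat.cast_nonneg k
        linarith) one_pos hw
  refine Integrable.mono' h (by fun_prop) ?_
  filter_upwards [self_mem_ae_restrict measurableSet_Ioi] with y hy
  have hy : 0 < y := hy
  rw [norm_mul, norm_pow, norm_real, Complex.norm_exp, Real.norm_of_nonneg hy.le]
  simp

theorem integral_pow_mul_cexp_neg (k : ℕ) {w : ℂ} (hw : 0 < w.re) :
    ∫ y : ℝ in Ioi 0, (y : ℂ) ^ k * cexp (-(w * y)) = k.factorial / w ^ (k + 1) := by
  have hw0 : w ≠ 0 := fun h => by simp [h] at hw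
  have htend : ∀ j : ℕ, Tendsto (fun y : ℝ => (y : ℂ) ^ j * cexp (-(w * y))) atTop (𝓝 0) := by
    intro j
    rw [tendsto_zero_iff_norm_tendsto_zero]
    have h1 := Real.tendsto_pow_mul_exp_neg_atTop_nhds_zero j
    have h2 := (h1.comp (tendsto_id.const_mul_atTop hw)).const_mul ((w.re ^ j)⁻¹)
    rw [mul_zero] at h2
    refine h2.congr' ?_
    filter_upwards [eventually_gt_atTop 0] with y hy
    simp only [Function.comp, id]
    rw [norm_mul, norm_pow, norm_real, Complex.norm_exp, Real.norm_of_nonneg hy.le, mul_pow]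
    have := hw.ne'
    simp only [neg_re, mul_re, ofReal_re, ofReal_im, mul_zero, sub_zero]
    field_simp
  have hderiv : ∀ (j : ℕ) (y : ℝ), HasDerivAt (fun y : ℝ => (y : ℂ) ^ j * cexp (-(w * y)))
      (j * (y : ℂ) ^ (j - 1) * cexp (-(w * y)) - w * ((y : ℂ) ^ j * cexp (-(w * y)))) y := by
    intro j y
    have h1 : HasDerivAt (fun z : ℂ => z ^ j * cexp (-(w * z)))
        (j * (y : ℂ) ^ (j - 1) * cexp (-(w * y)) + (y : ℂ) ^ j * (cexp (-(w * y)) * -(w * 1)))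
        (y : ℂ) :=
      (hasDerivAt_pow j (y : ℂ)).mul (((hasDerivAt_id (y : ℂ)).const_mul w).neg.cexp)
    have h2 := h1.comp_ofReal
    convert! h2 using 1
    ring
  induction k with
  | zero =>
    have h := integral_Ioi_of_hasDerivAt_of_tendsto (a := (0 : ℝ)) (m := 0)
      (f := fun y : ℝ => (y : ℂ) ^ 0 * cexp (-(w * y)))
      ((hderiv 0 0).continuousAt.continuousWithinAt) (fun y _ => hderiv 0 y)
      (by
        have := (integrableOn_pow_mul_cexp_neg 0 hw).const_mul (-w)
        refine IntegrableOn.congr_fun (show IntegrableOn _ _ volume from this) (fun y _ => ?_)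
          measurableSet_Ioi
        simp) (htend 0)
    simp only [Nat.cast_zero, zero_mul, zero_sub, integral_neg, integral_const_mul] at h
    simp only [pow_zero, ofReal_zero, mul_zero, neg_zero, Complex.exp_zero, one_mul] at h ⊢
    rw [Nat.factorial_zero, zero_add, pow_one, Nat.cast_one, eq_div_iff hw0]
    linear_combination -h
  | succ k ih =>
    have i1 := (integrableOn_pow_mul_cexp_neg k hw).const_mul ((k : ℂ) + 1)
    have i2 := (integrableOn_pow_mul_cexp_neg (k + 1) hw).const_mul w
    have e : ∀ y : ℝ, ((k + 1 : ℕ) : ℂ) * (y : ℂ) ^ (k + 1 - 1) * cexp (-(w * y)) -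
        w * ((y : ℂ) ^ (k + 1) * cexp (-(w * y))) =
        ((k : ℂ) + 1) * ((y : ℂ) ^ k * cexp (-(w * y))) -
        w * ((y : ℂ) ^ (k + 1) * cexp (-(w * y))) := by
      intro y; rw [Nat.add_sub_cancel]; push_cast; ring
    have h := integral_Ioi_of_hasDerivAt_of_tendsto (a := (0 : ℝ)) (m := 0)
      (f := fun y : ℝ => (y : ℂ) ^ (k + 1) * cexp (-(w * y)))
      ((hderiv (k + 1) 0).continuousAt.continuousWithinAt) (fun y _ => hderiv (k + 1) y)
      (IntegrableOn.congr_fun (show IntegrableOn _ _ volume from i1.sub i2) (fun y _ => (e y).symm)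
        measurableSet_Ioi) (htend (k + 1))
    rw [setIntegral_congr_fun measurableSet_Ioi (fun y _ => e y), integral_sub i1 i2,
      integral_const_mul, integral_const_mul, ih] at h
    simp only [ofReal_zero, ne_eq, Nat.succ_ne_zero, not_false_eq_true, zero_pow, zero_mul,
      sub_zero] at h
    rw [eq_div_iff (pow_ne_zero _ hw0), Nat.factorial_succ]
    push_cast
    have h2 : ((k : ℂ) + 1) * (k.factorial / w ^ (k + 1)) * w ^ (k + 1) =
        (k + 1) * k.factorial := by field_simp
    rw [pow_succ]
    linear_combination (-w ^ (k + 1)) * h + h2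

/-- The inner product of the exponential polynomials `(i y)^r / r! · exp (i μ y)` and
`(i y)^s / s! · exp (i ν y)` on the half line. -/
def gramEntry (μ ν : ℂ) (r s : ℕ) : ℂ :=
  -I * (((r + s).choose r : ℕ) * (-1) ^ r / (star μ - ν) ^ (r + s + 1))

/-- The exponential polynomial `(i y)^r / r! · exp (i μ y)`. -/
def expPoly (μ : ℂ) (r : ℕ) (y : ℝ) : ℂ :=
  (I * y) ^ r / (r.factorial : ℂ) * cexp (I * μ * y)

theorem star_expPoly_mul (μ ν : ℂ) (r s : ℕ) (y : ℝ) :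
    star (expPoly μ r y) * expPoly ν s y =
      ((-I) ^ r * I ^ s / (r.factorial * s.factorial)) *
        ((y : ℂ) ^ (r + s) * cexp (-(I * (star μ - ν) * y))) := by
  have h : cexp (-(I * (star μ - ν) * y)) = cexp (-I * star μ * y) * cexp (I * ν * y) := by
    rw [← Complex.exp_add]; congr 1; ring
  rw [h, expPoly, expPoly, star_mul', star_div₀, star_pow, star_mul']
  have h1 : star (cexp (I * μ * y)) = cexp (-I * star μ * y) := by
    rw [← starRingEnd_apply, ← Complex.exp_conj, map_mul, map_mul, conj_I, conj_ofReal,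
      starRingEnd_apply]
  have h2 : star (y : ℂ) = y := conj_ofReal y
  have h3 : star I = -I := conj_I
  have h4 : star (r.factorial : ℂ) = r.factorial := by
    rw [← starRingEnd_apply, map_natCast]
  rw [h1, h2, h3, h4, mul_pow, mul_pow, pow_add]
  ring

theorem re_I_mul_pos {μ ν : ℂ} (hμ : 0 < μ.im) (hν : 0 < ν.im) : 0 < (I * (star μ - ν)).re := by
  simp
  linarith

theorem integral_star_expPoly_mul {μ ν : ℂ} (hμ : 0 < μ.im) (hν : 0 < ν.im) (r s : ℕ) :
    IntegrableOn (fun y => star (expPoly μ r y) * expPoly ν s y) (Ioi 0) ∧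
    ∫ y in Ioi 0, star (expPoly μ r y) * expPoly ν s y = gramEntry μ ν r s := by
  have hw := re_I_mul_pos hμ hν
  have hδ : star μ - ν ≠ 0 := fun h => by rw [h, mul_zero, zero_re] at hw; exact lt_irrefl _ hw
  simp only [star_expPoly_mul]
  refine ⟨(integrableOn_pow_mul_cexp_neg (r + s) hw).const_mul _, ?_⟩
  rw [integral_const_mul, integral_pow_mul_cexp_neg (r + s) hw, gramEntry]
  have h := Nat.add_choose_mul_factorial_mul_factorial r s
  have h' : ((r + s).choose r : ℂ) * r.factorial * s.factorial = (r + s).factorial := by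
    rw [Nat.choose_symm_add]
    exact_mod_cast h
  have h1 : (r.factorial : ℂ) ≠ 0 := Nat.cast_ne_zero.2 (Nat.factorial_ne_zero _)
  have h2 : (s.factorial : ℂ) ≠ 0 := Nat.cast_ne_zero.2 (Nat.factorial_ne_zero _)
  rw [← h', mul_pow, pow_succ I, pow_add I, neg_pow]
  have hI := I_ne_zero
  have hII : (I : ℂ)⁻¹ = -I := inv_I
  field_simp
  rw [I_sq]
  ring

/-- The Gram matrix of arbitrary exponential polynomials: its quadratic form is the integral of the
squared modulus of a linear combination. -/
theorem posSemidef_gram {ι : Type*} [Fintype ι] (μ : ι → ℂ) (hμ : ∀ i, 0 < (μ i).im)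
    (r : ι → ℕ) : (of fun i j => gramEntry (μ i) (μ j) (r i) (r j)).PosSemidef := by
  have hval := fun i j => integral_star_expPoly_mul (hμ i) (hμ j) (r i) (r j)
  have key : ∀ x : ι → ℂ,
      star x ⬝ᵥ ((of fun i j => gramEntry (μ i) (μ j) (r i) (r j)) *ᵥ x) =
      ((∫ y in Ioi (0 : ℝ), ‖∑ i, x i * expPoly (μ i) (r i) y‖ ^ 2 : ℝ) : ℂ) := by
    intro x
    rw [← integral_complex_ofReal]
    have h1 : ∀ y : ℝ, ((‖∑ i, x i * expPoly (μ i) (r i) y‖ ^ 2 : ℝ) : ℂ) =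
        ∑ i, ∑ j, (star (x i) * x j) *
          (star (expPoly (μ i) (r i) y) * expPoly (μ j) (r j) y) := by
      intro y
      push_cast
      rw [← conj_mul', starRingEnd_apply, star_sum, Finset.sum_mul_sum]
      refine Finset.sum_congr rfl fun i _ => Finset.sum_congr rfl fun j _ => ?_
      rw [star_mul']; ring
    simp only [h1]
    rw [integral_finsetSum _ fun i _ => integrable_finsetSum _ fun j _ =>
      ((hval i j).1.const_mul _)]
    simp only [dotProduct, mulVec, Finset.mul_sum]
    refine Finset.sum_congr rfl fun i _ => ?_
    rw [integral_finsetSum _ fun j _ => ((hval i j).1.const_mul _)]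
    refine Finset.sum_congr rfl fun j _ => ?_
    rw [integral_const_mul, (hval i j).2, of_apply, Pi.star_apply]
    ring
  refine PosSemidef.of_dotProduct_mulVec_nonneg ?_ fun x => ?_
  · ext i j
    rw [conjTranspose_apply, of_apply, of_apply, ← (hval j i).2, ← (hval i j).2,
      ← starRingEnd_apply, ← integral_conj]
    congr 1
    funext y
    rw [map_mul, starRingEnd_apply, starRingEnd_apply, star_star, mul_comm]
  · rw [key]
    exact_mod_cast integral_nonneg fun y => by positivity

theorem jordan_mulVec_apply {n : ℕ} (μ : ℂ) (v : Fin n → ℂ) (i : Fin n) :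
    (jordan n μ *ᵥ v) i = μ * v i + if h : (i : ℕ) + 1 < n then v ⟨i + 1, h⟩ else 0 := by
  have h1 : ∀ j, jordan n μ i j * v j =
      (if i = j then μ * v j else 0) + if (j : ℕ) = i + 1 then v j else 0 := by
    intro j
    rcases eq_or_ne i j with rfl | h
    · simp [jordan]
    · simp [jordan, h]
  rw [mulVec, dotProduct, Finset.sum_congr rfl fun j _ => h1 j, Finset.sum_add_distrib,
    Finset.sum_ite_eq, if_pos (Finset.mem_univ i)]
  congr 1
  split_ifs with h
  · rw [Finset.sum_eq_single ⟨i + 1, h⟩]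
    · simp
    · intro j _ hj
      rw [if_neg fun h' => hj (Fin.ext h')]
    · simp
  · refine Finset.sum_eq_zero fun j _ => if_neg ?_
    have := j.2
    omega

theorem det_jordan_sub (n : ℕ) (μ ν : ℂ) :
    (jordan n μ - ν • (1 : Matrix (Fin n) (Fin n) ℂ)).det = (μ - ν) ^ n := by
  rw [det_of_isUpperTriangular]
  · simp [jordan]
  · intro i j hij
    have hij : j < i := hij
    have h1 : ¬ (j : ℕ) = i + 1 := by have : (j : ℕ) < i := hij; omega
    simp [jordan, h1, ne_of_gt hij]

/-- The row vector of the values at `0` of the exponential polynomials. -/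
def firstRow (n : ℕ) : Fin n → ℂ := fun i => if (i : ℕ) = 0 then 1 else 0

theorem star_firstRow (n : ℕ) : star (firstRow n) = firstRow n := by
  funext i
  simp only [firstRow, Pi.star_apply]
  split_ifs <;> simp

/-- An eigenvector of a Jordan block is determined by its first entry. -/
theorem eq_zero_of_jordan_mulVec_eq {n : ℕ} {μ ρ : ℂ} {v : Fin n → ℂ}
    (h : jordan n μ *ᵥ v = ρ • v) (hv : ρ = μ → firstRow n ⬝ᵥ v = 0) : v = 0 := by
  by_cases hρ : ρ = μ
  · have h0 : ∀ i : Fin n, (i : ℕ) ≠ 0 → v i = 0 := by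
      rintro ⟨i, hi⟩ h0
      obtain ⟨i, rfl⟩ := Nat.exists_eq_succ_of_ne_zero h0
      have h1 := congrFun h ⟨i, by omega⟩
      rw [jordan_mulVec_apply, dif_pos hi, Pi.smul_apply, smul_eq_mul, hρ] at h1
      simpa using h1
    funext i
    by_cases hi : (i : ℕ) = 0
    · have h2 := hv hρ
      rw [dotProduct, Finset.sum_eq_single i] at h2
      · simpa [firstRow, hi] using h2
      · intro j _ hj
        have : (j : ℕ) ≠ 0 := fun h => hj (Fin.ext (by omega))
        simp [firstRow, this]
      · simp
    · exact h0 i hi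
  · by_contra hne
    have h1 : (jordan n μ - ρ • (1 : Matrix (Fin n) (Fin n) ℂ)) *ᵥ v = 0 := by
      rw [Matrix.sub_mulVec, h, Matrix.smul_mulVec, one_mulVec, sub_self]
    have h2 := exists_mulVec_eq_zero_iff.1 ⟨v, hne, h1⟩
    rw [det_jordan_sub] at h2
    exact pow_ne_zero _ (sub_ne_zero.2 (Ne.symm hρ)) h2

/-- The Gram matrix of two families of exponential polynomials. -/
def gramBlock (m n : ℕ) (μ ν : ℂ) : Matrix (Fin m) (Fin n) ℂ :=
  of fun r s => gramEntry μ ν r s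

theorem jordan_conjTranspose_mul_apply {m n : ℕ} (μ : ℂ) (B : Matrix (Fin m) (Fin n) ℂ)
    (i : Fin m) (j : Fin n) : ((jordan m μ)ᴴ * B) i j = star μ * B i j +
      if h : 0 < (i : ℕ) then B ⟨i - 1, by omega⟩ j else 0 := by
  have h1 : ∀ k, (jordan m μ)ᴴ i k * B k j =
      (if i = k then star μ * B k j else 0) + if (k : ℕ) + 1 = i then B k j else 0 := by
    intro k
    rcases eq_or_ne i k with rfl | h
    · simp [jordan]
    · by_cases h' : (i : ℕ) = k + 1
      · simp [jordan, Ne.symm h, h, h']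
      · simp [jordan, Ne.symm h, h, h', Ne.symm h']
  rw [mul_apply, Finset.sum_congr rfl fun j _ => h1 j, Finset.sum_add_distrib,
    Finset.sum_ite_eq, if_pos (Finset.mem_univ i)]
  congr 1
  split_ifs with h
  · rw [Finset.sum_eq_single ⟨i - 1, by omega⟩]
    · simp [Nat.sub_add_cancel h]
    · intro k _ hk
      rw [if_neg fun h' => hk (Fin.ext (by simp; omega))]
    · simp
  · refine Finset.sum_eq_zero fun k _ => if_neg ?_
    omega

theorem mul_jordan_apply {m n : ℕ} (ν : ℂ) (B : Matrix (Fin m) (Fin n) ℂ)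
    (i : Fin m) (j : Fin n) : (B * jordan n ν) i j = ν * B i j +
      if h : 0 < (j : ℕ) then B i ⟨j - 1, by omega⟩ else 0 := by
  have h1 := jordan_conjTranspose_mul_apply ν Bᴴ j i
  have h2 := congrArg star h1
  rw [← conjTranspose_mul, conjTranspose_apply, star_star, star_add, star_mul', star_star,
    conjTranspose_apply, star_star] at h2
  rw [h2]
  congr 1
  split_ifs with h
  · rw [conjTranspose_apply, star_star]
  · rw [star_zero]

/-- The displacement equation of a block of the Gram matrix: Pascal's rule. -/
theorem gramBlock_displacement (m n : ℕ) {μ ν : ℂ} (h : star μ ≠ ν) :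
    (jordan m μ)ᴴ * gramBlock m n μ ν - gramBlock m n μ ν * jordan n ν =
      (-I) • vecMulVec (star (firstRow m)) (firstRow n) := by
  have hδ : star μ - ν ≠ 0 := sub_ne_zero.2 h
  rw [star_firstRow]
  ext ⟨i, hi⟩ ⟨j, hj⟩
  rw [Matrix.sub_apply, jordan_conjTranspose_mul_apply, mul_jordan_apply, Matrix.smul_apply,
    vecMulVec_apply]
  simp only [gramBlock, of_apply, gramEntry, firstRow, smul_eq_mul]
  generalize hd : star μ - ν = d at *
  have hμ : star μ = d + ν := by rw [← hd]; ring
  rw [hμ]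
  rcases i with _ | i <;> rcases j with _ | j
  · simp
    field_simp
    ring
  · simp
    field_simp
    ring
  · simp
    field_simp
    ring
  -- The generic entry is the only one that uses Pascal's rule; the others sit on the boundary.
  · have hp : ((i + 1 + (j + 1)).choose (i + 1) : ℂ) =
        (i + (j + 1)).choose i + (i + 1 + j).choose (i + 1) := by
      have : i + 1 + (j + 1) = (i + 1 + j) + 1 := by ring
      rw [this, Nat.choose_succ_succ, show i + (j + 1) = i + 1 + j by ring]
      push_cast; rfl
    simp only [Nat.zero_lt_succ, dif_pos, Nat.add_sub_cancel, Nat.succ_ne_zero, if_false,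
      mul_zero, hp]
    have e1 : d ^ (i + 1 + (j + 1) + 1) = d ^ (i + j + 2) * d := by ring
    have e2 : d ^ (i + (j + 1) + 1) = d ^ (i + j + 2) := by ring
    have e3 : d ^ (i + 1 + j + 1) = d ^ (i + j + 2) := by ring
    rw [e1, e2, e3]
    have := pow_ne_zero (i + j + 2) hδ
    generalize d ^ (i + j + 2) = D at *
    field_simp
    ring

end Gram

/-! ### The Gram matrix of two blocks -/

section TwoBlocks

variable {m n : ℕ} {μ ν : ℂ}

/-- The Gram matrix of the exponential polynomials attached to two spectral parameters. -/
def gramTwo (m n : ℕ) (μ ν : ℂ) : Matrix (Fin m ⊕ Fin n) (Fin m ⊕ Fin n) ℂ :=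
  fromBlocks (gramBlock m m μ μ) (gramBlock m n μ ν) (gramBlock n m ν μ) (gramBlock n n ν ν)

theorem posSemidef_gramTwo (hμ : 0 < μ.im) (hν : 0 < ν.im) : (gramTwo m n μ ν).PosSemidef := by
  have h := posSemidef_gram (Sum.elim (fun _ : Fin m => μ) (fun _ : Fin n => ν))
    (by rintro (i | i) <;> simpa) (Sum.elim (fun i => (i : ℕ)) (fun i => (i : ℕ)))
  convert h using 1
  ext (i | i) (j | j) <;> simp [gramTwo, gramBlock]

theorem gramBlock_conjTranspose (hμ : 0 < μ.im) (hν : 0 < ν.im) :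
    (gramBlock m n μ ν)ᴴ = gramBlock n m ν μ :=
  (isHermitian_fromBlocks_iff.1 (posSemidef_gramTwo hμ hν).isHermitian).2.1

theorem star_ne_of_im_pos (hμ : 0 < μ.im) (hν : 0 < ν.im) : star μ ≠ ν := by
  intro h
  have := congrArg Complex.im h
  simp at this
  linarith

theorem gramTwo_displacement (hμ : 0 < μ.im) (hν : 0 < ν.im) :
    (fromBlocks (jordan m μ) 0 0 (jordan n ν))ᴴ * gramTwo m n μ ν -
      gramTwo m n μ ν * fromBlocks (jordan m μ) 0 0 (jordan n ν) =
      (-I) • vecMulVec (star (Sum.elim (firstRow m) (firstRow n)))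
        (Sum.elim (firstRow m) (firstRow n)) := by
  rw [gramTwo, fromBlocks_conjTranspose, fromBlocks_multiply, fromBlocks_multiply]
  simp only [conjTranspose_zero, Matrix.zero_mul, Matrix.mul_zero, add_zero, zero_add]
  have h11 := gramBlock_displacement m m (star_ne_of_im_pos hμ hμ)
  have h12 := gramBlock_displacement m n (star_ne_of_im_pos hμ hν)
  have h21 := gramBlock_displacement n m (star_ne_of_im_pos hν hμ)
  have h22 := gramBlock_displacement n n (star_ne_of_im_pos hν hν)
  ext (i | i) (j | j)
  · simpa [vecMulVec_apply] using congrFun (congrFun h11 i) j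
  · simpa [vecMulVec_apply] using congrFun (congrFun h12 i) j
  · simpa [vecMulVec_apply] using congrFun (congrFun h21 i) j
  · simpa [vecMulVec_apply] using congrFun (congrFun h22 i) j

/-- The kernel of the Gram matrix is invariant under the Jordan matrix and is annihilated by the
row of values at `0`; an eigenvector in it would have to vanish. -/
theorem posDef_gramTwo (hμ : 0 < μ.im) (hν : 0 < ν.im) (hne : μ ≠ ν) :
    (gramTwo m n μ ν).PosDef := by
  have hpsd : (gramTwo m n μ ν).PosSemidef := posSemidef_gramTwo hμ hν
  set G := gramTwo m n μ ν with hG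
  set J : Matrix (Fin m ⊕ Fin n) (Fin m ⊕ Fin n) ℂ :=
    fromBlocks (jordan m μ) 0 0 (jordan n ν) with hJ
  set e : Fin m ⊕ Fin n → ℂ := Sum.elim (firstRow m) (firstRow n) with he
  have hdisp : Jᴴ * G - G * J = (-I) • vecMulVec (star e) e := gramTwo_displacement hμ hν
  have hker : ∀ v, G *ᵥ v = 0 → e ⬝ᵥ v = 0 ∧ G *ᵥ (J *ᵥ v) = 0 := by
    intro v hv
    have h1 := congrArg (fun M => M *ᵥ v) hdisp
    simp only [Matrix.sub_mulVec, ← mulVec_mulVec, hv, mulVec_zero, zero_sub,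
      Matrix.smul_mulVec, vecMulVec_mulVec] at h1
    have h2 : star v ⬝ᵥ (G *ᵥ (J *ᵥ v)) = 0 := by
      rw [dotProduct_mulVec, ← hpsd.isHermitian.eq, ← star_mulVec, hv, star_zero,
        zero_dotProduct]
    have h3 := congrArg (fun w => star v ⬝ᵥ w) h1
    simp only [dotProduct_neg, h2, neg_zero] at h3
    have h4 : e ⬝ᵥ v = 0 := by
      have h5 : star v ⬝ᵥ star e = star (e ⬝ᵥ v) := by rw [star_dotProduct_star, dotProduct_comm]
      simp [dotProduct_smul, h5] at h3
      exact h3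
    refine ⟨h4, ?_⟩
    rw [h4] at h1
    simpa using h1
  have hinj : ∀ v, G *ᵥ v = 0 → v = 0 := by
    by_contra! hcon
    obtain ⟨v₀, hv₀, hne₀⟩ := hcon
    set K := LinearMap.ker (toLin' G) with hK
    have hmaps : ∀ v ∈ K, toLin' J v ∈ K := by
      intro v hv
      rw [hK, LinearMap.mem_ker, toLin'_apply] at hv ⊢
      rw [toLin'_apply]
      exact (hker v hv).2
    have : Nontrivial K := by
      refine ⟨⟨⟨v₀, ?_⟩, 0, fun h => hne₀ (congrArg Subtype.val h)⟩⟩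
      rw [hK, LinearMap.mem_ker, toLin'_apply, hv₀]
    obtain ⟨ρ, hρ⟩ := Module.End.exists_eigenvalue ((toLin' J).restrict hmaps)
    obtain ⟨⟨w, hwK⟩, hw⟩ := hρ.exists_hasEigenvector
    have hw1 : J *ᵥ w = ρ • w := by
      have := congrArg Subtype.val hw.apply_eq_smul
      simpa using this
    have hw0 : w ≠ 0 := fun h => hw.2 (Subtype.ext h)
    have hwe : e ⬝ᵥ w = 0 := by
      rw [hK, LinearMap.mem_ker, toLin'_apply] at hwK
      exact (hker w hwK).1
    have hwe' : firstRow m ⬝ᵥ (w ∘ Sum.inl) + firstRow n ⬝ᵥ (w ∘ Sum.inr) = 0 := by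
      rw [← hwe, he]
      simp [dotProduct, Fintype.sum_sum_type]
    rw [hJ, fromBlocks_mulVec] at hw1
    have ha : jordan m μ *ᵥ (w ∘ Sum.inl) = ρ • (w ∘ Sum.inl) := by
      funext i; simpa using congrFun hw1 (Sum.inl i)
    have hb : jordan n ν *ᵥ (w ∘ Sum.inr) = ρ • (w ∘ Sum.inr) := by
      funext i; simpa using congrFun hw1 (Sum.inr i)
    -- An eigenvector lives in a single block, and `e` sees its first entry.
    have hcases : w ∘ Sum.inl = 0 ∧ w ∘ Sum.inr = 0 := by
      by_cases h : ρ = μ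
      · have hb0 := eq_zero_of_jordan_mulVec_eq hb fun h' => absurd (h.symm.trans h') hne
        rw [hb0, dotProduct_zero, add_zero] at hwe'
        exact ⟨eq_zero_of_jordan_mulVec_eq ha fun _ => hwe', hb0⟩
      · have ha0 := eq_zero_of_jordan_mulVec_eq ha fun h' => absurd h' h
        rw [ha0, dotProduct_zero, zero_add] at hwe'
        exact ⟨ha0, eq_zero_of_jordan_mulVec_eq hb fun _ => hwe'⟩
    apply hw0
    funext i
    rcases i with i | i
    · exact congrFun hcases.1 i
    · exact congrFun hcases.2 i
  refine PosDef.of_dotProduct_mulVec_pos hpsd.isHermitian fun x hx => ?_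
  refine lt_of_le_of_ne (hpsd.dotProduct_mulVec_nonneg x) fun h => hx (hinj x ?_)
  exact (hpsd.dotProduct_mulVec_zero_iff x).1 h.symm

/-- The Schur complement inherits the displacement equation. -/
theorem schur_displacement {ι κ : Type*} [Fintype ι] [Fintype κ] [DecidableEq ι]
    {A Jf : Matrix ι ι ℂ} {B : Matrix ι κ ℂ} {D Js : Matrix κ κ ℂ} {e : ι → ℂ} {f : κ → ℂ}
    (hA : Aᴴ = A) (hAd : IsUnit A.det)
    (h1 : Jfᴴ * A - A * Jf = (-I) • vecMulVec (star e) e)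
    (h2 : Jfᴴ * B - B * Js = (-I) • vecMulVec (star e) f)
    (h3 : Jsᴴ * D - D * Js = (-I) • vecMulVec (star f) f) :
    Jsᴴ * (D - Bᴴ * A⁻¹ * B) - (D - Bᴴ * A⁻¹ * B) * Js =
      (-I) • vecMulVec (star (f - e ᵥ* (A⁻¹ * B))) (f - e ᵥ* (A⁻¹ * B)) := by
  set X := A⁻¹ * B with hX
  have hAX : A * X = B := by rw [hX, ← Matrix.mul_assoc, mul_nonsing_inv _ hAd, Matrix.one_mul]
  have hXA : Xᴴ * A = Bᴴ := by
    have := congrArg conjTranspose hAX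
    rwa [conjTranspose_mul, hA] at this
  have hS : Bᴴ * A⁻¹ * B = Xᴴ * A * X := by rw [hXA, hX, Matrix.mul_assoc]
  rw [hS]
  set y := e ᵥ* X with hy
  set b := f - y with hb
  set Z := Jf * X - X * Js with hZ
  have hAZ : A * Z = (-I) • vecMulVec (star e) b := by
    have e1 : A * Z = (Jfᴴ * B - B * Js) - (Jfᴴ * A - A * Jf) * X := by
      rw [hZ, ← hAX]
      simp only [Matrix.mul_sub, Matrix.sub_mul, Matrix.mul_assoc]; abel
    rw [e1, h1, h2, Matrix.smul_mul, vecMulVec_mul, ← smul_sub, ← vecMulVec_sub]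
  -- The equation for `A Z` and its adjoint turn the displacement of `X† A X` into rank one terms.
  have hZA : Zᴴ * A = I • vecMulVec (star b) e := by
    have := congrArg conjTranspose hAZ
    rw [conjTranspose_mul, hA, conjTranspose_smul, conjTranspose_vecMulVec, star_star] at this
    rw [this]
    simp
  have hXJ : X * Js = Jf * X - Z := by rw [hZ]; abel
  have hJX : Jsᴴ * Xᴴ = Xᴴ * Jfᴴ - Zᴴ := by
    rw [← conjTranspose_mul, hXJ, conjTranspose_sub, conjTranspose_mul]
  have e2 : Jsᴴ * (D - Xᴴ * A * X) - (D - Xᴴ * A * X) * Js =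
      (Jsᴴ * D - D * Js) - ((Jsᴴ * Xᴴ) * A * X - Xᴴ * A * (X * Js)) := by
    simp only [Matrix.mul_sub, Matrix.sub_mul, Matrix.mul_assoc]; abel
  have e3 : (Xᴴ * Jfᴴ - Zᴴ) * A * X - Xᴴ * A * (Jf * X - Z) =
      Xᴴ * (Jfᴴ * A - A * Jf) * X - (Zᴴ * A) * X + Xᴴ * (A * Z) := by
    simp only [Matrix.mul_sub, Matrix.sub_mul, Matrix.mul_assoc]; abel
  rw [e2, hJX, hXJ, e3, h3, h1, hAZ, hZA]
  have hyX : Xᴴ *ᵥ star e = star y := by rw [hy, star_vecMul]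
  simp only [Matrix.smul_mul, Matrix.mul_smul, vecMulVec_mul, mul_vecMulVec, hyX, ← hy]
  have hf : f = b + y := by rw [hb]; abel
  rw [hf, star_add, vecMulVec_add, add_vecMulVec, add_vecMulVec]
  module

/-- The first entry of the reduced row vector is a Blaschke factor, by the matrix determinant
lemma. -/
theorem schur_firstRow_eq {A : Matrix (Fin m) (Fin m) ℂ} {B : Matrix (Fin m) (Fin (n + 1)) ℂ}
    (hAd : IsUnit A.det) (hμν : star μ ≠ ν)
    (h1 : (jordan m μ)ᴴ * A - A * jordan m μ = (-I) • vecMulVec (star (firstRow m)) (firstRow m))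
    (h2 : (jordan m μ)ᴴ * B - B * jordan (n + 1) ν =
      (-I) • vecMulVec (star (firstRow m)) (firstRow (n + 1))) :
    (firstRow (n + 1) - firstRow m ᵥ* (A⁻¹ * B)) 0 = ((μ - ν) / (star μ - ν)) ^ m := by
  set c : Fin m → ℂ := fun i => B i 0 with hc
  set e := firstRow m with he
  set u : Fin m → ℂ := -(A⁻¹ *ᵥ c) with hu
  set M := (jordan m μ)ᴴ - ν • (1 : Matrix (Fin m) (Fin m) ℂ) with hM
  have hMdet : M.det = (star μ - ν) ^ m := by
    have : M = (jordan m μ - star ν • (1 : Matrix (Fin m) (Fin m) ℂ))ᴴ := by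
      rw [hM, conjTranspose_sub, conjTranspose_smul, conjTranspose_one, star_star]
    rw [this, det_conjTranspose, det_jordan_sub, star_pow, star_sub, star_star]
  -- Only the first column `c` of `B` matters, and the displacement equation determines it.
  have hMc : M *ᵥ c = (-I) • star e := by
    funext i
    have h3 := congrFun (congrFun h2 i) 0
    rw [Matrix.sub_apply, mul_jordan_apply, dif_neg (by simp), add_zero, Matrix.smul_apply,
      vecMulVec_apply] at h3
    rw [hM, Matrix.sub_mulVec, Matrix.smul_mulVec, one_mulVec, Pi.sub_apply, Pi.smul_apply,
      Pi.smul_apply, smul_eq_mul, smul_eq_mul]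
    have h4 : ((jordan m μ)ᴴ *ᵥ c) i = ((jordan m μ)ᴴ * B) i 0 := by
      simp [mulVec, dotProduct, mul_apply, hc]
    rw [h4]
    simpa [firstRow] using h3
  have hAu : A *ᵥ u = -c := by
    rw [hu, mulVec_neg, mulVec_mulVec, mul_nonsing_inv _ hAd, one_mulVec]
  have key : M * A * (1 + vecMulVec u e) = A * (jordan m μ - ν • 1) := by
    have h5 : M * A * vecMulVec u e = I • vecMulVec (star e) e := by
      rw [Matrix.mul_assoc, mul_vecMulVec, hAu, mul_vecMulVec, mulVec_neg, hMc]
      ext i j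
      simp [vecMulVec_apply, mul_assoc]
    have h6 : I • vecMulVec (star e) e = -((jordan m μ)ᴴ * A - A * jordan m μ) := by
      rw [h1]; simp
    rw [Matrix.mul_add, Matrix.mul_one, h5, h6, hM, Matrix.sub_mul, Matrix.mul_sub,
      Matrix.smul_mul, Matrix.mul_smul, Matrix.one_mul, Matrix.mul_one]
    abel
  have hdet := congrArg Matrix.det key
  have hdu : (1 + vecMulVec u e).det = 1 + e ⬝ᵥ u := by
    rw [vecMulVec_eq Unit, det_one_add_replicateCol_mul_replicateRow]
  rw [det_mul, det_mul, det_mul, hMdet, det_jordan_sub, hdu] at hdet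
  have hgoal : (firstRow (n + 1) - e ᵥ* (A⁻¹ * B)) 0 = 1 + e ⬝ᵥ u := by
    have h7 : (e ᵥ* (A⁻¹ * B)) 0 = e ⬝ᵥ (A⁻¹ *ᵥ c) := by
      rw [dotProduct_mulVec, ← vecMul_vecMul]
      simp [vecMul, dotProduct, hc]
    rw [Pi.sub_apply, h7, hu, dotProduct_neg]
    simp [firstRow, sub_eq_add_neg]
  rw [hgoal, div_pow, eq_div_iff (pow_ne_zero _ (sub_ne_zero.2 hμν))]
  apply mul_left_cancel₀ hAd.ne_zero
  rw [← hdet]; ring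

end TwoBlocks

/-! ### Decoupling of two blocks -/

/-- The scalar amplitude extracted from a transfer matrix by a row vector `α` on the left and the
adjoint of a row vector `β` on the right. -/
def amplitude {ι : Type*} [Fintype ι] [DecidableEq ι] (P Q : Matrix ι ι ℂ) (α β : ι → ℂ)
    (T : Matrix ι ι ℂ) : ℂ := -2 * I * (α ⬝ᵥ (transfer P T Q *ᵥ star β))

theorem isBigO_mul_mul_apply {ι κ Ω : Type*} [Fintype ι] [Fintype κ] {l : Filter Ω} {g : Ω → ℝ}
    {A : Ω → Matrix ι ι ℂ} {B : Ω → Matrix κ κ ℂ}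
    (h : ∀ i j k m, (fun ω => A ω i j * B ω k m) =O[l] g) (C : Matrix ι κ ℂ) (i : ι) (m : κ) :
    (fun ω => (A ω * C * B ω) i m) =O[l] g := by
  simp only [mul_apply, Finset.sum_mul]
  refine IsBigO.fun_sum fun k _ => IsBigO.fun_sum fun j _ => ?_
  exact ((h i j k m).const_mul_left (C j k)).congr_left fun ω => by ring

section Decoupling

variable {ι κ : Type*} [Fintype ι] [DecidableEq ι] [Fintype κ] [DecidableEq κ]
  {Ω : Type*} {l : Filter Ω} {g : Ω → ℝ}

theorem transfer_fromBlocks {P₁ Q₁ T₁ : Matrix ι ι ℂ} {P₂ Q₂ T₂ : Matrix κ κ ℂ}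
    (hP₁ : P₁.PosDef) (hQ₁ : Q₁.PosDef) (hP₂ : P₂.PosDef) (hQ₂ : Q₂.PosDef) :
    transfer (fromBlocks P₁ 0 0 P₂) (fromBlocks T₁ 0 0 T₂) (fromBlocks Q₁ 0 0 Q₂) =
      fromBlocks (transfer P₁ T₁ Q₁) 0 0 (transfer P₂ T₂ Q₂) := by
  have h1 := (hP₁.add_posSemidef (hQ₁.posSemidef.conjTranspose_mul_mul_same T₁)).isUnit
  have h2 := (hP₂.add_posSemidef (hQ₂.posSemidef.conjTranspose_mul_mul_same T₂)).isUnit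
  rw [isUnit_iff_isUnit_det] at h1 h2
  unfold transfer
  rw [fromBlocks_conjTranspose, fromBlocks_multiply, fromBlocks_multiply, fromBlocks_add]
  simp only [conjTranspose_zero, Matrix.zero_mul, Matrix.mul_zero, add_zero, zero_add]
  have : (fromBlocks (P₁ + T₁ᴴ * Q₁ * T₁) 0 0 (P₂ + T₂ᴴ * Q₂ * T₂))⁻¹ =
      fromBlocks (P₁ + T₁ᴴ * Q₁ * T₁)⁻¹ 0 0 (P₂ + T₂ᴴ * Q₂ * T₂)⁻¹ := by
    apply inv_eq_right_inv
    rw [fromBlocks_multiply]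
    simp [mul_nonsing_inv _ h1, mul_nonsing_inv _ h2]
  rw [this, fromBlocks_multiply]
  simp

variable {A : Matrix ι ι ℂ} {B : Matrix ι κ ℂ} {D : Matrix κ κ ℂ}

/-- Block elimination with the second block as pivot. -/
theorem conj_fromBlocks_left (hD : D.PosDef) :
    (fromBlocks 1 0 (-(D⁻¹ * Bᴴ)) 1)ᴴ * fromBlocks A B Bᴴ D *
      (fromBlocks 1 0 (-(D⁻¹ * Bᴴ)) 1 : Matrix (ι ⊕ κ) (ι ⊕ κ) ℂ) =
      fromBlocks (A - B * D⁻¹ * Bᴴ) 0 0 D := by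
  have hDu : IsUnit D.det := (isUnit_iff_isUnit_det _).1 hD.isUnit
  have hDi : (D⁻¹)ᴴ = D⁻¹ := by rw [conjTranspose_nonsing_inv, hD.isHermitian.eq]
  rw [fromBlocks_conjTranspose, fromBlocks_multiply, fromBlocks_multiply]
  simp only [conjTranspose_one, conjTranspose_zero, conjTranspose_neg, conjTranspose_mul,
    conjTranspose_conjTranspose, hDi, Matrix.mul_neg, Matrix.neg_mul, Matrix.mul_one,
    Matrix.one_mul, Matrix.mul_zero, Matrix.zero_mul, zero_add, Matrix.mul_assoc,
    nonsing_inv_mul _ hDu, mul_nonsing_inv_cancel_left _ _ hDu]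
  simp [sub_eq_add_neg]

/-- Block elimination with the first block as pivot. -/
theorem conj_fromBlocks_right (hA : A.PosDef) :
    (fromBlocks 1 (-(A⁻¹ * B)) 0 1)ᴴ * fromBlocks A B Bᴴ D *
      (fromBlocks 1 (-(A⁻¹ * B)) 0 1 : Matrix (ι ⊕ κ) (ι ⊕ κ) ℂ) =
      fromBlocks A 0 0 (D - Bᴴ * A⁻¹ * B) := by
  have hAu : IsUnit A.det := (isUnit_iff_isUnit_det _).1 hA.isUnit
  have hAi : (A⁻¹)ᴴ = A⁻¹ := by rw [conjTranspose_nonsing_inv, hA.isHermitian.eq]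
  rw [fromBlocks_conjTranspose, fromBlocks_multiply, fromBlocks_multiply]
  simp only [conjTranspose_one, conjTranspose_zero, conjTranspose_neg, conjTranspose_mul,
    hAi, Matrix.mul_neg, Matrix.neg_mul, Matrix.mul_one,
    Matrix.one_mul, Matrix.mul_zero, Matrix.zero_mul, add_zero, Matrix.mul_assoc,
    nonsing_inv_mul _ hAu, mul_nonsing_inv_cancel_left _ _ hAu]
  simp [sub_eq_add_neg, add_comm]

theorem posDef_schur_left (hG : (fromBlocks A B Bᴴ D).PosDef) :
    (A - B * D⁻¹ * Bᴴ).PosDef := by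
  have hD : D.PosDef := hG.submatrix Sum.inr_injective
  have hDu : IsUnit D.det := (isUnit_iff_isUnit_det _).1 hD.isUnit
  set U : Matrix (ι ⊕ κ) (ι ⊕ κ) ℂ := fromBlocks 1 0 (-(D⁻¹ * Bᴴ)) 1 with hU
  have hUdet : IsUnit U.det := by rw [hU, det_fromBlocks_zero₁₂]; simp
  have hp : (fromBlocks (A - B * D⁻¹ * Bᴴ) 0 0 D).PosDef := by
    rw [← conj_fromBlocks_left hD]
    exact hG.conjTranspose_mul_mul_same (mulVec_injective_iff_isUnit.2
      ((isUnit_iff_isUnit_det _).2 hUdet))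
  exact hp.submatrix Sum.inl_injective

theorem posDef_schur_right (hG : (fromBlocks A B Bᴴ D).PosDef) :
    (D - Bᴴ * A⁻¹ * B).PosDef := by
  have hA : A.PosDef := hG.submatrix Sum.inl_injective
  set V : Matrix (ι ⊕ κ) (ι ⊕ κ) ℂ := fromBlocks 1 (-(A⁻¹ * B)) 0 1 with hV
  have hVdet : IsUnit V.det := by rw [hV, det_fromBlocks_zero₂₁]; simp
  have hq : (fromBlocks A 0 0 (D - Bᴴ * A⁻¹ * B)).PosDef := by
    rw [← conj_fromBlocks_right hA]
    exact hG.conjTranspose_mul_mul_same (mulVec_injective_iff_isUnit.2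
      ((isUnit_iff_isUnit_det _).2 hVdet))
  exact hq.submatrix Sum.inr_injective

/-- If the product of the inverse of the first block with the second block is small, the two blocks
decouple: block elimination, done with the first block as pivot on one side and with the second
block as pivot on the other, almost commutes with the block diagonal matrix. -/
theorem isBigO_amplitude_fromBlocks_sub (hG : (fromBlocks A B Bᴴ D).PosDef)
    (hg : Tendsto g l (𝓝 0)) {T₁ T₁' : Ω → Matrix ι ι ℂ} {T₂ : Ω → Matrix κ κ ℂ}
    (hT : ∀ ω, T₁' ω * T₁ ω = 1)
    (hO : ∀ i j k m, (fun ω => T₁' ω i j * T₂ ω k m) =O[l] g) (e : ι → ℂ) (f : κ → ℂ) :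
    (fun ω => amplitude (fromBlocks A B Bᴴ D) (fromBlocks A B Bᴴ D) (Sum.elim e f) (Sum.elim e f)
        (fromBlocks (T₁ ω) 0 0 (T₂ ω)) -
      (amplitude (A - B * D⁻¹ * Bᴴ) A (e - f ᵥ* (D⁻¹ * Bᴴ)) e (T₁ ω) +
        amplitude D (D - Bᴴ * A⁻¹ * B) f (f - e ᵥ* (A⁻¹ * B)) (T₂ ω))) =O[l] g := by
  have hA : A.PosDef := hG.submatrix Sum.inl_injective
  have hD : D.PosDef := hG.submatrix Sum.inr_injective
  set U : Matrix (ι ⊕ κ) (ι ⊕ κ) ℂ := fromBlocks 1 0 (-(D⁻¹ * Bᴴ)) 1 with hU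
  set V : Matrix (ι ⊕ κ) (ι ⊕ κ) ℂ := fromBlocks 1 (-(A⁻¹ * B)) 0 1 with hV
  have hUdet : IsUnit U.det := by rw [hU, det_fromBlocks_zero₁₂]; simp
  have hVdet : IsUnit V.det := by rw [hV, det_fromBlocks_zero₂₁]; simp
  have hUG : Uᴴ * fromBlocks A B Bᴴ D * U = fromBlocks (A - B * D⁻¹ * Bᴴ) 0 0 D :=
    conj_fromBlocks_left hD
  have hVG : Vᴴ * fromBlocks A B Bᴴ D * V = fromBlocks A 0 0 (D - Bᴴ * A⁻¹ * B) :=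
    conj_fromBlocks_right hA
  have hS' : (A - B * D⁻¹ * Bᴴ).PosDef := posDef_schur_left hG
  have hS : (D - Bᴴ * A⁻¹ * B).PosDef := posDef_schur_right hG
  have hp : (fromBlocks (A - B * D⁻¹ * Bᴴ) 0 0 D).PosDef := by
    rw [← hUG]
    exact hG.conjTranspose_mul_mul_same (mulVec_injective_iff_isUnit.2
      ((isUnit_iff_isUnit_det _).2 hUdet))
  have hq : (fromBlocks A 0 0 (D - Bᴴ * A⁻¹ * B)).PosDef := by
    rw [← hVG]
    exact hG.conjTranspose_mul_mul_same (mulVec_injective_iff_isUnit.2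
      ((isUnit_iff_isUnit_det _).2 hVdet))
  have hTr : ∀ ω, T₁ ω * T₁' ω = 1 := fun ω => mul_eq_one_comm.1 (hT ω)
  have hO' : ∀ k m i j, (fun ω => T₂ ω k m * T₁' ω i j) =O[l] g := fun k m i j =>
    (hO i j k m).congr_left fun ω => mul_comm _ _
  have key := isBigO_transfer_sub_of_conj hp hq hUG hVG hUdet hg
    (T := fun ω => fromBlocks (T₁ ω) 0 0 (T₂ ω))
    (U' := fun ω => fromBlocks 1 0 (-(T₂ ω * (D⁻¹ * Bᴴ) * T₁' ω)) 1)
    (V' := fun ω => fromBlocks 1 (-(T₁' ω * (A⁻¹ * B) * T₂ ω)) 0 1)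
    (Eventually.of_forall fun ω => by
      rw [hU, fromBlocks_multiply, fromBlocks_multiply]
      simp [Matrix.mul_assoc, hT])
    (Eventually.of_forall fun ω => by
      rw [hV, fromBlocks_multiply, fromBlocks_multiply]
      simp only [Matrix.mul_neg, ← Matrix.mul_assoc, hTr]
      simp)
    (isBigO_matrix_iff.2 (by
      rintro (i | i) (j | j)
      · simpa [Matrix.one_apply] using isBigO_zero _ _
      · simpa [Matrix.one_apply] using isBigO_zero _ _
      · simpa [Matrix.one_apply] using isBigO_mul_mul_apply hO' _ i j
      · simpa [Matrix.one_apply] using isBigO_zero _ _))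
    (isBigO_matrix_iff.2 (by
      rintro (i | i) (j | j)
      · simpa [Matrix.one_apply] using isBigO_zero _ _
      · simpa [Matrix.one_apply] using isBigO_mul_mul_apply hO _ i j
      · simpa [Matrix.one_apply] using isBigO_zero _ _
      · simpa [Matrix.one_apply] using isBigO_zero _ _))
  refine ((isBigO_bilin key (Sum.elim e f) (star (Sum.elim e f))).const_mul_left
    (-2 * I)).congr_left fun ω => ?_
  have heU : Sum.elim e f ᵥ* U = Sum.elim (e - f ᵥ* (D⁻¹ * Bᴴ)) f := by
    rw [hU, vecMul_fromBlocks]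
    ext (i | i) <;> simp [Matrix.vecMul_neg, sub_eq_add_neg]
  have heV : Sum.elim e f ᵥ* V = Sum.elim e (f - e ᵥ* (A⁻¹ * B)) := by
    rw [hV, vecMul_fromBlocks]
    ext (i | i) <;> simp [Matrix.vecMul_neg, sub_eq_add_neg, add_comm]
  have hsplit : Sum.elim e f ⬝ᵥ ((U * transfer (fromBlocks (A - B * D⁻¹ * Bᴴ) 0 0 D)
      (fromBlocks (T₁ ω) 0 0 (T₂ ω)) (fromBlocks A 0 0 (D - Bᴴ * A⁻¹ * B)) * Vᴴ) *ᵥ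
        star (Sum.elim e f)) =
      (e - f ᵥ* (D⁻¹ * Bᴴ)) ⬝ᵥ (transfer (A - B * D⁻¹ * Bᴴ) (T₁ ω) A *ᵥ star e) +
      f ⬝ᵥ (transfer D (T₂ ω) (D - Bᴴ * A⁻¹ * B) *ᵥ star (f - e ᵥ* (A⁻¹ * B))) := by
    rw [transfer_fromBlocks hS' hA hD hS, Matrix.mul_assoc, ← mulVec_mulVec, ← mulVec_mulVec,
      ← star_vecMul, heV, dotProduct_mulVec, heU, fromBlocks_mulVec]
    simp only [dotProduct, Fintype.sum_sum_type, Sum.elim_inl, Sum.elim_inr]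
    congr 1
    · refine Finset.sum_congr rfl fun i _ => ?_
      congr 1
      simp
      congr 1
    · refine Finset.sum_congr rfl fun i _ => ?_
      congr 1
      simp
      congr 1
      funext j
      simp
  simp only [Matrix.sub_mulVec, dotProduct_sub]
  rw [hsplit]
  unfold amplitude
  ring

theorem isBigO_amplitude_of_isBigO {P Q : Matrix ι ι ℂ} (hP : P.PosDef) (hQ : Q.PosDef)
    {T : Ω → Matrix ι ι ℂ} (hT : T =O[l] g) (α β : ι → ℂ) :
    (fun ω => amplitude P Q α β (T ω)) =O[l] g :=
  (isBigO_bilin (isBigO_transfer_of_isBigO hP hQ hT) α (star β)).const_mul_left _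

theorem isBigO_amplitude_of_isBigO_inv {P Q : Matrix ι ι ℂ} (hP : P.PosDef) (hQ : Q.PosDef)
    {T T' : Ω → Matrix ι ι ℂ} (hTT : ∀ ω, T' ω * T ω = 1) (hT : T' =O[l] g) (α β : ι → ℂ) :
    (fun ω => amplitude P Q α β (T ω)) =O[l] g :=
  (isBigO_bilin (isBigO_transfer_of_isBigO_inv hP hQ hTT hT) α (star β)).const_mul_left _

end Decoupling

/-! ### Growth of phases -/

section Growth

variable {Ω : Type*} {l : Filter Ω} {t s : Ω → ℝ}

theorem isBigO_abs_rpow_of_le (ht : Tendsto (fun ω => |t ω|) l atTop) {a b : ℝ} (hab : a ≤ b) :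
    (fun ω => |t ω| ^ a) =O[l] fun ω => |t ω| ^ b := by
  refine IsBigO.of_bound 1 ?_
  filter_upwards [ht.eventually_ge_atTop 1] with ω hω
  rw [one_mul, Real.norm_of_nonneg (by positivity), Real.norm_of_nonneg (by positivity)]
  exact Real.rpow_le_rpow_of_exponent_le hω hab

theorem tendsto_log_div_abs (ht : Tendsto (fun ω => |t ω|) l atTop) :
    Tendsto (fun ω => Real.log |t ω| / |t ω|) l (𝓝 0) :=
  (Real.isLittleO_log_id_atTop.tendsto_div_nhds_zero).comp ht

theorem isBigO_inv_log_div_abs (ht : Tendsto (fun ω => |t ω|) l atTop) :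
    (fun ω => |t ω|⁻¹) =O[l] fun ω => Real.log |t ω| / |t ω| := by
  refine IsBigO.of_bound 1 ?_
  filter_upwards [ht.eventually_ge_atTop (Real.exp 1)] with ω hω
  have h0 : 0 < |t ω| := (Real.exp_pos 1).trans_le hω
  have h1 : 1 ≤ Real.log |t ω| := (Real.le_log_iff_exp_le h0).2 hω
  rw [one_mul, Real.norm_of_nonneg (by positivity), Real.norm_of_nonneg (by positivity),
    inv_eq_one_div]
  gcongr

theorem isBigO_rpow_log_div_abs (ht : Tendsto (fun ω => |t ω|) l atTop) {a : ℝ} (ha : a ≤ -1) :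
    (fun ω => |t ω| ^ a) =O[l] fun ω => Real.log |t ω| / |t ω| := by
  refine (isBigO_abs_rpow_of_le ht ha).trans ((isBigO_inv_log_div_abs ht).congr_left fun ω => ?_)
  rw [Real.rpow_neg_one]

/-- An exponential in `s` absorbs any power of `s`; on the side `K log |t| ≤ s` it is bounded by a
power of `|t|`, with an exponent that tends to `-∞` as `K → ∞`. -/
theorem isBigO_exp_mul_pow (ht : Tendsto (fun ω => |t ω|) l atTop) {η K : ℝ} (hη : 0 < η)
    (hs : ∀ᶠ ω in l, K * Real.log |t ω| ≤ s ω) (m : ℕ) :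
    (fun ω => Real.exp (-2 * η * s ω) * (1 + |t ω| + |s ω|) ^ m) =O[l]
      fun ω => |t ω| ^ ((m : ℝ) - min (η * K) (3 * (η * K))) := by
  refine IsBigO.of_bound (2 ^ m * (m.factorial / η ^ m * Real.exp η)) ?_
  filter_upwards [ht.eventually_ge_atTop 1, hs] with ω h1 hK
  have h0 : 0 < |t ω| := one_pos.trans_le h1
  have hlog : 0 ≤ Real.log |t ω| := Real.log_nonneg h1
  rw [Real.norm_of_nonneg (by positivity), Real.norm_of_nonneg (by positivity)]
  have hR : 1 + |t ω| + |s ω| ≤ 2 * |t ω| * (1 + |s ω|) := by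
    nlinarith [abs_nonneg (s ω), mul_nonneg h0.le (abs_nonneg (s ω)),
      mul_nonneg (sub_nonneg.2 h1) (abs_nonneg (s ω))]
  have hp : (1 + |s ω|) ^ m ≤ m.factorial / η ^ m * Real.exp η * Real.exp (η * |s ω|) := by
    have h2 := Real.pow_div_factorial_le_exp (η * (1 + |s ω|)) (by positivity) m
    rw [mul_pow, mul_add, mul_one, Real.exp_add, div_le_iff₀ (by positivity)] at h2
    rw [div_mul_eq_mul_div, div_mul_eq_mul_div, le_div_iff₀ (by positivity)]
    linarith
  have hex : Real.exp (-2 * η * s ω) * Real.exp (η * |s ω|) ≤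
      Real.exp (-min (η * K) (3 * (η * K)) * Real.log |t ω|) := by
    rw [← Real.exp_add]
    apply Real.exp_le_exp.2
    have h3 : η * (K * Real.log |t ω|) ≤ η * s ω := mul_le_mul_of_nonneg_left hK hη.le
    rcases le_total 0 (s ω) with h | h
    · rw [abs_of_nonneg h]
      nlinarith [mul_le_mul_of_nonneg_right (min_le_left (η * K) (3 * (η * K))) hlog]
    · rw [abs_of_nonpos h]
      nlinarith [mul_le_mul_of_nonneg_right (min_le_right (η * K) (3 * (η * K))) hlog]
  calc Real.exp (-2 * η * s ω) * (1 + |t ω| + |s ω|) ^ m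
      ≤ Real.exp (-2 * η * s ω) * (2 * |t ω| * (1 + |s ω|)) ^ m := by gcongr
    _ = 2 ^ m * |t ω| ^ m * (Real.exp (-2 * η * s ω) * (1 + |s ω|) ^ m) := by
        rw [mul_pow, mul_pow]; ring
    _ ≤ 2 ^ m * |t ω| ^ m * (Real.exp (-2 * η * s ω) *
          (m.factorial / η ^ m * Real.exp η * Real.exp (η * |s ω|))) := by gcongr
    _ = 2 ^ m * (m.factorial / η ^ m * Real.exp η) * (|t ω| ^ m *
          (Real.exp (-2 * η * s ω) * Real.exp (η * |s ω|))) := by ring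
    _ ≤ 2 ^ m * (m.factorial / η ^ m * Real.exp η) * (|t ω| ^ m *
          Real.exp (-min (η * K) (3 * (η * K)) * Real.log |t ω|)) := by gcongr
    _ = _ := by
        rw [sub_eq_add_neg, Real.rpow_add h0, Real.rpow_natCast, Real.rpow_def_of_pos h0,
          mul_comm (Real.log _)]

theorem isBigO_of_inf_principal {E E' : Type*} [SeminormedAddCommGroup E]
    [SeminormedAddCommGroup E'] {f : Ω → E} {g : Ω → E'}
    {A : Set Ω} (h : f =O[l ⊓ 𝓟 A] g) (h' : f =O[l ⊓ 𝓟 Aᶜ] g) : f =O[l] g := by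
  have := h.sup h'
  rwa [← inf_sup_left, sup_principal, Set.union_compl_self, principal_univ, inf_top_eq] at this

end Growth

section Phase

variable {Ω : Type*} {l : Filter Ω} {t s : Ω → ℝ} {μ κ : ℂ} {φ : Ω → ℂ → ℂ}

/-- A family of phases whose Taylor expansion at `μ` depends on a time `t` and on a position `s`
in a moving frame: the value at `μ` has real part `-2 (Im μ) s` up to a constant, the first
coefficient is `2 i s + κ t` up to a constant, and the higher ones are affine in `t`. -/
structure IsPhase (μ κ : ℂ) (t s : Ω → ℝ) (φ : Ω → ℂ → ℂ) : Prop where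
  contDiff : ∀ ω, ContDiff ℂ ⊤ (φ ω)
  re : ∃ ρ : ℝ, ∀ ω, (φ ω μ).re = ρ - 2 * μ.im * s ω
  coeff_one : ∃ C : ℂ, ∀ ω, taylorCoeff (φ ω) μ 1 = 2 * I * s ω + κ * t ω + C
  coeff_add_two : ∀ k, ∃ B C : ℂ, ∀ ω, taylorCoeff (φ ω) μ (k + 2) = B * t ω + C

/-- The Taylor coefficients of `exp φ` at `μ`, divided by the value of `exp φ` at `μ`. -/
def expCoeff (μ : ℂ) (φ : Ω → ℂ → ℂ) (m : ℕ) (ω : Ω) : ℂ :=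
  taylorCoeff (fun z => cexp (φ ω z)) μ m * cexp (-φ ω μ)

theorem taylorCoeff_cexp_eq (m : ℕ) (ω : Ω) :
    taylorCoeff (fun z => cexp (φ ω z)) μ m = cexp (φ ω μ) * expCoeff μ φ m ω := by
  rw [expCoeff, mul_left_comm, ← Complex.exp_add, add_neg_cancel, Complex.exp_zero, mul_one]

theorem expCoeff_zero (ω : Ω) : expCoeff μ φ 0 ω = 1 := by
  rw [expCoeff, taylorCoeff_zero, ← Complex.exp_add, add_neg_cancel, Complex.exp_zero]

theorem expCoeff_succ (hφ : ∀ ω, ContDiff ℂ ⊤ (φ ω)) (m : ℕ) (ω : Ω) :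
    ((m : ℂ) + 1) * expCoeff μ φ (m + 1) ω = ∑ k ∈ Finset.range (m + 1),
      ((k + 1) * taylorCoeff (φ ω) μ (k + 1)) * expCoeff μ φ (m - k) ω := by
  simp only [expCoeff]
  rw [← mul_assoc, taylorCoeff_exp_succ (hφ ω), Finset.sum_mul]
  simp only [mul_assoc]

theorem isBigO_affine (ht : Tendsto (fun ω => |t ω|) l atTop) (B C : ℂ) :
    (fun ω => B * t ω + C) =O[l] fun ω => |t ω| := by
  refine IsBigO.add (IsBigO.const_mul_left ?_ _) ?_
  · exact IsBigO.of_norm_left (by simpa using isBigO_refl (fun ω => |t ω|) l)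
  · refine IsBigO.of_bound ‖C‖ ?_
    filter_upwards [ht.eventually_ge_atTop 1] with ω hω
    rw [Real.norm_of_nonneg (by positivity)]
    exact le_mul_of_one_le_right (norm_nonneg _) hω

theorem IsPhase.isBigO_taylorCoeff (h : IsPhase μ κ t s φ)
    (ht : Tendsto (fun ω => |t ω|) l atTop) (k : ℕ) :
    (fun ω => taylorCoeff (φ ω) μ (k + 1)) =O[l] fun ω => 1 + |t ω| + |s ω| := by
  have hle : (fun ω => |t ω|) =O[l] fun ω => 1 + |t ω| + |s ω| := by
    refine IsBigO.of_bound 1 (Eventually.of_forall fun ω => ?_)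
    rw [one_mul, Real.norm_of_nonneg (by positivity), Real.norm_of_nonneg (by positivity)]
    linarith [abs_nonneg (s ω)]
  have hles : (fun ω => (s ω : ℂ)) =O[l] fun ω => 1 + |t ω| + |s ω| := by
    refine IsBigO.of_bound 1 (Eventually.of_forall fun ω => ?_)
    rw [one_mul, norm_real, Real.norm_eq_abs, Real.norm_of_nonneg (by positivity)]
    linarith [abs_nonneg (t ω)]
  rcases k with _ | k
  · obtain ⟨C, hC⟩ := h.coeff_one
    simp only [zero_add, hC]
    exact ((hles.const_mul_left (2 * I)).add ((isBigO_affine ht κ C).trans hle)).congr_left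
      fun ω => by ring
  · obtain ⟨B, C, hC⟩ := h.coeff_add_two k
    simp only [add_assoc, one_add_one_eq_two, hC]
    simpa only [add_assoc] using (isBigO_affine ht B C).trans hle

theorem isBigO_taylorCoeff_cexp {η ρ K : ℝ} (hη : 0 < η)
    (hφ : ∀ ω, ContDiff ℂ ⊤ (φ ω)) (hre : ∀ ω, (φ ω μ).re = ρ - 2 * η * s ω)
    (hc : ∀ k, (fun ω => taylorCoeff (φ ω) μ (k + 1)) =O[l] fun ω => 1 + |t ω| + |s ω|)
    (ht : Tendsto (fun ω => |t ω|) l atTop)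
    (hs : ∀ᶠ ω in l, K * Real.log |t ω| ≤ s ω) (m : ℕ) :
    (fun ω => taylorCoeff (fun z => cexp (φ ω z)) μ m) =O[l]
      fun ω => |t ω| ^ ((m : ℝ) - min (η * K) (3 * (η * K))) := by
  have h1 : (fun _ => (1 : ℝ)) =O[l] fun ω => 1 + |t ω| + |s ω| := by
    refine IsBigO.of_bound 1 (Eventually.of_forall fun ω => ?_)
    rw [one_mul, norm_one, Real.norm_of_nonneg (by positivity)]
    linarith [abs_nonneg (s ω), abs_nonneg (t ω)]
  have h2 := isBigO_pow_of_recurrence (F := expCoeff μ φ)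
    (c := fun k ω => taylorCoeff (φ ω) μ k) h1 expCoeff_zero (expCoeff_succ hφ) hc m
  have h3 : (fun ω => cexp (φ ω μ)) =O[l] fun ω => Real.exp (-2 * η * s ω) := by
    refine IsBigO.of_bound (Real.exp ρ) (Eventually.of_forall fun ω => ?_)
    rw [Complex.norm_exp, hre, Real.norm_of_nonneg (Real.exp_pos _).le, ← Real.exp_add]
    exact le_of_eq (by ring_nf)
  refine ((h3.mul h2).congr_left fun ω => (taylorCoeff_cexp_eq m ω).symm).trans ?_
  exact isBigO_exp_mul_pow ht hη hs m

theorem taylorCoeff_neg (f : ℂ → ℂ) (z : ℂ) (m : ℕ) :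
    taylorCoeff (fun w => -f w) z m = -taylorCoeff f z m := by
  rw [taylorCoeff, taylorCoeff, iteratedDeriv_fun_neg, mul_neg]

theorem IsPhase.isBigO_coeff (h : IsPhase μ κ t s φ) (hμ : 0 < μ.im)
    (ht : Tendsto (fun ω => |t ω|) l atTop) {K : ℝ} (hs : ∀ᶠ ω in l, K * Real.log |t ω| ≤ s ω)
    (m : ℕ) : (fun ω => taylorCoeff (fun z => cexp (φ ω z)) μ m) =O[l]
      fun ω => |t ω| ^ ((m : ℝ) - min (μ.im * K) (3 * (μ.im * K))) := by
  obtain ⟨ρ, hρ⟩ := h.re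
  exact isBigO_taylorCoeff_cexp hμ h.contDiff hρ (h.isBigO_taylorCoeff ht) ht hs m

/-- The mirror image of `IsPhase.isBigO_coeff`: the inverse of `exp φ` is small on the
other side. -/
theorem IsPhase.isBigO_coeff_neg (h : IsPhase μ κ t s φ) (hμ : 0 < μ.im)
    (ht : Tendsto (fun ω => |t ω|) l atTop) {K : ℝ} (hs : ∀ᶠ ω in l, K * Real.log |t ω| ≤ -s ω)
    (m : ℕ) : (fun ω => taylorCoeff (fun z => cexp (-φ ω z)) μ m) =O[l]
      fun ω => |t ω| ^ ((m : ℝ) - min (μ.im * K) (3 * (μ.im * K))) := by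
  obtain ⟨ρ, hρ⟩ := h.re
  refine isBigO_taylorCoeff_cexp (φ := fun ω z => -φ ω z) (s := fun ω => -s ω) (ρ := -ρ) hμ
    (fun ω => (h.contDiff ω).neg) (fun ω => by rw [neg_re, hρ]; ring) (fun k => ?_) ht hs m
  simp only [taylorCoeff_neg, abs_neg]
  exact (h.isBigO_taylorCoeff ht k).neg_left

theorem isBigO_toeplitz {f : Ω → ℕ → ℂ} {g : Ω → ℝ} (n : ℕ)
    (h : ∀ m < n, (fun ω => f ω m) =O[l] g) : (fun ω => toeplitz n (f ω)) =O[l] g := by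
  refine isBigO_matrix_iff.2 fun i j => ?_
  simp only [toeplitz, of_apply]
  split_ifs
  · exact h _ (by omega)
  · exact isBigO_zero _ _

/-- The Toeplitz matrix of `exp φ` at `μ`. -/
def phaseMatrix (n : ℕ) (μ : ℂ) (φ : Ω → ℂ → ℂ) (ω : Ω) : Matrix (Fin n) (Fin n) ℂ :=
  toeplitz n (taylorCoeff (fun z => cexp (φ ω z)) μ)

theorem phaseMatrix_neg_mul (hφ : ∀ ω, ContDiff ℂ ⊤ (φ ω)) (n : ℕ) (ω : Ω) :
    phaseMatrix n μ (fun ω z => -φ ω z) ω * phaseMatrix n μ φ ω = 1 :=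
  mul_eq_one_comm.1 (toeplitz_exp_mul_toeplitz_exp_neg (hφ ω) μ n)

theorem IsPhase.isBigO_phaseMatrix (h : IsPhase μ κ t s φ) (hμ : 0 < μ.im)
    (ht : Tendsto (fun ω => |t ω|) l atTop) {K : ℝ} (hs : ∀ᶠ ω in l, K * Real.log |t ω| ≤ s ω)
    (n : ℕ) : phaseMatrix n μ φ =O[l]
      fun ω => |t ω| ^ ((n : ℝ) - min (μ.im * K) (3 * (μ.im * K))) :=
  isBigO_toeplitz n fun m hm => (h.isBigO_coeff hμ ht hs m).trans
    (isBigO_abs_rpow_of_le ht (by gcongr))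

theorem IsPhase.isBigO_phaseMatrix_neg (h : IsPhase μ κ t s φ) (hμ : 0 < μ.im)
    (ht : Tendsto (fun ω => |t ω|) l atTop) {K : ℝ} (hs : ∀ᶠ ω in l, K * Real.log |t ω| ≤ -s ω)
    (n : ℕ) : phaseMatrix n μ (fun ω z => -φ ω z) =O[l]
      fun ω => |t ω| ^ ((n : ℝ) - min (μ.im * K) (3 * (μ.im * K))) :=
  isBigO_toeplitz n fun m hm => (h.isBigO_coeff_neg hμ ht hs m).trans
    (isBigO_abs_rpow_of_le ht (by gcongr))

end Phase

/-! ### One block, uniformly in the position -/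

section SingleBlock

variable {Ω : Type*} {l : Filter Ω} {t s : Ω → ℝ} {μ κ : ℂ} {φ : Ω → ℂ → ℂ} {m : ℕ}

/-- Near the trajectory `s = O(log |t|)` the normalised coefficients of `exp φ` are, up to a small
relative error, those of `exp (κ t X)`. -/
theorem IsPhase.isBigO_expCoeff_sub (h : IsPhase μ κ t s φ) (hκ : κ ≠ 0)
    (ht : Tendsto (fun ω => |t ω|) l atTop) {K : ℝ} (hs : ∀ᶠ ω in l, |s ω| ≤ K * Real.log |t ω|)
    (k : ℕ) : (fun ω => expCoeff μ φ k ω * (κ * t ω)⁻¹ ^ k - 1 / (k.factorial : ℂ)) =O[l]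
      fun ω => Real.log |t ω| / |t ω| := by
  have hinv : (fun ω => (κ * t ω)⁻¹) =O[l] fun ω => |t ω|⁻¹ := by
    refine IsBigO.of_bound ‖κ‖⁻¹ (Eventually.of_forall fun ω => ?_)
    simp [mul_comm]
  have hne : ∀ᶠ ω in l, κ * t ω ≠ 0 := by
    filter_upwards [ht.eventually_ge_atTop 1] with ω hω
    refine mul_ne_zero hκ (ofReal_ne_zero.2 fun h0 => ?_)
    rw [h0] at hω
    simp at hω
    linarith
  have hcancel : (fun ω => |t ω| * |t ω|⁻¹) =O[l] fun _ => (1 : ℝ) := by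
    refine IsBigO.of_bound 1 (Eventually.of_forall fun ω => ?_)
    rcases eq_or_ne |t ω| 0 with h0 | h0
    · simp [h0]
    · simp [h0]
  have hinv1 : (fun ω => |t ω|⁻¹) =O[l] fun _ => (1 : ℝ) :=
    (tendsto_inv_atTop_zero.comp ht).isBigO_one ℝ
  have hlogO : (fun ω => (s ω : ℂ)) =O[l] fun ω => Real.log |t ω| := by
    refine IsBigO.of_bound |K| ?_
    filter_upwards [hs] with ω hω
    rw [norm_real, Real.norm_eq_abs, Real.norm_eq_abs, ← abs_mul]
    exact hω.trans (le_abs_self _)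
  refine isBigO_sub_inv_factorial_of_recurrence (F := fun k ω => expCoeff μ φ k ω *
    (κ * t ω)⁻¹ ^ k) (c := fun k ω => taylorCoeff (φ ω) μ k * (κ * t ω)⁻¹ ^ k)
    (tendsto_log_div_abs ht) (fun ω => by simp [expCoeff_zero]) ?_ ?_ ?_ k
  · intro m ω
    rw [← mul_assoc, expCoeff_succ h.contDiff, Finset.sum_mul]
    refine Finset.sum_congr rfl fun k hk => ?_
    have hk := Finset.mem_range.1 hk
    rw [show m + 1 = (k + 1) + (m - k) by omega, pow_add (κ * (t ω : ℂ))⁻¹]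
    ring
  · obtain ⟨C, hC⟩ := h.coeff_one
    have h1 : (fun ω => 2 * I * s ω * (κ * t ω)⁻¹ + C * (κ * t ω)⁻¹) =O[l]
        fun ω => Real.log |t ω| / |t ω| := by
      refine IsBigO.add ?_ ?_
      · exact ((hlogO.const_mul_left (2 * I)).mul hinv)
      · exact (hinv.const_mul_left C).trans (isBigO_inv_log_div_abs ht)
    refine h1.congr' ?_ EventuallyEq.rfl
    filter_upwards [hne] with ω hω
    rw [hC, pow_one]
    linear_combination -mul_inv_cancel₀ hω
  · intro k
    obtain ⟨B, C, hC⟩ := h.coeff_add_two k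
    simp only [hC, pow_add]
    have h1 := (isBigO_affine ht B C).mul ((hinv.pow k).mul (hinv.pow 2))
    refine h1.trans (IsBigO.trans ?_ (isBigO_inv_log_div_abs ht))
    have h2 := ((hcancel.mul (hinv1.pow k)).mul (isBigO_refl (fun ω => |t ω|⁻¹) l))
    refine (h2.congr_left fun ω => by ring).congr_right fun ω => by ring

/-- The argument of the `p`-th peak of a block with `m + 1` columns: up to constants, the
exponential of the phase times the power `t ^ (m - 2 p)`. -/
def peakArg (m : ℕ) (μ κ : ℂ) (t : Ω → ℝ) (φ : Ω → ℂ → ℂ) (c : ℂ) (p : Fin (m + 1)) (ω : Ω) : ℂ :=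
  c * (cexp (φ ω μ) * hankelPivot m p * (2 * I * μ.im * (κ * t ω)) ^ ((m : ℤ) - 2 * p))

/-- A power of `t` with exponent at most `m` in absolute value, weighted by an exponential, is
small far from the trajectory. -/
theorem isBigO_exp_mul_zpow {η : ℝ} (hη : 0 < η) {ψ : Ω → ℂ} {ρ : ℝ}
    (hψ : ∀ ω, (ψ ω).re = ρ - 2 * η * s ω) (ht : Tendsto (fun ω => |t ω|) l atTop) {K : ℝ}
    (hs : ∀ᶠ ω in l, K * Real.log |t ω| ≤ s ω) (c d : ℂ) {k : ℤ} (hk : k ≤ m) :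
    (fun ω => c * (cexp (ψ ω) * (d * t ω) ^ k)) =O[l]
      fun ω => |t ω| ^ ((m : ℝ) - min (η * K) (3 * (η * K))) := by
  refine IsBigO.trans ?_ (isBigO_exp_mul_pow ht hη hs m)
  refine IsBigO.of_bound (‖c‖ * Real.exp ρ * ‖d‖ ^ k) ?_
  filter_upwards [ht.eventually_ge_atTop 1] with ω h1
  have h2 : |t ω| ^ k ≤ (1 + |t ω| + |s ω|) ^ m := by
    calc |t ω| ^ k ≤ |t ω| ^ (m : ℤ) := zpow_le_zpow_right₀ h1 hk
      _ = |t ω| ^ m := zpow_natCast _ _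
      _ ≤ _ := by gcongr; linarith [abs_nonneg (s ω)]
  rw [norm_mul, norm_mul, Complex.norm_exp, hψ, norm_zpow, norm_mul, norm_real, Real.norm_eq_abs,
    mul_zpow, Real.norm_of_nonneg (by positivity), sub_eq_add_neg, Real.exp_add]
  calc ‖c‖ * (Real.exp ρ * Real.exp (-(2 * η * s ω)) * (‖d‖ ^ k * |t ω| ^ k))
      = ‖c‖ * Real.exp ρ * ‖d‖ ^ k * (Real.exp (-2 * η * s ω) * |t ω| ^ k) := by
        rw [show -(2 * η * s ω) = -2 * η * s ω by ring]; ring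
    _ ≤ _ := by gcongr

/-- The amplitude of one block is a sum of peaks, uniformly in the position: near the trajectory
by the analysis of the Toeplitz matrix, elsewhere because both sides are small. -/
theorem IsPhase.isBigO_amplitude_sub_peaks (h : IsPhase μ κ t s φ) (hκ : κ ≠ 0) (hμ : 0 < μ.im)
    {P Q : Matrix (Fin (m + 1)) (Fin (m + 1)) ℂ} (hP : P.PosDef) (hQ : Q.PosDef)
    {α β : Fin (m + 1) → ℂ} (hα : Displacement μ P α) (hβ : Displacement μ Q β)
    (ht : Tendsto (fun ω => |t ω|) l atTop) :
    (fun ω => amplitude P Q α β (phaseMatrix (m + 1) μ φ ω) -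
      ∑ p : Fin (m + 1), peak μ.im (peakArg m μ κ t φ (β 0 / α 0) p ω)) =O[l]
      fun ω => Real.log |t ω| / |t ω| := by
  obtain ⟨ρ, hρ⟩ := h.re
  -- Beyond `|s| = K log |t|` the exponential beats every power of `t` that occurs.
  set K : ℝ := (m + 2) / μ.im with hK
  have hηK : μ.im * K = m + 2 := by rw [hK]; field_simp
  have hmin : min (μ.im * K) (3 * (μ.im * K)) = m + 2 := by
    rw [hηK]; exact min_eq_left (by linarith [(Nat.cast_nonneg m : (0 : ℝ) ≤ m)])
  have hexp1 : ((m + 1 : ℕ) : ℝ) - min (μ.im * K) (3 * (μ.im * K)) ≤ -1 := by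
    rw [hmin]; push_cast; linarith
  have hexp2 : (m : ℝ) - min (μ.im * K) (3 * (μ.im * K)) ≤ -1 := by
    rw [hmin]; linarith
  have hsub : ∀ A : Set Ω, Tendsto (fun ω => |t ω|) (l ⊓ 𝓟 A) atTop := fun A =>
    ht.mono_left inf_le_left
  have hp0 : ∀ p : Fin (m + 1), hankelPivot m p ≠ 0 := fun p => hankelPivot_ne_zero _ _
  refine isBigO_of_inf_principal (A := {ω | K * Real.log |t ω| ≤ s ω}) ?_ ?_
  · have hs : ∀ᶠ ω in l ⊓ 𝓟 {ω | K * Real.log |t ω| ≤ s ω}, K * Real.log |t ω| ≤ s ω :=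
      eventually_inf_principal.2 (Eventually.of_forall fun _ h => h)
    refine IsBigO.sub ?_ (IsBigO.fun_sum fun p _ => ?_)
    · exact isBigO_amplitude_of_isBigO hP hQ ((h.isBigO_phaseMatrix hμ (hsub _) hs _).trans
        (isBigO_rpow_log_div_abs (hsub _) hexp1)) α β
    · refine IsBigO.trans ?_ (isBigO_rpow_log_div_abs (hsub _) hexp2)
      refine IsBigO.trans (IsBigO.of_bound (4 * |μ.im|) (Eventually.of_forall fun ω =>
        norm_peak_le _ _)) ?_
      refine (isBigO_exp_mul_zpow (m := m) hμ hρ (hsub _) hs (β 0 / α 0 * hankelPivot m p)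
        (2 * I * μ.im * κ) (k := (m : ℤ) - 2 * p) (by omega)).congr_left fun ω => ?_
      rw [peakArg, mul_assoc (2 * I * (μ.im : ℂ))]; ring
  refine isBigO_of_inf_principal (A := {ω | K * Real.log |t ω| ≤ -s ω}) ?_ ?_
  · have hs : ∀ᶠ ω in l ⊓ 𝓟 {ω | K * Real.log |t ω| ≤ s ω}ᶜ ⊓ 𝓟 {ω | K * Real.log |t ω| ≤ -s ω},
        K * Real.log |t ω| ≤ -s ω :=
      eventually_inf_principal.2 (Eventually.of_forall fun _ h => h)
    have ht' := (hsub {ω | K * Real.log |t ω| ≤ s ω}ᶜ).mono_left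
      (inf_le_left (b := 𝓟 {ω | K * Real.log |t ω| ≤ -s ω}))
    refine IsBigO.sub ?_ (IsBigO.fun_sum fun p _ => ?_)
    · exact isBigO_amplitude_of_isBigO_inv hP hQ (phaseMatrix_neg_mul h.contDiff _)
        ((h.isBigO_phaseMatrix_neg hμ ht' hs _).trans (isBigO_rpow_log_div_abs ht' hexp1)) α β
    · refine IsBigO.trans ?_ (isBigO_rpow_log_div_abs ht' hexp2)
      refine IsBigO.trans (IsBigO.of_bound (g := fun ω =>
        (peakArg m μ κ t φ (β 0 / α 0) p ω)⁻¹) (4 * |μ.im|) (Eventually.of_forall fun ω => by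
          rw [norm_inv]; exact norm_peak_le_inv _ _)) ?_
      refine (isBigO_exp_mul_zpow (m := m) (ψ := fun ω => -φ ω μ) (s := fun ω => -s ω) (ρ := -ρ) hμ
        (fun ω => by rw [neg_re, hρ]; ring) ht' hs (β 0 / α 0 * hankelPivot m p)⁻¹
        (2 * I * μ.im * κ) (k := -((m : ℤ) - 2 * p)) (by omega)).congr_left fun ω => ?_
      rw [peakArg, mul_assoc (2 * I * (μ.im : ℂ)), Complex.exp_neg, _root_.zpow_neg]
      simp only [mul_inv]
      ring
  · have ht' := (hsub {ω | K * Real.log |t ω| ≤ s ω}ᶜ).mono_left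
      (inf_le_left (b := 𝓟 {ω | K * Real.log |t ω| ≤ -s ω}ᶜ))
    have hs : ∀ᶠ ω in l ⊓ 𝓟 {ω | K * Real.log |t ω| ≤ s ω}ᶜ ⊓ 𝓟 {ω | K * Real.log |t ω| ≤ -s ω}ᶜ,
        |s ω| ≤ K * Real.log |t ω| := by
      rw [inf_assoc, inf_principal]
      refine eventually_inf_principal.2 (Eventually.of_forall fun ω hω => ?_)
      have h1 := not_le.1 (show ¬ K * Real.log |t ω| ≤ s ω from hω.1)
      have h2 := not_le.1 (show ¬ K * Real.log |t ω| ≤ -s ω from hω.2)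
      exact abs_le.2 ⟨by linarith, h1.le⟩
    have hne : ∀ᶠ ω in l ⊓ 𝓟 {ω | K * Real.log |t ω| ≤ s ω}ᶜ ⊓
        𝓟 {ω | K * Real.log |t ω| ≤ -s ω}ᶜ, κ * t ω ≠ 0 := by
      filter_upwards [ht'.eventually_gt_atTop 0] with ω hω
      exact mul_ne_zero hκ (ofReal_ne_zero.2 (abs_pos.1 hω))
    have hinv : (fun ω => (κ * t ω)⁻¹) =O[l ⊓ 𝓟 {ω | K * Real.log |t ω| ≤ s ω}ᶜ ⊓
        𝓟 {ω | K * Real.log |t ω| ≤ -s ω}ᶜ] fun ω => Real.log |t ω| / |t ω| := by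
      refine IsBigO.trans (IsBigO.of_bound ‖κ‖⁻¹ (Eventually.of_forall fun ω => ?_))
        (isBigO_inv_log_div_abs ht')
      simp [mul_comm]
    have key := isBigO_transfer_toeplitz_sub_peaks hμ hP hQ hα hβ (tendsto_log_div_abs ht')
      hne hinv (e := fun ω => cexp (φ ω μ)) (F := expCoeff μ φ) (fun ω => Complex.exp_ne_zero _)
      (h.isBigO_expCoeff_sub hκ ht' hs)
    refine key.congr_left fun ω => ?_
    simp only [amplitude, phaseMatrix, peakArg, ← taylorCoeff_cexp_eq]

end SingleBlock

/-! ### Two blocks, uniformly in the position -/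

section TwoBlockAsymptotics

variable {Ω : Type*} {l : Filter Ω} {t s s' : Ω → ℝ} {μ ν κ κ' : ℂ} {φ ψ : Ω → ℂ → ℂ} {m n : ℕ}

theorem displacement_iff {Q : Matrix (Fin n) (Fin n) ℂ} {b : Fin n → ℂ} :
    Displacement μ Q b ↔
      (jordan n μ)ᴴ * Q - Q * jordan n μ = (-I) • vecMulVec (star b) b := by
  rw [Displacement]
  refine Eq.congr_right ?_
  ext i j
  simp [vecMulVec_apply]

theorem isBigO_fromBlocks {ι ι' : Type*} [Fintype ι] [DecidableEq ι] [Fintype ι'] [DecidableEq ι']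
    {A : Ω → Matrix ι ι ℂ} {B : Ω → Matrix ι' ι' ℂ} {g : Ω → ℝ} (hA : A =O[l] g) (hB : B =O[l] g) :
    (fun ω => fromBlocks (A ω) 0 0 (B ω)) =O[l] g := by
  refine isBigO_matrix_iff.2 ?_
  rintro (i | i) (j | j)
  · exact isBigO_matrix_iff.1 hA i j
  · exact isBigO_zero _ _
  · exact isBigO_zero _ _
  · exact isBigO_matrix_iff.1 hB i j

/-- The exponents in `IsPhase.isBigO_phaseMatrix` are as negative as desired for large `K`. -/
theorem exists_exponent (a : ℝ) {η : ℝ} (hη : 0 < η) :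
    ∃ K, 0 ≤ K ∧ a - min (η * K) (3 * (η * K)) ≤ -1 := by
  refine ⟨(|a| + 1) / η, by positivity, ?_⟩
  rw [mul_div_cancel₀ _ hη.ne', min_eq_left (by linarith [abs_nonneg a])]
  linarith [le_abs_self a]

theorem eventually_log_le (ht : Tendsto (fun ω => |t ω|) l atTop) (K : ℝ) {a : ℝ} (ha : 0 < a) :
    ∀ᶠ ω in l, K * Real.log |t ω| ≤ a * |t ω| := by
  have h := ht.eventually (((Real.isLittleO_log_id_atTop).const_mul_left K).def ha)
  filter_upwards [h] with ω hω
  simp only [id, Real.norm_eq_abs, abs_abs] at hω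
  exact (le_abs_self _).trans hω

theorem isBigO_entry_mul_entry {ι ι' : Type*} [Fintype ι] [DecidableEq ι] [Fintype ι']
    [DecidableEq ι'] {A : Ω → Matrix ι ι ℂ} {B : Ω → Matrix ι' ι' ℂ} {a b : ℝ}
    (ht : Tendsto (fun ω => |t ω|) l atTop) (hA : A =O[l] fun ω => |t ω| ^ a)
    (hB : B =O[l] fun ω => |t ω| ^ b) (hab : a + b ≤ -1) (i j : ι) (k p : ι') :
    (fun ω => A ω i j * B ω k p) =O[l] fun ω => Real.log |t ω| / |t ω| := by
  refine IsBigO.trans ?_ (isBigO_rpow_log_div_abs ht hab)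
  refine ((isBigO_matrix_iff.1 hA i j).mul (isBigO_matrix_iff.1 hB k p)).congr' EventuallyEq.rfl ?_
  filter_upwards [ht.eventually_gt_atTop 0] with ω hω
  rw [Real.rpow_add hω]

/-- Two blocks whose trajectories separate linearly in time decouple: where both weights are small,
or both are large, everything is small, and elsewhere the quotient of the weights is small. -/
theorem isBigO_amplitude_sub_reduced (h : IsPhase μ κ t s φ) (h' : IsPhase ν κ' t s' ψ)
    (hμ : 0 < μ.im) (hν : 0 < ν.im)
    {A : Matrix (Fin m) (Fin m) ℂ} {B : Matrix (Fin m) (Fin n) ℂ} {D : Matrix (Fin n) (Fin n) ℂ}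
    (hG : (fromBlocks A B Bᴴ D).PosDef) (hS' : (A - B * D⁻¹ * Bᴴ).PosDef)
    (hS : (D - Bᴴ * A⁻¹ * B).PosDef) {a : ℝ} (ha : 0 < a)
    (hsep : ∀ᶠ ω in l, s' ω - s ω = a * |t ω|) (e : Fin m → ℂ) (f : Fin n → ℂ)
    (ht : Tendsto (fun ω => |t ω|) l atTop) :
    (fun ω => amplitude (fromBlocks A B Bᴴ D) (fromBlocks A B Bᴴ D) (Sum.elim e f) (Sum.elim e f)
        (fromBlocks (phaseMatrix m μ φ ω) 0 0 (phaseMatrix n ν ψ ω)) -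
      (amplitude (A - B * D⁻¹ * Bᴴ) A (e - f ᵥ* (D⁻¹ * Bᴴ)) e (phaseMatrix m μ φ ω) +
        amplitude D (D - Bᴴ * A⁻¹ * B) f (f - e ᵥ* (A⁻¹ * B)) (phaseMatrix n ν ψ ω))) =O[l]
      fun ω => Real.log |t ω| / |t ω| := by
  have hA : A.PosDef := hG.submatrix Sum.inl_injective
  have hD : D.PosDef := hG.submatrix Sum.inr_injective
  obtain ⟨K₁, hK₁, hK₁'⟩ := exists_exponent m hμ
  obtain ⟨K₂, hK₂, hK₂'⟩ := exists_exponent n hν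
  set K := max K₁ K₂ with hK
  have inv₁ := phaseMatrix_neg_mul (μ := μ) h.contDiff m
  have inv₂ := phaseMatrix_neg_mul (μ := ν) h'.contDiff n
  have inv₁₂ : ∀ ω, fromBlocks (phaseMatrix m μ (fun ω z => -φ ω z) ω) 0 0
      (phaseMatrix n ν (fun ω z => -ψ ω z) ω) *
        fromBlocks (phaseMatrix m μ φ ω) 0 0 (phaseMatrix n ν ψ ω) = 1 := by
    intro ω
    rw [fromBlocks_multiply]
    simp [inv₁, inv₂]
  have split : ∀ (l' : Filter Ω) (C : Set Ω), l' ≤ l →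
      l' ⊓ 𝓟 C ≤ l ∧ ∀ᶠ ω in l' ⊓ 𝓟 C, ω ∈ C := fun l' C hl =>
    ⟨inf_le_left.trans hl, eventually_inf_principal.2 (Eventually.of_forall fun _ h => h)⟩
  refine isBigO_of_inf_principal (A := {ω | K * Real.log |t ω| ≤ s ω}) ?_ ?_
  · obtain ⟨hl, hs⟩ := split l {ω | K * Real.log |t ω| ≤ s ω} le_rfl
    set l' := l ⊓ 𝓟 {ω | K * Real.log |t ω| ≤ s ω}
    have ht' := ht.mono_left hl
    have hs₁ : ∀ᶠ ω in l', K₁ * Real.log |t ω| ≤ s ω := by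
      filter_upwards [hs, ht'.eventually_ge_atTop 1] with ω hω h1
      exact (mul_le_mul_of_nonneg_right (le_max_left _ _) (Real.log_nonneg h1)).trans hω
    have hs₂ : ∀ᶠ ω in l', K₂ * Real.log |t ω| ≤ s' ω := by
      filter_upwards [hs, ht'.eventually_ge_atTop 1, hsep.filter_mono hl] with ω hω h1 h2
      have h3 := (mul_le_mul_of_nonneg_right (le_max_right K₁ K₂) (Real.log_nonneg h1)).trans hω
      nlinarith [mul_nonneg ha.le (abs_nonneg (t ω))]
    have b₁ := (h.isBigO_phaseMatrix hμ ht' hs₁ m).trans (isBigO_rpow_log_div_abs ht' hK₁')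
    have b₂ := (h'.isBigO_phaseMatrix hν ht' hs₂ n).trans (isBigO_rpow_log_div_abs ht' hK₂')
    exact (isBigO_amplitude_of_isBigO hG hG (isBigO_fromBlocks b₁ b₂) _ _).sub
      ((isBigO_amplitude_of_isBigO hS' hA b₁ _ _).add (isBigO_amplitude_of_isBigO hD hS b₂ _ _))
  refine isBigO_of_inf_principal (A := {ω | K * Real.log |t ω| ≤ -s' ω}) ?_ ?_
  · obtain ⟨hl, hs⟩ := split (l ⊓ 𝓟 {ω | K * Real.log |t ω| ≤ s ω}ᶜ)
      {ω | K * Real.log |t ω| ≤ -s' ω} inf_le_left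
    set l' := l ⊓ 𝓟 {ω | K * Real.log |t ω| ≤ s ω}ᶜ ⊓ 𝓟 {ω | K * Real.log |t ω| ≤ -s' ω}
    have ht' := ht.mono_left hl
    have hs₂ : ∀ᶠ ω in l', K₂ * Real.log |t ω| ≤ -s' ω := by
      filter_upwards [hs, ht'.eventually_ge_atTop 1] with ω hω h1
      exact (mul_le_mul_of_nonneg_right (le_max_right _ _) (Real.log_nonneg h1)).trans hω
    have hs₁ : ∀ᶠ ω in l', K₁ * Real.log |t ω| ≤ -s ω := by
      filter_upwards [hs, ht'.eventually_ge_atTop 1, hsep.filter_mono hl] with ω hω h1 h2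
      have h3 := (mul_le_mul_of_nonneg_right (le_max_left K₁ K₂) (Real.log_nonneg h1)).trans hω
      nlinarith [mul_nonneg ha.le (abs_nonneg (t ω))]
    have b₁ := (h.isBigO_phaseMatrix_neg hμ ht' hs₁ m).trans (isBigO_rpow_log_div_abs ht' hK₁')
    have b₂ := (h'.isBigO_phaseMatrix_neg hν ht' hs₂ n).trans (isBigO_rpow_log_div_abs ht' hK₂')
    exact (isBigO_amplitude_of_isBigO_inv hG hG inv₁₂ (isBigO_fromBlocks b₁ b₂) _ _).sub
      ((isBigO_amplitude_of_isBigO_inv hS' hA inv₁ b₁ _ _).add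
        (isBigO_amplitude_of_isBigO_inv hD hS inv₂ b₂ _ _))
  obtain ⟨hl, -⟩ := split (l ⊓ 𝓟 {ω | K * Real.log |t ω| ≤ s ω}ᶜ)
      {ω | K * Real.log |t ω| ≤ -s' ω}ᶜ inf_le_left
  have hs₁ : ∀ᶠ ω in l ⊓ 𝓟 {ω | K * Real.log |t ω| ≤ s ω}ᶜ ⊓
      𝓟 {ω | K * Real.log |t ω| ≤ -s' ω}ᶜ, -K * Real.log |t ω| ≤ -s ω := by
    rw [inf_assoc, inf_principal]
    refine eventually_inf_principal.2 (Eventually.of_forall fun ω hω => ?_)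
    have h1 := not_le.1 (show ¬ K * Real.log |t ω| ≤ s ω from hω.1)
    linarith
  have hs₂ : ∀ᶠ ω in l ⊓ 𝓟 {ω | K * Real.log |t ω| ≤ s ω}ᶜ ⊓
      𝓟 {ω | K * Real.log |t ω| ≤ -s' ω}ᶜ, -K * Real.log |t ω| ≤ s' ω := by
    filter_upwards [(split (l ⊓ 𝓟 {ω | K * Real.log |t ω| ≤ s ω}ᶜ)
      {ω | K * Real.log |t ω| ≤ -s' ω}ᶜ inf_le_left).2] with ω hω
    have h1 := not_le.1 (show ¬ K * Real.log |t ω| ≤ -s' ω from hω)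
    linarith
  set l' := l ⊓ 𝓟 {ω | K * Real.log |t ω| ≤ s ω}ᶜ ⊓ 𝓟 {ω | K * Real.log |t ω| ≤ -s' ω}ᶜ
  have ht' := ht.mono_left hl
  have a₁ := h.isBigO_phaseMatrix_neg hμ ht' hs₁ m
  have a₂ := h'.isBigO_phaseMatrix hν ht' hs₂ n
  -- Between the trajectories one of the two weights beats any power of `t`, while the other one
  -- is at most a power of `t`.
  refine isBigO_amplitude_fromBlocks_sub hG (tendsto_log_div_abs ht') inv₁ (fun i j k p => ?_) e f
  refine isBigO_of_inf_principal (A := {ω | a / 2 * |t ω| ≤ -s ω}) ?_ ?_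
  · obtain ⟨hl'', hs⟩ := split l' {ω | a / 2 * |t ω| ≤ -s ω} hl
    have hle : l' ⊓ 𝓟 {ω | a / 2 * |t ω| ≤ -s ω} ≤ l' := inf_le_left
    obtain ⟨K', -, hK'⟩ := exists_exponent
      (m + ((n : ℝ) - min (ν.im * -K) (3 * (ν.im * -K)))) hμ
    have hs' : ∀ᶠ ω in l' ⊓ 𝓟 {ω | a / 2 * |t ω| ≤ -s ω}, K' * Real.log |t ω| ≤ -s ω := by
      filter_upwards [hs, eventually_log_le (ht.mono_left hl'') K' (half_pos ha)] with ω h1 h2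
      exact h2.trans h1
    exact isBigO_entry_mul_entry (ht.mono_left hl'')
      (h.isBigO_phaseMatrix_neg hμ (ht.mono_left hl'') hs' m) (a₂.mono hle) (by linarith) i j k p
  · obtain ⟨hl'', hs⟩ := split l' {ω | a / 2 * |t ω| ≤ -s ω}ᶜ hl
    have hle : l' ⊓ 𝓟 {ω | a / 2 * |t ω| ≤ -s ω}ᶜ ≤ l' := inf_le_left
    obtain ⟨K', -, hK'⟩ := exists_exponent
      (n + ((m : ℝ) - min (μ.im * -K) (3 * (μ.im * -K)))) hν
    have hs' : ∀ᶠ ω in l' ⊓ 𝓟 {ω | a / 2 * |t ω| ≤ -s ω}ᶜ, K' * Real.log |t ω| ≤ s' ω := by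
      filter_upwards [hs, eventually_log_le (ht.mono_left hl'') K' (half_pos ha),
        hsep.filter_mono hl''] with ω h1 h2 h3
      have h1 := not_le.1 (show ¬ a / 2 * |t ω| ≤ -s ω from h1)
      linarith
    exact isBigO_entry_mul_entry (ht.mono_left hl'') (a₁.mono hle)
      (h'.isBigO_phaseMatrix hν (ht.mono_left hl'') hs' n) (by linarith) i j k p

/-- The amplitude of the two-block system is the sum of the peaks of the blocks, each multiplied by
a power of a Blaschke factor of the other one. -/
theorem isBigO_amplitude_gramTwo_sub_peaks {M N : ℕ} (hM : M = m + 1)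
    (hN : N = n + 1) (h : IsPhase μ κ t s φ) (h' : IsPhase ν κ' t s' ψ)
    (hκ : κ ≠ 0) (hκ' : κ' ≠ 0) (hμ : 0 < μ.im) (hν : 0 < ν.im) (hne : μ ≠ ν) {a : ℝ} (ha : 0 < a)
    (hsep : ∀ᶠ ω in l, s' ω - s ω = a * |t ω|) (ht : Tendsto (fun ω => |t ω|) l atTop) :
    (fun ω => amplitude (gramTwo M N μ ν) (gramTwo M N μ ν)
        (Sum.elim (firstRow M) (firstRow N))
        (Sum.elim (firstRow M) (firstRow N))
        (fromBlocks (phaseMatrix M μ φ ω) 0 0 (phaseMatrix N ν ψ ω)) -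
      (∑ p : Fin (m + 1),
          peak μ.im (peakArg m μ κ t φ (1 / ((ν - μ) / (star ν - μ)) ^ N) p ω) +
        ∑ p : Fin (n + 1),
          peak ν.im (peakArg n ν κ' t ψ (((μ - ν) / (star μ - ν)) ^ M) p ω))) =O[l]
      fun ω => Real.log |t ω| / |t ω| := by
  subst hM hN
  set A := gramBlock (m + 1) (m + 1) μ μ with hAdef
  set B := gramBlock (m + 1) (n + 1) μ ν with hBdef
  set D := gramBlock (n + 1) (n + 1) ν ν with hDdef
  have hBH : Bᴴ = gramBlock (n + 1) (m + 1) ν μ := gramBlock_conjTranspose hμ hν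
  have hGeq : gramTwo (m + 1) (n + 1) μ ν = fromBlocks A B Bᴴ D := by rw [hBH]; rfl
  have hG : (fromBlocks A B Bᴴ D).PosDef := hGeq ▸ posDef_gramTwo hμ hν hne
  have hA : A.PosDef := hG.submatrix Sum.inl_injective
  have hD : D.PosDef := hG.submatrix Sum.inr_injective
  have hAu : IsUnit A.det := (isUnit_iff_isUnit_det _).1 hA.isUnit
  have hDu : IsUnit D.det := (isUnit_iff_isUnit_det _).1 hD.isUnit
  have hS' : (A - B * D⁻¹ * Bᴴ).PosDef := posDef_schur_left hG
  have hS : (D - Bᴴ * A⁻¹ * B).PosDef := posDef_schur_right hG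
  have dA := gramBlock_displacement (m + 1) (m + 1) (star_ne_of_im_pos hμ hμ)
  have dB := gramBlock_displacement (m + 1) (n + 1) (star_ne_of_im_pos hμ hν)
  have dB' := gramBlock_displacement (n + 1) (m + 1) (star_ne_of_im_pos hν hμ)
  have dD := gramBlock_displacement (n + 1) (n + 1) (star_ne_of_im_pos hν hν)
  rw [← hAdef] at dA
  rw [← hBdef] at dB
  rw [← hBH] at dB'
  rw [← hDdef] at dD
  have dS := schur_displacement hA.isHermitian.eq hAu dA dB dD
  have dS' := schur_displacement hD.isHermitian.eq hDu dD dB' dA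
  rw [conjTranspose_conjTranspose] at dS'
  have bS := schur_firstRow_eq hAu (star_ne_of_im_pos hμ hν) dA dB
  have bS' := schur_firstRow_eq hDu (star_ne_of_im_pos hν hμ) dD dB'
  have k₀ := isBigO_amplitude_sub_reduced h h' hμ hν hG hS' hS ha hsep (firstRow (m + 1))
    (firstRow (n + 1)) ht
  have k₁ := h.isBigO_amplitude_sub_peaks hκ hμ hS' hA (displacement_iff.2 dS')
    (displacement_iff.2 dA) ht
  have k₂ := h'.isBigO_amplitude_sub_peaks hκ' hν hD hS (displacement_iff.2 dD)
    (displacement_iff.2 dS) ht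
  rw [bS'] at k₁
  rw [bS] at k₂
  have hone : ∀ k : ℕ, firstRow (k + 1) 0 = 1 := fun k => by simp [firstRow]
  rw [hone] at k₁ k₂
  rw [div_one] at k₂
  rw [hGeq]
  refine (k₀.add (k₁.add k₂)).congr_left fun ω => by ring

end TwoBlockAsymptotics

/-! ### Reduction of the soliton to two blocks -/

section HirotaPhase

theorem taylorCoeff_add {f g : ℂ → ℂ} (hf : ContDiff ℂ ⊤ f) (hg : ContDiff ℂ ⊤ g) (z : ℂ) (m : ℕ) :
    taylorCoeff (fun w => f w + g w) z m = taylorCoeff f z m + taylorCoeff g z m := by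
  rw [taylorCoeff, iteratedDeriv_fun_add (hf.of_le le_top).contDiffAt
    (hg.of_le le_top).contDiffAt, mul_add]
  rfl

theorem taylorCoeff_const_mul {f : ℂ → ℂ} (hf : ContDiff ℂ ⊤ f) (c z : ℂ) (m : ℕ) :
    taylorCoeff (fun w => c * f w) z m = c * taylorCoeff f z m := by
  rw [taylorCoeff, iteratedDeriv_const_mul c (hf.of_le le_top).contDiffAt, taylorCoeff]
  ring

theorem taylorCoeff_one (g : ℂ → ℂ) (z : ℂ) : taylorCoeff g z 1 = deriv g z := by
  simp [taylorCoeff]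

theorem taylorCoeff_linear_add_two (c z : ℂ) (k : ℕ) :
    taylorCoeff (fun w => c * w) z (k + 2) = 0 := by
  have h : deriv (fun w : ℂ => c * w) = fun _ => c := by
    funext w
    simp
  rw [taylorCoeff, iteratedDeriv_succ', h, iteratedDeriv_const]
  simp

/-- The phase `2 θ` of a block, as a function of `(t, x)`. -/
def hirotaPhase (γ δ : ℝ) (lam : ℂ) (n : ℕ) (a : ℕ → ℂ) (ω : ℝ × ℝ) (z : ℂ) : ℂ :=
  2 * theta γ δ lam n a ω.2 ω.1 z

theorem theta_self (γ δ : ℝ) (lam : ℂ) {n : ℕ} (hn : 1 ≤ n) (a : ℕ → ℂ) (x t : ℝ) :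
    theta γ δ lam n a x t lam =
      I * lam * (x + (2 * γ * lam + 4 * δ * lam ^ 2) * t) + a 0 - I / 4 * Real.pi := by
  rw [theta]
  congr 2
  rw [Finset.sum_eq_single 0]
  · simp
  · intro j _ hj
    simp [hj]
  · intro h
    simp at h
    omega

theorem two_mul_theta_re (γ δ : ℝ) (lam : ℂ) {n : ℕ} (hn : 1 ≤ n) (a : ℕ → ℂ) (x t : ℝ) :
    (2 * theta γ δ lam n a x t lam).re =
      2 * (a 0).re - 2 * lam.im * (x - velocity γ δ lam * t) := by
  rw [theta_self γ δ lam hn, velocity]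
  simp [pow_two]
  ring

/-- The velocity and the constant `𝒞` are the real and the imaginary information in the derivative
of the phase at the spectral parameter: `(2 θ)' = 2 i (x - v t) - i 𝒞^* t + const`. -/
theorem isPhase_hirotaPhase (γ δ : ℝ) (lam : ℂ) {n : ℕ} (hn : 1 ≤ n) (a : ℕ → ℂ) :
    IsPhase lam (-I * star (constC γ δ lam)) (fun ω : ℝ × ℝ => ω.1)
      (fun ω => ω.2 - velocity γ δ lam * ω.1) (hirotaPhase γ δ lam n a) := by
  set f₁ : ℂ → ℂ := fun z => 2 * I * z with hf₁
  set f₂ : ℂ → ℂ := fun z => 4 * I * γ * z ^ 2 + 8 * I * δ * z ^ 3 with hf₂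
  set f₃ : ℂ → ℂ := fun z => 2 * (∑ j ∈ Finset.range n, a j * (z - lam) ^ j - I / 4 * Real.pi)
    with hf₃
  have c₁ : ContDiff ℂ ⊤ f₁ := by fun_prop
  have c₂ : ContDiff ℂ ⊤ f₂ := by fun_prop
  have c₃ : ContDiff ℂ ⊤ f₃ := by fun_prop
  have heq : ∀ ω, hirotaPhase γ δ lam n a ω =
      fun z => (ω.2 : ℂ) * f₁ z + (ω.1 : ℂ) * f₂ z + f₃ z := by
    intro ω
    funext z
    simp only [hirotaPhase, theta, hf₁, hf₂, hf₃]
    ring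
  have hcoeff : ∀ ω k, taylorCoeff (hirotaPhase γ δ lam n a ω) lam k =
      ω.2 * taylorCoeff f₁ lam k + ω.1 * taylorCoeff f₂ lam k + taylorCoeff f₃ lam k := by
    intro ω k
    rw [heq, taylorCoeff_add ((contDiff_const.mul c₁).add (contDiff_const.mul c₂)) c₃,
      taylorCoeff_add (contDiff_const.mul c₁) (contDiff_const.mul c₂),
      taylorCoeff_const_mul c₁, taylorCoeff_const_mul c₂]
  refine ⟨fun ω => ?_, ⟨2 * (a 0).re, fun ω => two_mul_theta_re γ δ lam hn a _ _⟩,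
    ⟨taylorCoeff f₃ lam 1, fun ω => ?_⟩, fun k => ⟨taylorCoeff f₂ lam (k + 2),
      taylorCoeff f₃ lam (k + 2), fun ω => ?_⟩⟩
  · rw [heq]
    exact ((contDiff_const.mul c₁).add (contDiff_const.mul c₂)).add c₃
  · have d₁ : taylorCoeff f₁ lam 1 = 2 * I := by
      rw [taylorCoeff_one, hf₁]
      simp
    have d₂ : taylorCoeff f₂ lam 1 = 8 * I * γ * lam + 24 * I * δ * lam ^ 2 := by
      rw [taylorCoeff_one]
      have h1 := ((hasDerivAt_pow 2 lam).const_mul (4 * I * γ)).add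
        ((hasDerivAt_pow 3 lam).const_mul (8 * I * δ))
      refine h1.deriv.trans ?_
      push_cast
      ring
    have hkey : 8 * I * γ * lam + 24 * I * δ * lam ^ 2 =
        -I * star (constC γ δ lam) - 2 * I * velocity γ δ lam := by
      rw [constC, velocity]
      apply Complex.ext
      · simp [pow_two]
        ring
      · simp [pow_two]
        ring
    rw [hcoeff, d₁, d₂, hkey]
    push_cast
    ring
  · rw [hcoeff, hf₁, taylorCoeff_linear_add_two]
    ring

end HirotaPhase

section Reduction

theorem amplitude_submatrix {ι ι' : Type*} [Fintype ι] [DecidableEq ι] [Fintype ι'] [DecidableEq ι']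
    (σ : ι' ≃ ι) (P Q T : Matrix ι ι ℂ) (α β : ι → ℂ) :
    amplitude (P.submatrix σ σ) (Q.submatrix σ σ) (α ∘ σ) (β ∘ σ) (T.submatrix σ σ) =
      amplitude P Q α β T := by
  have h : transfer (P.submatrix σ σ) (T.submatrix σ σ) (Q.submatrix σ σ) =
      (transfer P T Q).submatrix σ σ := by
    unfold transfer
    rw [conjTranspose_submatrix, submatrix_mul_equiv, submatrix_mul_equiv, ← show
      (P + Tᴴ * Q * T).submatrix σ σ = P.submatrix σ σ + (Tᴴ * Q * T).submatrix σ σ from rfl,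
      inv_submatrix_equiv, submatrix_mul_equiv]
  rw [amplitude, h, amplitude, show star (β ∘ σ) = star β ∘ σ from rfl, submatrix_mulVec_equiv]
  simp [Function.comp_assoc]

variable {k : ℕ}

/-- The block diagonal matrix of the Toeplitz matrices, indexed by the columns. -/
def toeplitzIdx (γ δ : ℝ) (lam : Fin k → ℂ) (n : Fin k → ℕ) (a : Fin k → ℕ → ℂ) (x t : ℝ) :
    Matrix (Idx n) (Idx n) ℂ :=
  of fun p q => if p.1 = q.1 ∧ (p.2 : ℕ) ≤ q.2 then
    taylorCoeff (fun z => cexp (2 * theta γ δ (lam q.1) (n q.1) (a q.1) x t z)) (lam q.1)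
      ((q.2 : ℕ) - p.2) else 0

/-- The Gram matrix of all the blocks, indexed by the columns. -/
def gramIdx (lam : Fin k → ℂ) (n : Fin k → ℕ) : Matrix (Idx n) (Idx n) ℂ :=
  of fun p q => gramEntry (lam p.1) (lam q.1) p.2 q.2

/-- The row vector selecting the first column of each block. -/
def rowIdx (n : Fin k → ℕ) : Idx n → ℂ := fun p => if (p.2 : ℕ) = 0 then 1 else 0

variable (γ δ : ℝ) (lam : Fin k → ℂ) (n : Fin k → ℕ) (a : Fin k → ℕ → ℂ) (x t : ℝ)

/-- In `X` each vector `Φ` contributes an entry of the Toeplitz matrix and an entry of the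
identity, and `S` acts on both in the same way. -/
theorem matM_eq : matM γ δ lam n a x t = I • (gramIdx lam n +
    (toeplitzIdx γ δ lam n a x t)ᴴ * gramIdx lam n * toeplitzIdx γ δ lam n a x t) := by
  have hX0 : ∀ p q, matX γ δ lam n a x t (p, 0) q = toeplitzIdx γ δ lam n a x t p q := by
    intro p q
    simp [matX, toeplitzIdx, phi, taylorCoeff]
  have hX1 : ∀ p q, matX γ δ lam n a x t (p, 1) q = (1 : Matrix (Idx n) (Idx n) ℂ) p q := by
    rintro ⟨i, p⟩ ⟨j, q⟩
    simp only [matX, phi, of_apply, one_apply]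
    by_cases hij : i = j
    · subst hij
      have : (⟨i, p⟩ : Idx n) = ⟨i, q⟩ ↔ (p : ℕ) = q := by
        simp [Fin.ext_iff]
      simp only [this, true_and]
      split_ifs <;> simp <;> omega
    · have : (⟨i, p⟩ : Idx n) ≠ ⟨j, q⟩ := fun h => hij (congrArg Sigma.fst h)
      simp [hij, this]
  have hS : ∀ p q c d, matS lam n (p, c) (q, d) = if c = d then I * gramIdx lam n p q else 0 := by
    intro p q c d
    simp only [matS, gramIdx, gramEntry, of_apply]
    split_ifs
    · rw [← mul_assoc, show I * -I = 1 by simp, one_mul]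
    · rfl
  have hdecomp : matM γ δ lam n a x t = (toeplitzIdx γ δ lam n a x t)ᴴ * (I • gramIdx lam n) *
      toeplitzIdx γ δ lam n a x t +
      (1 : Matrix (Idx n) (Idx n) ℂ)ᴴ * (I • gramIdx lam n) * (1 : Matrix (Idx n) (Idx n) ℂ) := by
    ext p q
    simp only [matM, mul_apply, Fintype.sum_prod_type, Fin.sum_univ_two, conjTranspose_apply,
      Matrix.add_apply, hX0, hX1, hS, Matrix.smul_apply, smul_eq_mul, Finset.sum_add_distrib]
    simp
  rw [hdecomp, conjTranspose_one, Matrix.one_mul, Matrix.mul_one, Matrix.mul_smul, Matrix.smul_mul,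
    ← smul_add, add_comm]

theorem soliton_eq_amplitude (hdet : IsUnit (gramIdx lam n +
    (toeplitzIdx γ δ lam n a x t)ᴴ * gramIdx lam n * toeplitzIdx γ δ lam n a x t).det) :
    soliton γ δ lam n a x t =
      amplitude (gramIdx lam n) (gramIdx lam n) (rowIdx n) (rowIdx n)
        (toeplitzIdx γ δ lam n a x t) := by
  have h1 : matY γ δ lam n a x t 1 = rowIdx n := by
    funext p
    simp [matY, phi, rowIdx]
  have h0 : matY γ δ lam n a x t 0 = rowIdx n ᵥ* toeplitzIdx γ δ lam n a x t := by
    funext ⟨i, q⟩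
    simp only [vecMul, dotProduct, rowIdx, toeplitzIdx, of_apply, matY, phi]
    rw [Finset.sum_eq_single (⟨i, ⟨0, q.pos⟩⟩ : Idx n)]
    · simp [taylorCoeff]
    · rintro ⟨j, p⟩ _ hp
      by_cases hj : j = i
      · subst hj
        have : (p : ℕ) ≠ 0 := fun h =>
          hp (by rw [Sigma.mk.injEq]; exact ⟨rfl, heq_of_eq (Fin.ext h)⟩)
        simp [this]
      · simp [hj]
    · simp
  set N := gramIdx lam n +
    (toeplitzIdx γ δ lam n a x t)ᴴ * gramIdx lam n * toeplitzIdx γ δ lam n a x t with hN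
  have hinv : (I • N)⁻¹ = -I • N⁻¹ := by
    apply inv_eq_right_inv
    rw [Matrix.smul_mul, Matrix.mul_smul, smul_smul, mul_nonsing_inv _ hdet]
    simp
  rw [soliton, amplitude, transfer, h0, h1, matM_eq, ← hN, hinv, star_vecMul, Matrix.smul_mulVec,
    mulVec_mulVec, dotProduct_smul, smul_eq_mul]
  ring

/-- The columns of two blocks, as a disjoint union. -/
def idxEquiv (n : Fin 2 → ℕ) {f s : Fin 2} (hfs : f ≠ s) : Fin (n f) ⊕ Fin (n s) ≃ Idx n :=
  Equiv.ofBijective (Sum.elim (fun p => ⟨f, p⟩) (fun p => ⟨s, p⟩)) (by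
    constructor
    · rintro (p | p) (q | q) h
      · simpa using h
      · exact absurd (congrArg Sigma.fst h) hfs
      · exact absurd (congrArg Sigma.fst h) hfs.symm
      · simpa using h
    · rintro ⟨i, p⟩
      have hi : i = f ∨ i = s := by omega
      rcases hi with rfl | rfl
      · exact ⟨Sum.inl p, rfl⟩
      · exact ⟨Sum.inr p, rfl⟩)

theorem soliton_eq_amplitude_gramTwo (γ δ : ℝ) (lam : Fin 2 → ℂ) (n : Fin 2 → ℕ)
    (a : Fin 2 → ℕ → ℂ) {f s : Fin 2} (hfs : f ≠ s) (hf : 0 < (lam f).im) (hs : 0 < (lam s).im)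
    (hne : lam f ≠ lam s) (ω : ℝ × ℝ) :
    soliton γ δ lam n a ω.2 ω.1 =
      amplitude (gramTwo (n f) (n s) (lam f) (lam s)) (gramTwo (n f) (n s) (lam f) (lam s))
        (Sum.elim (firstRow (n f)) (firstRow (n s))) (Sum.elim (firstRow (n f)) (firstRow (n s)))
        (fromBlocks (phaseMatrix (n f) (lam f) (hirotaPhase γ δ (lam f) (n f) (a f)) ω) 0 0
          (phaseMatrix (n s) (lam s) (hirotaPhase γ δ (lam s) (n s) (a s)) ω)) := by
  set σ := idxEquiv n hfs with hσ
  have hl : ∀ p, σ (Sum.inl p) = ⟨f, p⟩ := fun p => rfl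
  have hr : ∀ p, σ (Sum.inr p) = ⟨s, p⟩ := fun p => rfl
  have eG : (gramIdx lam n).submatrix σ σ = gramTwo (n f) (n s) (lam f) (lam s) := by
    ext (i | i) (j | j) <;> simp [gramIdx, gramTwo, gramBlock, hl, hr]
  have eT : (toeplitzIdx γ δ lam n a ω.2 ω.1).submatrix σ σ =
      fromBlocks (phaseMatrix (n f) (lam f) (hirotaPhase γ δ (lam f) (n f) (a f)) ω) 0 0
          (phaseMatrix (n s) (lam s) (hirotaPhase γ δ (lam s) (n s) (a s)) ω) := by
    ext (i | i) (j | j) <;>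
      simp [toeplitzIdx, phaseMatrix, toeplitz, hirotaPhase, hl, hr, hfs, hfs.symm]
  have eR : rowIdx n ∘ σ = Sum.elim (firstRow (n f)) (firstRow (n s)) := by
    funext i
    rcases i with i | i <;> rfl
  have hG : (gramTwo (n f) (n s) (lam f) (lam s)).PosDef := posDef_gramTwo hf hs hne
  rw [soliton_eq_amplitude, ← eG, ← eT, ← eR, amplitude_submatrix]
  rw [← det_submatrix_equiv_self σ]
  rw [← isUnit_iff_isUnit_det]
  rw [← eG] at hG
  have := hG.add_posSemidef (hG.posSemidef.conjTranspose_mul_mul_same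
    ((toeplitzIdx γ δ lam n a ω.2 ω.1).submatrix σ σ))
  rw [conjTranspose_submatrix, submatrix_mul_equiv, submatrix_mul_equiv] at this
  exact this.isUnit

end Reduction

/-! ### Identification of the peaks with the asymptotic solitons -/

section Matching

theorem peak_exp (η A B : ℝ) : peak η (cexp (A + B * I)) =
    ((2 * η * sech A : ℝ) : ℂ) * cexp (I * ((-B - Real.pi / 2 : ℝ) : ℂ)) := by
  have hn : ‖cexp ((A : ℂ) + B * I)‖ = Real.exp A := by rw [Complex.norm_exp]; simp
  have hI : cexp (I * ((-B - Real.pi / 2 : ℝ) : ℂ)) = -I * cexp (-(B * I)) := by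
    rw [show I * ((-B - Real.pi / 2 : ℝ) : ℂ) = -(Real.pi / 2 * I) + -(B * I) by push_cast; ring,
      Complex.exp_add, Complex.exp_neg ((Real.pi : ℂ) / 2 * I), Complex.exp_pi_div_two_mul_I, inv_I]
  have hstar : star (cexp ((A : ℂ) + B * I)) = cexp A * cexp (-(B * I)) := by
    rw [← Complex.exp_add, star_def, ← Complex.exp_conj]
    simp
  have hc : ((sech A : ℝ) : ℂ) = 2 * cexp A / (1 + cexp A ^ 2) := by
    have h1 : (Real.exp A) * Real.exp (-A) = 1 := by rw [← Real.exp_add]; simp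
    have h2 := Real.exp_pos A
    have h3 : sech A = 2 * Real.exp A / (1 + Real.exp A ^ 2) := by
      rw [sech, Real.cosh_eq, Real.exp_neg]
      field_simp
      ring
    rw [h3]
    push_cast
    rfl
  rw [peak, hn, hI, hstar]
  push_cast
  rw [hc]
  ring

theorem sech_neg (y : ℝ) : sech (-y) = sech y := by rw [sech, sech, Real.cosh_neg]

/-- A `sech` profile with given position and phase is a peak. The profile is even, and phases matter
modulo `2 π`. -/
theorem eq_peak_exp {η X A B P : ℝ} (hX : X = -A) (k : ℤ)
    (hP : P = -B - Real.pi / 2 + k * (2 * Real.pi)) :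
    ((2 * η * sech X : ℝ) : ℂ) * cexp (I * P) = peak η (cexp (A + B * I)) := by
  rw [peak_exp, hX, sech_neg, hP]
  congr 1
  refine Complex.exp_eq_exp_iff_exists_int.2 ⟨k, ?_⟩
  push_cast
  ring

theorem hankelPivot_eq_exp {m p : ℕ} :
    hankelPivot m p = cexp ((Real.log (p.factorial / (m - p).factorial) : ℝ) +
      (Real.pi * p : ℝ) * I) := by
  have h0 : (0 : ℝ) < p.factorial / (m - p).factorial := by positivity
  rw [Complex.exp_add, ← Complex.ofReal_exp, Real.exp_log h0,
    show ((Real.pi * p : ℝ) : ℂ) * I = p * (Real.pi * I) by push_cast; ring, Complex.exp_nat_mul,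
    Complex.exp_pi_mul_I, hankelPivot]
  push_cast
  ring

/-- Polar form of the large parameter `2 (Im λ) 𝒞^* t`; a negative `t` contributes the angle `π`. -/
theorem star_mul_eq_exp {C : ℂ} (hC : C ≠ 0) {η : ℝ} (hη : 0 < η) {σ t : ℝ}
    (hσ : (σ = 1 ∧ 0 < t) ∨ (σ = -1 ∧ t < 0)) :
    2 * I * η * (-I * star C * t) = cexp ((Real.log (2 * η * ‖C‖) + Real.log |t| : ℝ) +
      (-arg C + Real.pi * ((1 - σ) / 2) : ℝ) * I) := by
  have hC' : 0 < ‖C‖ := norm_pos_iff.2 hC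
  have ht : 0 < |t| := by
    rcases hσ with ⟨-, h⟩ | ⟨-, h⟩
    · exact abs_pos.2 h.ne'
    · exact abs_pos.2 h.ne
  have h1 : star C = ‖C‖ * cexp (-(arg C * I)) := by
    conv_lhs => rw [← norm_mul_exp_arg_mul_I C]
    rw [star_def, map_mul, conj_ofReal, ← Complex.exp_conj]
    simp
  have h2 : (t : ℂ) = |t| * cexp ((Real.pi * ((1 - σ) / 2) : ℝ) * I) := by
    rcases hσ with ⟨rfl, h⟩ | ⟨rfl, h⟩
    · simp [abs_of_pos h]
    · rw [abs_of_neg h]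
      norm_num [Complex.exp_pi_mul_I]
  have h3 : cexp ((Real.log (2 * η * ‖C‖) + Real.log |t| : ℝ) +
      (-arg C + Real.pi * ((1 - σ) / 2) : ℝ) * I) = (2 * η * ‖C‖ * |t| : ℝ) *
      (cexp (-(arg C * I)) * cexp ((Real.pi * ((1 - σ) / 2) : ℝ) * I)) := by
    rw [Complex.exp_add, ← Complex.ofReal_exp, Real.exp_add, Real.exp_log (by positivity),
      Real.exp_log ht, ← Complex.exp_add]
    congr 2
    push_cast
    ring
  rw [h3, h1]
  conv_lhs => rw [h2]
  push_cast
  linear_combination (-2 * η * ‖C‖ * ((|t| : ℝ) : ℂ) * cexp (-(arg C * I)) *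
    cexp ((Real.pi : ℂ) * ((1 - σ) / 2) * I)) * I_sq

variable {Ω : Type*} {t : Ω → ℝ} {φ : Ω → ℂ → ℂ}

/-- Logarithm of the argument of a peak, with its real and imaginary parts written out. -/
theorem peakArg_eq_exp {m : ℕ} {μ C c u : ℂ} (hC : C ≠ 0) (hμ : 0 < μ.im) {σ N : ℝ} {ω : Ω}
    (hσ : (σ = 1 ∧ 0 < t ω) ∨ (σ = -1 ∧ t ω < 0)) (hc : c = cexp (-(σ * N) * Complex.log u))
    (p : Fin (m + 1)) :
    peakArg m μ (-I * star C) t φ c p ω = cexp (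
      (-(σ * N) * Real.log ‖u‖ + (φ ω μ).re + Real.log ((p : ℕ).factorial / (m - p).factorial) +
        (m - 2 * p) * (Real.log (2 * μ.im * ‖C‖) + Real.log |t ω|) : ℝ) +
      (-(σ * N) * arg u + (φ ω μ).im + Real.pi * p +
        (m - 2 * p) * (-arg C + Real.pi * ((1 - σ) / 2)) : ℝ) * I) := by
  rw [peakArg, star_mul_eq_exp hC hμ hσ, hc, hankelPivot_eq_exp, ← Complex.exp_int_mul,
    ← Complex.exp_add, ← Complex.exp_add, ← Complex.exp_add]
  congr 1
  have h1 : Complex.log u = Real.log ‖u‖ + arg u * I := rfl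
  have h2 := re_add_im (φ ω μ)
  rw [h1]
  conv_lhs => rw [← h2]
  push_cast
  ring

theorem sum_range_eq_sum_Icc_add_sum_Icc (G : ℕ → ℂ) (n : ℕ) :
    ∑ p ∈ Finset.range n, G p = ∑ κ ∈ Finset.Icc 1 ((n + 1) / 2), G (κ - 1) +
      ∑ κ ∈ Finset.Icc 1 (n / 2), G (n - κ) := by
  rw [← Finset.sum_range_add_sum_Ico G (show (n + 1) / 2 ≤ n by omega)]
  congr 1
  · refine Finset.sum_nbij' (· + 1) (· - 1) ?_ ?_ ?_ ?_ ?_ <;>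
      simp only [Finset.mem_range, Finset.mem_Icc] <;> intro a ha
    any_goals omega
    rw [Nat.add_sub_cancel]
  · refine Finset.sum_nbij' (n - ·) (n - ·) ?_ ?_ ?_ ?_ ?_ <;>
      simp only [Finset.mem_Ico, Finset.mem_Icc] <;> intro a ha
    any_goals omega
    congr 1
    omega

theorem sum_range_eq_sum_Icc_add_sum_Icc' (G : ℕ → ℂ) (n : ℕ) :
    ∑ p ∈ Finset.range n, G p = ∑ κ ∈ Finset.Icc 1 ((n + 1) / 2), G (n - κ) +
      ∑ κ ∈ Finset.Icc 1 (n / 2), G (κ - 1) := by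
  rw [← Finset.sum_range_reflect, sum_range_eq_sum_Icc_add_sum_Icc]
  congr 1 <;> refine Finset.sum_congr rfl fun κ hκ => ?_ <;> have := Finset.mem_Icc.1 hκ <;>
    congr 1 <;> omega

variable {γ δ : ℝ} {lam : Fin 2 → ℂ} {n : Fin 2 → ℕ} {a : Fin 2 → ℕ → ℂ} {σ : ℝ} {i j : Fin 2}
  {u c : ℂ} {m : ℕ} {ω : ℝ × ℝ}

/-- The hypotheses on `κ` hold for `κ = p + 1` when `σ = 1` and for `κ = m + 1 - p` when
`σ = -1`; the integer `k` counts the full turns between the two ways of writing the phase. -/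
theorem solitonL_eq_peak (hm : n i = m + 1) (hμ : 0 < (lam i).im) (hC : constC γ δ (lam i) ≠ 0)
    (hσ : (σ = 1 ∧ 0 < ω.1) ∨ (σ = -1 ∧ ω.1 < 0)) (hc : c = cexp (-(σ * n j) * Complex.log u))
    (hu : SignType.sign ((j : ℝ) - (i : ℝ)) *
      Real.log ‖(lam i - lam j) / (lam i - star (lam j))‖ = -Real.log ‖u‖)
    (p : Fin (m + 1)) {κ : ℕ} (hκ : σ * ((n i : ℝ) + 1 - 2 * κ) = m - 2 * p)
    (hfac : σ * Real.log (((n i - κ).factorial : ℝ) / ((κ - 1).factorial : ℝ)) =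
      -Real.log ((p : ℕ).factorial / (m - p).factorial)) {k : ℤ}
    (hk : (1 : ℝ) + κ + p + (m - 2 * p) * ((1 - σ) / 2) = k * 2) :
    solitonL γ δ lam n a σ i j u κ ω.2 ω.1 = peak (lam i).im
      (peakArg m (lam i) (-I * star (constC γ δ (lam i))) (fun ω : ℝ × ℝ => ω.1)
        (hirotaPhase γ δ (lam i) (n i) (a i)) c p ω) := by
  have hre := two_mul_theta_re γ δ (lam i) (show 1 ≤ n i by omega) (a i) ω.2 ω.1
  have him : (hirotaPhase γ δ (lam i) (n i) (a i) ω (lam i)).im =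
      2 * (thetaAt γ δ lam n a i ω.2 ω.1).im := by
    simp [hirotaPhase, thetaAt]
  rw [peakArg_eq_exp (t := fun ω : ℝ × ℝ => ω.1) hC hμ hσ hc]
  refine eq_peak_exp ?_ k ?_
  · rw [show (hirotaPhase γ δ (lam i) (n i) (a i) ω (lam i)).re = _ from hre, shiftL]
    field_simp
    linear_combination (-(Real.log |ω.1|) - Real.log (2 * (lam i).im * ‖constC γ δ (lam i)‖)) * hκ
      + hfac - σ * n j * hu
  · rw [him]
    linear_combination arg (constC γ δ (lam i)) * hκ + Real.pi * hk

/-- The analogue of `solitonL_eq_peak` for the solitons of the second kind, with the two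
correspondences between `κ` and `p` interchanged. -/
theorem solitonR_eq_peak (hm : n i = m + 1) (hμ : 0 < (lam i).im) (hC : constC γ δ (lam i) ≠ 0)
    (hσ : (σ = 1 ∧ 0 < ω.1) ∨ (σ = -1 ∧ ω.1 < 0)) (hc : c = cexp (-(σ * n j) * Complex.log u))
    (hu : SignType.sign ((j : ℝ) - (i : ℝ)) *
      Real.log ‖(lam i - lam j) / (lam i - star (lam j))‖ = -Real.log ‖u‖)
    (p : Fin (m + 1)) {κ : ℕ} (hκ : σ * ((n i : ℝ) + 1 - 2 * κ) = -(m - 2 * p))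
    (hfac : σ * Real.log (((n i - κ).factorial : ℝ) / ((κ - 1).factorial : ℝ)) =
      Real.log ((p : ℕ).factorial / (m - p).factorial)) {k : ℤ}
    (hk : (n i : ℝ) + κ + p + (m - 2 * p) * ((1 - σ) / 2) = k * 2) :
    solitonR γ δ lam n a σ i j u κ ω.2 ω.1 = peak (lam i).im
      (peakArg m (lam i) (-I * star (constC γ δ (lam i))) (fun ω : ℝ × ℝ => ω.1)
        (hirotaPhase γ δ (lam i) (n i) (a i)) c p ω) := by
  have hre := two_mul_theta_re γ δ (lam i) (show 1 ≤ n i by omega) (a i) ω.2 ω.1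
  have him : (hirotaPhase γ δ (lam i) (n i) (a i) ω (lam i)).im =
      2 * (thetaAt γ δ lam n a i ω.2 ω.1).im := by
    simp [hirotaPhase, thetaAt]
  rw [peakArg_eq_exp (t := fun ω : ℝ × ℝ => ω.1) hC hμ hσ hc]
  refine eq_peak_exp ?_ k ?_
  · rw [show (hirotaPhase γ δ (lam i) (n i) (a i) ω (lam i)).re = _ from hre, shiftR]
    field_simp
    linear_combination (Real.log |ω.1| + Real.log (2 * (lam i).im * ‖constC γ δ (lam i)‖)) * hκ
      - hfac - σ * n j * hu
  · rw [him]
    linear_combination -arg (constC γ δ (lam i)) * hκ + Real.pi * hk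

/-- The two families of asymptotic solitons of a block together enumerate its peaks, each once. -/
theorem sum_solitons_eq_sum_peaks (hm : n i = m + 1) (hμ : 0 < (lam i).im)
    (hC : constC γ δ (lam i) ≠ 0) (hσ : (σ = 1 ∧ 0 < ω.1) ∨ (σ = -1 ∧ ω.1 < 0))
    (hc : c = cexp (-(σ * n j) * Complex.log u))
    (hu : SignType.sign ((j : ℝ) - (i : ℝ)) *
      Real.log ‖(lam i - lam j) / (lam i - star (lam j))‖ = -Real.log ‖u‖) :
    ∑ κ ∈ Finset.Icc 1 ((n i + 1) / 2), solitonL γ δ lam n a σ i j u κ ω.2 ω.1 +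
      ∑ κ ∈ Finset.Icc 1 (n i / 2), solitonR γ δ lam n a σ i j u κ ω.2 ω.1 =
    ∑ p : Fin (m + 1), peak (lam i).im
      (peakArg m (lam i) (-I * star (constC γ δ (lam i))) (fun ω : ℝ × ℝ => ω.1)
        (hirotaPhase γ δ (lam i) (n i) (a i)) c p ω) := by
  set g : Fin (m + 1) → ℂ := fun p => peak (lam i).im
      (peakArg m (lam i) (-I * star (constC γ δ (lam i))) (fun ω : ℝ × ℝ => ω.1)
        (hirotaPhase γ δ (lam i) (n i) (a i)) c p ω) with hg
  set G : ℕ → ℂ := fun p => if h : p < m + 1 then g ⟨p, h⟩ else 0 with hG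
  have hGg : ∀ p (h : p < m + 1), G p = g ⟨p, h⟩ := fun p h => dif_pos h
  have hsum : ∑ p, g p = ∑ p ∈ Finset.range (n i), G p := by
    rw [hm, ← Fin.sum_univ_eq_sum_range]
    refine Finset.sum_congr rfl fun p _ => ?_
    exact (hGg p p.2).symm
  have hlog : ∀ x y : ℝ, Real.log (x / y) = -Real.log (y / x) := fun x y => by
    rw [← Real.log_inv, inv_div]
  rw [hsum]
  have hmR : (n i : ℝ) = m + 1 := by exact_mod_cast hm
  rcases hσ with ⟨h1, ht⟩ | ⟨h1, ht⟩
  · rw [sum_range_eq_sum_Icc_add_sum_Icc]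
    congr 1 <;> refine Finset.sum_congr rfl fun κ hκ => ?_ <;> have hκ := Finset.mem_Icc.1 hκ
    · obtain ⟨p, rfl⟩ : ∃ p, κ = p + 1 := ⟨κ - 1, by omega⟩
      have hp : p < m + 1 := by omega
      rw [Nat.add_sub_cancel, hGg _ hp]
      refine solitonL_eq_peak (k := p + 1) hm hμ hC (Or.inl ⟨h1, ht⟩) hc hu ⟨p, hp⟩ ?_ ?_ ?_
      · rw [h1, hmR]; push_cast; ring
      · rw [h1, one_mul, Nat.add_sub_cancel, hlog, show n i - (p + 1) = m - p by omega]
      · rw [h1]; push_cast; ring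
    · obtain ⟨p, hp, rfl⟩ : ∃ p, p < m + 1 ∧ κ = m + 1 - p := ⟨m + 1 - κ, by omega, by omega⟩
      have hcast : ((m + 1 - p : ℕ) : ℝ) = m + 1 - p := by
        rw [Nat.cast_sub hp.le]; push_cast; ring
      rw [show n i - (m + 1 - p) = p by omega, hGg _ hp]
      refine solitonR_eq_peak (k := m + 1) hm hμ hC (Or.inl ⟨h1, ht⟩) hc hu ⟨p, hp⟩ ?_ ?_ ?_
      · rw [h1, hmR, hcast]; ring
      · rw [h1, one_mul, show n i - (m + 1 - p) = p by omega,
          show m + 1 - p - 1 = m - p by omega]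
      · rw [h1, hmR, hcast]; push_cast; ring
  · rw [sum_range_eq_sum_Icc_add_sum_Icc']
    congr 1 <;> refine Finset.sum_congr rfl fun κ hκ => ?_ <;> have hκ := Finset.mem_Icc.1 hκ
    · obtain ⟨p, hp, rfl⟩ : ∃ p, p < m + 1 ∧ κ = m + 1 - p := ⟨m + 1 - κ, by omega, by omega⟩
      have hcast : ((m + 1 - p : ℕ) : ℝ) = m + 1 - p := by
        rw [Nat.cast_sub hp.le]; push_cast; ring
      rw [show n i - (m + 1 - p) = p by omega, hGg _ hp]
      refine solitonL_eq_peak (k := m + 1 - p) hm hμ hC (Or.inr ⟨h1, ht⟩) hc hu ⟨p, hp⟩ ?_ ?_ ?_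
      · rw [h1, hmR, hcast]; ring
      · rw [h1, show n i - (m + 1 - p) = p by omega,
          show m + 1 - p - 1 = m - p by omega]; ring
      · rw [h1, hcast]; push_cast; ring
    · obtain ⟨p, rfl⟩ : ∃ p, κ = p + 1 := ⟨κ - 1, by omega⟩
      have hp : p < m + 1 := by omega
      rw [Nat.add_sub_cancel, hGg _ hp]
      refine solitonR_eq_peak (k := m + 1) hm hμ hC (Or.inr ⟨h1, ht⟩) hc hu ⟨p, hp⟩ ?_ ?_ ?_
      · rw [h1, hmR]; push_cast; ring
      · rw [h1, Nat.add_sub_cancel, hlog, show n i - (p + 1) = m - p by omega]; ring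
      · rw [h1, hmR]; push_cast; ring

end Matching

/-! ### Asymptotics of the soliton -/

section Assembly

variable {γ δ : ℝ} {lam : Fin 2 → ℂ} {n : Fin 2 → ℕ} {a : Fin 2 → ℕ → ℂ}

/-- Both ends of the time axis at once: `f` is the block that is ahead for the sign `σ` of `t`. -/
theorem isBigO_soliton_sub (hn : ∀ i, 1 ≤ n i) (hlam : ∀ i, 0 < (lam i).im)
    (hC : ∀ i, constC γ δ (lam i) ≠ 0) {l : Filter (ℝ × ℝ)} {σ : ℝ}
    (ht : Tendsto (fun ω : ℝ × ℝ => |ω.1|) l atTop)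
    (hσ : ∀ᶠ ω in l, (σ = 1 ∧ 0 < ω.1) ∨ (σ = -1 ∧ ω.1 < 0)) {f s : Fin 2} (hfs : f ≠ s)
    (hv : 0 < σ * (velocity γ δ (lam f) - velocity γ δ (lam s))) {u u' : ℂ}
    (hc : 1 / ((lam s - lam f) / (star (lam s) - lam f)) ^ n s =
      cexp (-(σ * n s) * Complex.log u))
    (hc' : ((lam f - lam s) / (star (lam f) - lam s)) ^ n f =
      cexp (-(σ * n f) * Complex.log u'))
    (hu : SignType.sign ((s : ℝ) - (f : ℝ)) *
      Real.log ‖(lam f - lam s) / (lam f - star (lam s))‖ = -Real.log ‖u‖)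
    (hu' : SignType.sign ((f : ℝ) - (s : ℝ)) *
      Real.log ‖(lam s - lam f) / (lam s - star (lam f))‖ = -Real.log ‖u'‖) :
    (fun ω : ℝ × ℝ => soliton γ δ lam n a ω.2 ω.1 -
      ((∑ κ ∈ Finset.Icc 1 ((n f + 1) / 2), solitonL γ δ lam n a σ f s u κ ω.2 ω.1 +
        ∑ κ ∈ Finset.Icc 1 (n f / 2), solitonR γ δ lam n a σ f s u κ ω.2 ω.1) +
      (∑ κ ∈ Finset.Icc 1 ((n s + 1) / 2), solitonL γ δ lam n a σ s f u' κ ω.2 ω.1 +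
        ∑ κ ∈ Finset.Icc 1 (n s / 2), solitonR γ δ lam n a σ s f u' κ ω.2 ω.1))) =O[l]
      fun ω => Real.log |ω.1| / |ω.1| := by
  have hne : lam f ≠ lam s := fun h => by rw [h, sub_self, mul_zero] at hv; exact hv.ne rfl
  obtain ⟨m, hm⟩ : ∃ m, n f = m + 1 := ⟨n f - 1, by have := hn f; omega⟩
  obtain ⟨m', hm'⟩ : ∃ m, n s = m + 1 := ⟨n s - 1, by have := hn s; omega⟩
  have hκ : ∀ i, -I * star (constC γ δ (lam i)) ≠ 0 := fun i =>
    mul_ne_zero (neg_ne_zero.2 I_ne_zero) (star_ne_zero.2 (hC i))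
  have hsep : ∀ᶠ ω in l, (ω.2 - velocity γ δ (lam s) * ω.1) -
      (ω.2 - velocity γ δ (lam f) * ω.1) =
      σ * (velocity γ δ (lam f) - velocity γ δ (lam s)) * |ω.1| := by
    filter_upwards [hσ] with ω hω
    rcases hω with ⟨rfl, h⟩ | ⟨rfl, h⟩
    · rw [abs_of_pos h]; ring
    · rw [abs_of_neg h]; ring
  have key := isBigO_amplitude_gramTwo_sub_peaks hm hm'
    (isPhase_hirotaPhase γ δ (lam f) (hn f) (a f))
    (isPhase_hirotaPhase γ δ (lam s) (hn s) (a s)) (hκ f) (hκ s) (hlam f) (hlam s) hne hv hsep ht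
  refine key.congr' ?_ EventuallyEq.rfl
  filter_upwards [hσ] with ω hω
  rw [soliton_eq_amplitude_gramTwo γ δ lam n a hfs (hlam f) (hlam s) hne,
    sum_solitons_eq_sum_peaks hm (hlam f) (hC f) hω hc hu,
    sum_solitons_eq_sum_peaks hm' (hlam s) (hC s) hω hc' hu']

theorem constC_ne_zero {lam' : ℂ} (hv : velocity γ δ (lam 0) < velocity γ δ (lam 1))
    (hlam' : 0 < lam'.im) : constC γ δ lam' ≠ 0 := by
  intro h
  have h1 := congrArg Complex.re h
  have h2 := congrArg Complex.im h
  simp [constC, pow_two] at h1 h2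
  have hδ : δ = 0 := by
    rcases h1 with h1 | h1
    · exact h1
    · exact absurd h1 hlam'.ne'
  subst hδ
  have hγ : γ = 0 := by
    simp at h2
    rcases h2 with h2 | h2
    · exact h2
    · exact absurd h2 hlam'.ne'
  subst hγ
  simp [velocity] at hv

theorem cexp_nat_mul_log {u : ℂ} (hu : u ≠ 0) (k : ℕ) : cexp (k * Complex.log u) = u ^ k := by
  rw [Complex.exp_nat_mul, Complex.exp_log hu]

theorem isBigO_soliton_sub_asymptoticSum (hn : ∀ i, 1 ≤ n i) (hlam : ∀ i, 0 < (lam i).im)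
    (hv : velocity γ δ (lam 0) < velocity γ δ (lam 1)) {l : Filter (ℝ × ℝ)}
    (ht : Tendsto (fun ω : ℝ × ℝ => |ω.1|) l atTop) {σ : ℝ}
    (hσ : ∀ᶠ ω in l, (σ = 1 ∧ 0 < ω.1) ∨ (σ = -1 ∧ ω.1 < 0)) (hσ' : σ = 1 ∨ σ = -1) :
    (fun ω : ℝ × ℝ => soliton γ δ lam n a ω.2 ω.1 - asymptoticSum γ δ lam n a σ ω.2 ω.1) =O[l]
      fun ω => Real.log |ω.1| / |ω.1| := by
  have hne : lam 0 - lam 1 ≠ 0 := fun h => by rw [sub_eq_zero.1 h] at hv; exact hv.ne rfl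
  have hne' : lam 1 - lam 0 ≠ 0 := fun h => hne (by rw [← neg_sub, h, neg_zero])
  have hs : lam 0 - star (lam 1) ≠ 0 := fun h =>
    star_ne_of_im_pos (hlam 1) (hlam 0) (sub_eq_zero.1 h).symm
  have hs' : lam 1 - star (lam 0) ≠ 0 := fun h =>
    star_ne_of_im_pos (hlam 0) (hlam 1) (sub_eq_zero.1 h).symm
  have hC : ∀ i, constC γ δ (lam i) ≠ 0 := fun i => constC_ne_zero hv (hlam i)
  set u₁ : ℂ := (lam 0 - star (lam 1)) / (lam 0 - lam 1) with hu₁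
  set u₂ : ℂ := (lam 1 - lam 0) / (lam 1 - star (lam 0)) with hu₂
  have hu₁0 : u₁ ≠ 0 := div_ne_zero hs hne
  have hu₂0 : u₂ ≠ 0 := div_ne_zero hne' hs'
  have e₁ : (lam 1 - lam 0) / (star (lam 1) - lam 0) = u₁⁻¹ := by
    rw [hu₁, inv_div, ← neg_sub (lam 0), ← neg_sub (lam 0) (star (lam 1)), neg_div_neg_eq]
  have e₂ : (lam 0 - lam 1) / (star (lam 0) - lam 1) = u₂ := by
    rw [hu₂, ← neg_sub (lam 1), ← neg_sub (lam 1) (star (lam 0)), neg_div_neg_eq]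
  have l₁ : SignType.sign (((1 : Fin 2) : ℝ) - ((0 : Fin 2) : ℝ)) *
      Real.log ‖(lam 0 - lam 1) / (lam 0 - star (lam 1))‖ = -Real.log ‖u₁‖ := by
    rw [← Real.log_inv, ← norm_inv, hu₁, inv_div]
    simp
  have l₂ : SignType.sign (((0 : Fin 2) : ℝ) - ((1 : Fin 2) : ℝ)) *
      Real.log ‖(lam 1 - lam 0) / (lam 1 - star (lam 0))‖ = -Real.log ‖u₂‖ := by
    rw [← hu₂]
    simp
  rcases hσ' with rfl | rfl
  · refine (isBigO_soliton_sub (a := a) (σ := 1) (f := 1) (s := 0) (u := u₂) (u' := u₁) hn hlam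
      hC ht hσ (by decide) (by linarith) ?_ ?_ l₂ l₁).congr_left fun ω => ?_
    · rw [e₂, ofReal_one, one_mul, neg_mul, Complex.exp_neg, cexp_nat_mul_log hu₂0, one_div]
    · rw [e₁, ofReal_one, one_mul, neg_mul, Complex.exp_neg, cexp_nat_mul_log hu₁0, inv_pow]
    · rw [asymptoticSum]; ring
  · refine (isBigO_soliton_sub (a := a) (σ := -1) (f := 0) (s := 1) (u := u₁) (u' := u₂) hn hlam
      hC ht hσ (by decide) (by linarith) ?_ ?_ l₁ l₂).congr_left fun ω => ?_
    · rw [e₁, ofReal_neg, ofReal_one, neg_one_mul, neg_neg, cexp_nat_mul_log hu₁0, inv_pow, one_div,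
        inv_inv]
    · rw [e₂, ofReal_neg, ofReal_one, neg_one_mul, neg_neg, cexp_nat_mul_log hu₂0]
    · rw [asymptoticSum]; ring

end Assembly

end

end HirotaSoliton

theorem theorem4p9 (γ δ : ℝ) (lam : Fin 2 → ℂ) (n : Fin 2 → ℕ) (a : Fin 2 → ℕ → ℂ)
    (hn : ∀ i, 1 ≤ n i) (hlam : ∀ i, 0 < (lam i).im)
    (hv : HirotaSoliton.velocity γ δ (lam 0) < HirotaSoliton.velocity γ δ (lam 1)) :
    (∃ K T : ℝ, 1 < T ∧ ∀ t : ℝ, T ≤ t → ∀ x : ℝ,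
      ‖HirotaSoliton.soliton γ δ lam n a x t
        - HirotaSoliton.asymptoticSum γ δ lam n a 1 x t‖ ≤ K * (Real.log t / t)) ∧
    (∃ K T : ℝ, 1 < T ∧ ∀ t : ℝ, t ≤ -T → ∀ x : ℝ,
      ‖HirotaSoliton.soliton γ δ lam n a x t
        - HirotaSoliton.asymptoticSum γ δ lam n a (-1) x t‖ ≤ K * (Real.log |t| / |t|)) := by
  constructor
  · have ht : Filter.Tendsto (fun ω : ℝ × ℝ => ω.1) (Filter.comap Prod.fst Filter.atTop)
        Filter.atTop := Filter.tendsto_comap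
    obtain ⟨K, hK⟩ := (HirotaSoliton.isBigO_soliton_sub_asymptoticSum (a := a) (σ := 1) hn hlam hv
      (Filter.tendsto_abs_atTop_atTop.comp ht)
      ((ht.eventually_gt_atTop 0).mono fun ω h => Or.inl ⟨rfl, h⟩) (Or.inl rfl)).bound
    obtain ⟨T, hT⟩ := Filter.eventually_atTop.1 (Filter.eventually_comap.1 hK)
    refine ⟨K, max T 2, by simp, fun t h x => ?_⟩
    have h1 := hT t ((le_max_left _ _).trans h) (t, x) rfl
    have h2 : 2 ≤ t := (le_max_right _ _).trans h
    simp only [abs_of_pos (show 0 < t by linarith)] at h1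
    rwa [Real.norm_of_nonneg (div_nonneg (Real.log_nonneg (by linarith)) (by linarith))] at h1
  · have ht : Filter.Tendsto (fun ω : ℝ × ℝ => ω.1) (Filter.comap Prod.fst Filter.atBot)
        Filter.atBot := Filter.tendsto_comap
    obtain ⟨K, hK⟩ := (HirotaSoliton.isBigO_soliton_sub_asymptoticSum (a := a) (σ := -1) hn hlam hv
      (Filter.tendsto_abs_atBot_atTop.comp ht)
      ((ht.eventually_lt_atBot 0).mono fun ω h => Or.inr ⟨rfl, h⟩) (Or.inr rfl)).bound
    obtain ⟨T, hT⟩ := Filter.eventually_atBot.1 (Filter.eventually_comap.1 hK)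
    refine ⟨K, max (-T) 2, by simp, fun t h x => ?_⟩
    have h1 := hT t (by linarith [le_max_left (-T) 2]) (t, x) rfl
    have h2 : 2 ≤ |t| := by
      have := neg_le_abs t
      linarith [le_max_right (-T) 2]
    rwa [Real.norm_of_nonneg (div_nonneg (Real.log_nonneg (by linarith)) (by linarith))] at h1
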